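/- **Setting.** Let $L>0$, $\gamma\in\mathbb R$, $J=[-L/2,L/2]$, and let $\mathfrak h_N=L^2(J^N)$ for $N\ge 0$ (so $\mathfrak h_0=\mathbb C$). Let $\mathfrak h_{\rm fin}=\bigoplus_{N\ge 0}\mathfrak h_N$ be the space of finite vectors of the Fock space (algebraic direct sum). For $0\le n\le N$ let $\mathfrak i^n_N$ be the set of $n$-tuples $\boldsymbol i=(i_1,\dots,i_n)$ of distinct elements of $\{1,\dots,N\}$. For $x\in J^N$, $\boldsymbol i\in\mathfrak i^n_N$ and $y\in J^n$ let $x_{\boldsymbol i\to y}$ be the point obtained from $x$ by replacing $x_{i_m}$ by $y_m$ for $m=1,\dots,n$. Write $\theta(t_1>\dots>t_k)$ for $1$ if the inequalities hold and $0$ otherwise, and set $x_{i_0}=L/2$ and $x_{i_{n+1}}=-L/2$ unless stated otherwise. *Integral operators.* For $\lambda\in\mathbb C$, define bounded operators between the spaces $\mathfrak h_N$ by the following formulas (valid for almost every $x$). - $a_\lambda,d_\lambda:\mathfrak h_N\to\mathfrak h_N$, $$(a_\lambda f)(x)=e^{-i\lambda L/2}\sum_{n=0}^N\gamma^n\sum_{\boldsymbol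 i\in\mathfrak i^n_N}\theta(x_{i_1}>\dots>x_{i_n})\Big(\prod_{m=1}^n\int_{x_{i_{m+1}}}^{x_{i_m}}dy_m\,e^{i\lambda(x_{i_m}-y_m)}\Big)f(x_{\boldsymbol i\to y}),$$ $$(d_\lambda f)(x)=e^{i\lambda L/2}\sum_{n=0}^N\gamma^n\sum_{\boldsymbol i\in\mathfrak i^n_N}\theta(x_{i_1}>\dots>x_{i_n})\Big(\prod_{m=1}^n\int_{x_{i_m}}^{x_{i_{m-1}}}dy_m\,e^{i\lambda(x_{i_m}-y_m)}\Big)f(x_{\boldsymbol i\to y}).$$ - $b^\pm_\lambda:\mathfrak h_N\to\mathfrak h_{N+1}$. With $x'=(x_1,\dots,x_N)$ and, in this formula only, $x_{i_0}=x_{N+1}$, $$(b^-_\lambda f)(x)=e^{i\lambda x_{N+1}}\sum_{n=0}^N\gamma^n\sum_{\boldsymbol i\in\mathfrak i^n_N}\theta(x_{N+1}>x_{i_1}>\dots>x_{i_n})\Big(\prod_{m=1}^n\int_{x_{i_m}}^{x_{i_{m-1}}}dy_m\,e^{i\lambda(x_{i_m}-y_m)}\Big)f(x'_{\boldsymbol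 i\to y}).$$ With $x''=(x_2,\dots,x_{N+1})$, so $x''_{j}=x_{j+1}$, and, in this formula only, $x''_{i_{n+1}}=x_1$, $$(b^+_\lambda f)(x)=e^{i\lambda x_1}\sum_{n=0}^N\gamma^n\sum_{\boldsymbol i\in\mathfrak i^n_N}\theta(x''_{i_1}>\dots>x''_{i_n}>x_1)\Big(\prod_{m=1}^n\int_{x''_{i_{m+1}}}^{x''_{i_m}}dy_m\,e^{i\lambda(x''_{i_m}-y_m)}\Big)f(x''_{\boldsymbol i\to y}).$$ - $c^\pm_\lambda:\mathfrak h_{N+1}\to\mathfrak h_N$, and $c^\pm_\lambda=0$ on $\mathfrak h_0$, $$(c^+_\lambda f)(x)=\sum_{n=0}^N\gamma^n\sum_{\boldsymbol i\in\mathfrak i^n_N}\theta(x_{i_1}>\dots>x_{i_n})\Big(\prod_{m=0}^n\int_{x_{i_{m+1}}}^{x_{i_m}}dy_m\Big)e^{i\lambda(\sum_{m=1}^n x_{i_m}-\sum_{m=0}^n y_m)}f\big(x_{\boldsymbol i\to(y_1,\dots,y_n)},\,y_0\big),$$ $$(c^-_\lambda f)(x)=\sum_{n=0}^N\gamma^n\sum_{\boldsymbol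 i\in\mathfrak i^n_N}\theta(x_{i_1}>\dots>x_{i_n})\Big(\prod_{m=1}^{n+1}\int_{x_{i_m}}^{x_{i_{m-1}}}dy_m\Big)e^{i\lambda(\sum_{m=1}^n x_{i_m}-\sum_{m=1}^{n+1} y_m)}f\big(y_{n+1},\,x_{\boldsymbol i\to(y_1,\dots,y_n)}\big).$$ These operators act on $\mathfrak h_{\rm fin}$ sector by sector. *Pre-wavefunctions.* Let $w\in S_N$ act on $\mathbb R^N$ by $(wx)_j=x_{w^{-1}(j)}$. Let $s_j$ be the transposition of $j$ and $j+1$. On continuous functions on $\mathbb R^N$ put $$(s_{j,\gamma}f)(x)=f(s_jx)+\gamma\int_0^{x_j-x_{j+1}}f\big(x-y(e_j-e_{j+1})\big)\,dy ,$$ and let $w_\gamma=s_{j_1,\gamma}\cdots s_{j_l,\gamma}$ if $w=s_{j_1}\cdots s_{j_l}$ (this is independent of the decomposition). For $\boldsymbol\lambda\in\mathbb C^N$ the pre-wavefunction $\psi_{\boldsymbol\lambda}$ is given by $$\psi_{\boldsymbol\lambda}(x)=(w_\gamma e^{i\boldsymbol\lambda})(wx)\qquad\text{if } (wx)_1>\dots>(wx)_N,$$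 where $e^{i\boldsymbol\lambda}(x)=e^{i\sum_j\lambda_jx_j}$. Let $\mathfrak z_N\subset\mathfrak h_N$ be the closed linear span of the (restrictions to $J^N$ of the) functions $\psi_{\boldsymbol\lambda}$, $\boldsymbol\lambda\in\mathbb C^N$, and let $\mathfrak z_{\rm fin}=\bigoplus_{N\ge0}\mathfrak z_N\subset\mathfrak h_{\rm fin}$ (algebraic direct sum). **Theorem (non-symmetric Yang–Baxter algebra).** Let $L>0$ and $\gamma\in\mathbb R$. For all $\lambda\in\mathbb C$ the operators $a_\lambda,b^\pm_\lambda,c^\pm_\lambda,d_\lambda$ restrict to linear endomorphisms of $\mathfrak z_{\rm fin}$. For all $\lambda,\mu\in\mathbb C$ one has in $\operatorname{End}(\mathfrak z_{\rm fin})$ $$[a_\lambda,a_\mu]=[b^-_\lambda,b^+_\mu]=[c^-_\lambda,c^+_\mu]=[d_\lambda,d_\mu]=0,$$ and for all $\lambda\ne\mu$ in $\mathbb C$ one has in $\operatorname{End}(\mathfrak z_{\rm fin})$ $$\begin{aligned} {}[a_\lambda,b^+_\mu]&=-\tfrac{i\gamma}{\lambda-\mu}\,(b^+_\lambda a_\mu-b^+_\mu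 a_\lambda), & [b^+_\lambda,a_\mu]&=-\tfrac{i\gamma}{\lambda-\mu}\,(a_\lambda b^+_\mu-a_\mu b^+_\lambda),\\ [d_\lambda,b^-_\mu]&=\tfrac{i\gamma}{\lambda-\mu}\,(b^-_\lambda d_\mu-b^-_\mu d_\lambda), & [b^-_\lambda,d_\mu]&=\tfrac{i\gamma}{\lambda-\mu}\,(d_\lambda b^-_\mu-d_\mu b^-_\lambda),\\ [a_\lambda,c^+_\mu]&=\tfrac{i\gamma}{\lambda-\mu}\,(c^+_\lambda a_\mu-c^+_\mu a_\lambda), & [c^+_\lambda,a_\mu]&=\tfrac{i\gamma}{\lambda-\mu}\,(a_\lambda c^+_\mu-a_\mu c^+_\lambda),\\ [d_\lambda,c^-_\mu]&=-\tfrac{i\gamma}{\lambda-\mu}\,(c^-_\lambda d_\mu-c^-_\mu d_\lambda), & [c^-_\lambda,d_\mu]&=-\tfrac{i\gamma}{\lambda-\mu}\,(d_\lambda c^-_\mu-d_\mu c^-_\lambda). \end{aligned}$$ -/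

import Mathlib

open MeasureTheory

noncomputable section

namespace QNLS

/-! ### Particle sectors -/

/-- Lebesgue measure on the cube `J ^ N`, where `J = [-L/2, L/2]`. -/
def boxMeasure (L : ℝ) (N : ℕ) : Measure (Fin N → ℝ) :=
  Measure.pi fun _ => volume.restrict (Set.Icc (-(L / 2)) (L / 2))

/-- The non-symmetric `N`-particle sector `L²(J ^ N)`. -/
abbrev Sector (L : ℝ) (N : ℕ) : Type := Lp ℂ 2 (boxMeasure L N)

/-- The class in `L²(J ^ N)` of a square-integrable function (and `0` for any other function). -/
def toSector (L : ℝ) {N : ℕ} (g : (Fin N → ℝ) → ℂ) : Sector L N :=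
  open Classical in if h : MemLp g 2 (boxMeasure L N) then h.toLp g else 0

/-- Sequences `(f_0, f_1, f_2, …)` with `f_N ∈ L²(J ^ N)`. -/
abbrev SectorSeq (L : ℝ) : Type := ∀ N : ℕ, Sector L N

/-- The finite vectors of the Fock space: sequences with only finitely many nonzero components.
(The square-summability that cuts out the Fock space holds automatically for them.) -/
def hFin (L : ℝ) : Submodule ℂ (SectorSeq L) where
  carrier := {f | ∃ M : ℕ, ∀ N, M < N → f N = 0}
  zero_mem' := ⟨0, fun _ _ => rfl⟩
  add_mem' := by
    rintro f g ⟨M, hM⟩ ⟨M', hM'⟩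
    refine ⟨max M M', fun N hN => ?_⟩
    simp [hM N (lt_of_le_of_lt (le_max_left _ _) hN), hM' N (lt_of_le_of_lt (le_max_right _ _) hN)]
  smul_mem' := by
    rintro c f ⟨M, hM⟩
    exact ⟨M, fun N hN => by simp [hM N hN]⟩

/-! ### Elementary integral operators

Multi-indices `i` with `n` distinct entries in `{1, …, N}` are embeddings `Fin n ↪ Fin N`.
For such an `i`, the function `Function.extend i y x` is the point `x` in which the coordinate
`x_{i_m}` has been replaced by `y_m`, for every `m`. In all the integrals, `y` runs through a product
of intervals whose end points are consecutive terms of a decreasing chain of coordinates of `x`. -/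

/-- `(v_2, …, v_n, b)`, for `v = (v_1, …, v_n)`. -/
def next {n : ℕ} (v : Fin n → ℝ) (b : ℝ) : Fin n → ℝ :=
  fun m => (Fin.snoc v b : Fin (n + 1) → ℝ) m.succ

/-- `(t, v_1, …, v_{n-1})`, for `v = (v_1, …, v_n)`. -/
def prev {n : ℕ} (t : ℝ) (v : Fin n → ℝ) : Fin n → ℝ :=
  fun m => (Fin.cons t v : Fin (n + 1) → ℝ) m.castSucc

/-- `exp (i ν t)`. -/
def phase (ν : ℂ) (t : ℝ) : ℂ := Complex.exp (Complex.I * ν * t)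

open Classical in
/-- `ê⁺`, with `v_m = x_{i_m + 1}`: it vanishes unless `v_1 > … > v_n > x_1`, and `y_m` runs
through `[v_{m+1}, v_m]`, where `v_{n+1} = x_1`. -/
def eHatPlus {N n : ℕ} (ν : ℂ) (i : Fin n ↪ Fin N) (f : (Fin N → ℝ) → ℂ)
    (x : Fin (N + 1) → ℝ) : ℂ :=
  let v : Fin n → ℝ := fun m => x (i m).succ
  if StrictAnti (Fin.snoc v (x 0) : Fin (n + 1) → ℝ) then
    phase ν (x 0) * ∫ y in Set.Icc (next v (x 0)) v,
      phase ν (∑ m, v m - ∑ m, y m) * f (Function.extend i y (Fin.tail x))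
  else 0

open Classical in
/-- `ê⁻`, with `v_m = x_{i_m}`: it vanishes unless `x_{N+1} > v_1 > … > v_n`, and `y_m` runs
through `[v_m, v_{m-1}]`, where `v_0 = x_{N+1}`. -/
def eHatMinus {N n : ℕ} (ν : ℂ) (i : Fin n ↪ Fin N) (f : (Fin N → ℝ) → ℂ)
    (x : Fin (N + 1) → ℝ) : ℂ :=
  let v : Fin n → ℝ := fun m => x (i m).castSucc
  if StrictAnti (Fin.cons (x (Fin.last N)) v : Fin (n + 1) → ℝ) then
    phase ν (x (Fin.last N)) * ∫ y in Set.Icc v (prev (x (Fin.last N)) v),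
      phase ν (∑ m, v m - ∑ m, y m) * f (Function.extend i y (Fin.init x))
  else 0

open Classical in
/-- `ē⁺`, with `v_m = x_{i_m}`: it vanishes unless `v_1 > … > v_n`, and `y_m` runs
through `[v_{m+1}, v_m]`, where `v_{n+1} = -L/2`. -/
def eBarPlus (L : ℝ) {N n : ℕ} (ν : ℂ) (i : Fin n ↪ Fin N) (f : (Fin N → ℝ) → ℂ)
    (x : Fin N → ℝ) : ℂ :=
  let v : Fin n → ℝ := fun m => x (i m)
  if StrictAnti v then
    phase ν (-(L / 2)) * ∫ y in Set.Icc (next v (-(L / 2))) v,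
      phase ν (∑ m, v m - ∑ m, y m) * f (Function.extend i y x)
  else 0

open Classical in
/-- `ē⁻`, with `v_m = x_{i_m}`: it vanishes unless `v_1 > … > v_n`, and `y_m` runs
through `[v_m, v_{m-1}]`, where `v_0 = L/2`. -/
def eBarMinus (L : ℝ) {N n : ℕ} (ν : ℂ) (i : Fin n ↪ Fin N) (f : (Fin N → ℝ) → ℂ)
    (x : Fin N → ℝ) : ℂ :=
  let v : Fin n → ℝ := fun m => x (i m)
  if StrictAnti v then
    phase ν (L / 2) * ∫ y in Set.Icc v (prev (L / 2) v),
      phase ν (∑ m, v m - ∑ m, y m) * f (Function.extend i y x)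
  else 0

open Classical in
/-- `ě⁺`, with `v_m = x_{i_m}`, `v_0 = L/2`, `v_{n+1} = -L/2`: it vanishes unless `v_1 > … > v_n`,
and `y = (y_0, …, y_n)` with `y_m` running through `[v_{m+1}, v_m]`. The variables `y_1, …, y_n`
replace `x_{i_1}, …, x_{i_n}`, and `y_0` is appended as the last argument of `f`. -/
def eCheckPlus (L : ℝ) {N n : ℕ} (ν : ℂ) (i : Fin n ↪ Fin N) (f : (Fin (N + 1) → ℝ) → ℂ)
    (x : Fin N → ℝ) : ℂ :=
  let v : Fin n → ℝ := fun m => x (i m)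
  if StrictAnti v then
    ∫ y in Set.Icc (Fin.snoc v (-(L / 2)) : Fin (n + 1) → ℝ) (Fin.cons (L / 2) v),
      phase ν (∑ m, v m - ∑ m, y m) *
        f (Fin.snoc (Function.extend i (Fin.tail y) x) (y 0))
  else 0

open Classical in
/-- `ě⁻`, with `v_m = x_{i_m}`, `v_0 = L/2`, `v_{n+1} = -L/2`: it vanishes unless `v_1 > … > v_n`,
and `y = (y_1, …, y_{n+1})` with `y_m` running through `[v_m, v_{m-1}]`. The variables
`y_1, …, y_n` replace `x_{i_1}, …, x_{i_n}`, and `y_{n+1}` is the new first argument of `f`. -/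
def eCheckMinus (L : ℝ) {N n : ℕ} (ν : ℂ) (i : Fin n ↪ Fin N) (f : (Fin (N + 1) → ℝ) → ℂ)
    (x : Fin N → ℝ) : ℂ :=
  let v : Fin n → ℝ := fun m => x (i m)
  if StrictAnti v then
    ∫ y in Set.Icc (Fin.snoc v (-(L / 2)) : Fin (n + 1) → ℝ) (Fin.cons (L / 2) v),
      phase ν (∑ m, v m - ∑ m, y m) *
        f (Fin.cons (y (Fin.last n)) (Function.extend i (Fin.init y) x))
  else 0

/-! ### The non-symmetric integral operators

They are defined by their integral formulas on every square-integrable function. The value is, almost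
everywhere, independent of the representative of the class in `L²`, and it is square-integrable; so
these are the bounded extensions of the operators that the formulas define on test functions. -/

/-- The formula for `a_ν`. -/
def aFun (L γ : ℝ) (ν : ℂ) {N : ℕ} (f : (Fin N → ℝ) → ℂ) (x : Fin N → ℝ) : ℂ :=
  ∑ n ∈ Finset.range (N + 1), (γ : ℂ) ^ n * ∑ i : Fin n ↪ Fin N, eBarPlus L ν i f x

/-- The formula for `d_ν`. -/
def dFun (L γ : ℝ) (ν : ℂ) {N : ℕ} (f : (Fin N → ℝ) → ℂ) (x : Fin N → ℝ) : ℂ :=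
  ∑ n ∈ Finset.range (N + 1), (γ : ℂ) ^ n * ∑ i : Fin n ↪ Fin N, eBarMinus L ν i f x

/-- The formula for `b⁺_ν`. -/
def bPlusFun (γ : ℝ) (ν : ℂ) {N : ℕ} (f : (Fin N → ℝ) → ℂ) (x : Fin (N + 1) → ℝ) : ℂ :=
  ∑ n ∈ Finset.range (N + 1), (γ : ℂ) ^ n * ∑ i : Fin n ↪ Fin N, eHatPlus ν i f x

/-- The formula for `b⁻_ν`. -/
def bMinusFun (γ : ℝ) (ν : ℂ) {N : ℕ} (f : (Fin N → ℝ) → ℂ) (x : Fin (N + 1) → ℝ) : ℂ :=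
  ∑ n ∈ Finset.range (N + 1), (γ : ℂ) ^ n * ∑ i : Fin n ↪ Fin N, eHatMinus ν i f x

/-- The formula for `c⁺_ν`. -/
def cPlusFun (L γ : ℝ) (ν : ℂ) {N : ℕ} (f : (Fin (N + 1) → ℝ) → ℂ) (x : Fin N → ℝ) : ℂ :=
  ∑ n ∈ Finset.range (N + 1), (γ : ℂ) ^ n * ∑ i : Fin n ↪ Fin N, eCheckPlus L ν i f x

/-- The formula for `c⁻_ν`. -/
def cMinusFun (L γ : ℝ) (ν : ℂ) {N : ℕ} (f : (Fin (N + 1) → ℝ) → ℂ) (x : Fin N → ℝ) : ℂ :=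
  ∑ n ∈ Finset.range (N + 1), (γ : ℂ) ^ n * ∑ i : Fin n ↪ Fin N, eCheckMinus L ν i f x

/-- The operator `a_ν`, mapping the `N`-particle sector to itself. -/
def aOp (L γ : ℝ) (ν : ℂ) (f : SectorSeq L) : SectorSeq L :=
  fun N => toSector L (aFun L γ ν (f N))

/-- The operator `d_ν`, mapping the `N`-particle sector to itself. -/
def dOp (L γ : ℝ) (ν : ℂ) (f : SectorSeq L) : SectorSeq L :=
  fun N => toSector L (dFun L γ ν (f N))

/-- The operator `b⁺_ν`, mapping the `N`-particle sector to the `(N+1)`-particle sector. -/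
def bPlusOp (L γ : ℝ) (ν : ℂ) (f : SectorSeq L) : SectorSeq L
  | 0 => 0
  | N + 1 => toSector L (bPlusFun γ ν (f N))

/-- The operator `b⁻_ν`, mapping the `N`-particle sector to the `(N+1)`-particle sector. -/
def bMinusOp (L γ : ℝ) (ν : ℂ) (f : SectorSeq L) : SectorSeq L
  | 0 => 0
  | N + 1 => toSector L (bMinusFun γ ν (f N))

/-- The operator `c⁺_ν`, mapping the `(N+1)`-particle sector to the `N`-particle sector and the
`0`-particle sector to `0`. -/
def cPlusOp (L γ : ℝ) (ν : ℂ) (f : SectorSeq L) : SectorSeq L :=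
  fun N => toSector L (cPlusFun L γ ν (f (N + 1)))

/-- The operator `c⁻_ν`, mapping the `(N+1)`-particle sector to the `N`-particle sector and the
`0`-particle sector to `0`. -/
def cMinusOp (L γ : ℝ) (ν : ℂ) (f : SectorSeq L) : SectorSeq L :=
  fun N => toSector L (cMinusFun L γ ν (f (N + 1)))

/-! ### Pre-wavefunctions -/

/-- The simple transposition that exchanges the `j`-th and the `(j+1)`-th element (counted from `0`)
of `Fin N`, where `j + 1 < N`. -/
def simpleSwap {N : ℕ} (j : {j : ℕ // j + 1 < N}) : Equiv.Perm (Fin N) :=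
  Equiv.swap ⟨j.1, Nat.lt_of_succ_lt j.2⟩ ⟨j.1 + 1, j.2⟩

theorem exists_simpleSwap_word {N : ℕ} (w : Equiv.Perm (Fin N)) :
    ∃ l : List {j : ℕ // j + 1 < N}, (l.map simpleSwap).prod = w := by
  cases N with
  | zero => exact ⟨[], Subsingleton.elim _ _⟩
  | succ n =>
    have hw : w ∈ Submonoid.closure
        (Set.range fun i : Fin n => Equiv.swap i.castSucc i.succ) := by
      rw [Equiv.Perm.mclosure_swap_castSucc_succ]; trivial
    induction hw using Submonoid.closure_induction with
    | mem w hw =>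
      obtain ⟨i, rfl⟩ := hw
      exact ⟨[⟨i.1, by omega⟩], by simp [simpleSwap]; rfl⟩
    | one => exact ⟨[], rfl⟩
    | mul v w _ _ hv hw =>
      obtain ⟨l, rfl⟩ := hv
      obtain ⟨l', rfl⟩ := hw
      exact ⟨l ++ l', by simp⟩

/-- A decomposition of `w` as a product of simple transpositions. -/
def word {N : ℕ} (w : Equiv.Perm (Fin N)) : List {j : ℕ // j + 1 < N} :=
  (exists_simpleSwap_word w).choose

/-- The integral operator `(I_{jk} f)(x) = ∫_0^{x_j - x_k} f (x - y (e_j - e_k)) dy`. -/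
def lineIntegral {N : ℕ} (j k : Fin N) (f : (Fin N → ℝ) → ℂ) (x : Fin N → ℝ) : ℂ :=
  ∫ y in (0 : ℝ)..(x j - x k), f (x - y • (Pi.single j 1 - Pi.single k 1))

/-- The deformed simple transposition `s_j + γ I_{j,j+1}` acting on functions of `x`; the symmetric
group acts by `(w f)(x) = f (w⁻¹ x)`, where `w⁻¹ x = x ∘ w`. -/
def deformedSwap (γ : ℝ) {N : ℕ} (j : {j : ℕ // j + 1 < N}) (f : (Fin N → ℝ) → ℂ)
    (x : Fin N → ℝ) : ℂ :=
  f (x ∘ simpleSwap j) +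
    γ * lineIntegral ⟨j.1, Nat.lt_of_succ_lt j.2⟩ ⟨j.1 + 1, j.2⟩ f x

/-- The deformed permutation `w_γ`: if `w` is the product of the simple transpositions
`s_{j_1}, …, s_{j_l}`, it is the composition of the corresponding deformed ones. On continuous
functions it does not depend on the decomposition. -/
def deformedPerm (γ : ℝ) {N : ℕ} (w : Equiv.Perm (Fin N)) (f : (Fin N → ℝ) → ℂ) :
    (Fin N → ℝ) → ℂ :=
  (word w).foldr (deformedSwap γ) f

open Classical in
/-- The propagation operator: `(P_γ f)(x) = (w_γ f)(w x)` if the coordinates of `w x = x ∘ w⁻¹` are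
strictly decreasing. (A point with two equal coordinates gets the value `0`; these points are a null
set.) -/
def propagation (γ : ℝ) {N : ℕ} (f : (Fin N → ℝ) → ℂ) (x : Fin N → ℝ) : ℂ :=
  ∑ w : Equiv.Perm (Fin N),
    if StrictAnti (x ∘ (w⁻¹ : Equiv.Perm (Fin N))) then
      deformedPerm γ w f (x ∘ (w⁻¹ : Equiv.Perm (Fin N)))
    else 0

/-- The plane wave with wave vector `k`. -/
def planeWave {N : ℕ} (k : Fin N → ℂ) (x : Fin N → ℝ) : ℂ :=
  Complex.exp (Complex.I * ∑ j, k j * x j)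

/-- The pre-wavefunction `ψ_k = P_γ exp (i ⟨k, ·⟩)`, restricted to the cube `J ^ N`. -/
def preWave (L γ : ℝ) {N : ℕ} (k : Fin N → ℂ) : Sector L N :=
  toSector L (propagation γ (planeWave k))

/-- The closed linear span of all the pre-wavefunctions in the `N`-particle sector. -/
def zSector (L γ : ℝ) (N : ℕ) : Submodule ℂ (Sector L N) :=
  (Submodule.span ℂ (Set.range fun k : Fin N → ℂ => preWave L γ k)).topologicalClosure

/-- The finite vectors all of whose components lie in the spaces `zSector L γ N`. -/
def zFin (L γ : ℝ) : Submodule ℂ (SectorSeq L) :=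
  hFin L ⊓ Submodule.pi Set.univ fun N => zSector L γ N

end QNLS

end

open QNLS

noncomputable section

namespace QNLS

/-! ### Phases -/

/-! Everything reduces to one operator, `b⁺`. As a function of the position `t` of the new particle
and of the configuration `x` of the others, `b⁺_ν f` is the unique solution `create γ ν f` of a
Duhamel-type equation (`duhamel`): free propagation `phase ν t * f x`, plus, for each coordinate
`x_j` above `t`, a term in which the new particle sits at `x_j` and the old one is moved to some `y`
in between. Each such move leaves fewer coordinates above the new particle, so the equation is
solved by finite iteration, and the explicit multi-index sum is this iteration unrolled
(`bPlusFun_cons`).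

For two creations at positions `s`, `t`, differentiating the integral equation from the right gives
an ODE whose boundary terms are the same objects with fewer coordinates above. The collision of the
two new particles with each other contributes one extra term, and balancing it forces the
coefficient `γ / (i (l - m))`. Induction on the number of coordinates above the lower particle gives
the exchange relation (`exchange`) and symmetry in the momenta at coinciding positions
(`create₂_diag`). Since `a_ν` is `b⁺_ν` with the new particle frozen at `-L/2`, putting one or both
particles there yields the relations of `a` with `b⁺` and of `a` with itself.

The other relations come from two symmetries. Reflection of the cube turns `b⁺_ν, a_ν` into
`b⁻_{-ν}, d_{-ν}`. Transposition for the bilinear pairing `∫ g f` sends `a_ν` to `d_{-ν}`, `b⁺_ν` to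
`c⁻_{-ν}` and `b⁻_ν` to `c⁺_{-ν}`; kernel by kernel this says that the interlacing conditions on the
integration variables are symmetric up to null sets.

Commutation of `b⁻` and `b⁺` is different in nature. Both `b⁺_{k_1} ⋯ b⁺_{k_N}` and `b⁻_{k_N} ⋯
b⁻_{k_1}` applied to the vacuum equal `ψ_k`: each is a plane wave on the fundamental chamber and
transforms under simple transpositions by the exchange relation, which determines it
(`IsWaveFamily`). So `b⁺` prepends a momentum and `b⁻` appends one, and these operations commute on
all `ψ_k`. To conclude for bounded operators on the whole sector, the `ψ_k` are shown to be total
(`zSector_eq_top`): plane waves are uniformly dense by Stone–Weierstrass, and in a sup norm with a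
steep Gaussian weight the passage from plane waves to pre-wavefunctions is a small perturbation of
the identity, so a Neumann-type iteration applies. Totality also makes `zFin` the space of all
finite vectors, so that invariance is immediate. Transposing the last relation gives that of `c⁻`
and `c⁺`. -/

theorem phase_add (ν : ℂ) (s t : ℝ) : phase ν (s + t) = phase ν s * phase ν t := by
  simp only [phase, ← Complex.exp_add]; push_cast; ring_nf

theorem phase_zero (ν : ℂ) : phase ν 0 = 1 := by simp [phase]

theorem phase_ne_zero (ν : ℂ) (t : ℝ) : phase ν t ≠ 0 := Complex.exp_ne_zero _

theorem phase_neg_mul_self (ν : ℂ) (t : ℝ) : phase ν (-t) * phase ν t = 1 := by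
  rw [← phase_add, neg_add_cancel, phase_zero]

theorem phase_sub (ν : ℂ) (s t : ℝ) : phase ν (s - t) = phase ν s * phase ν (-t) := by
  rw [sub_eq_add_neg, phase_add]

theorem phase_momentum_add (ν ν' : ℂ) (t : ℝ) :
    phase (ν + ν') t = phase ν t * phase ν' t := by
  simp only [phase, ← Complex.exp_add]; ring_nf

theorem phase_neg_momentum (ν : ℂ) (t : ℝ) : phase (-ν) t = phase ν (-t) := by
  simp only [phase]; push_cast; ring_nf

@[fun_prop]
theorem continuous_phase {X : Type*} [TopologicalSpace X] {ν : X → ℂ} {t : X → ℝ}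
    (hν : Continuous ν) (ht : Continuous t) : Continuous fun x => phase (ν x) (t x) := by
  unfold phase; fun_prop

theorem hasDerivAt_phase_neg (ν : ℂ) (t : ℝ) :
    HasDerivAt (fun t : ℝ => phase ν (-t)) (-(Complex.I * ν) * phase ν (-t)) t := by
  have h1 : HasDerivAt (fun t : ℝ => (-(Complex.I * ν)) * (t : ℂ)) (-(Complex.I * ν)) t := by
    simpa using (Complex.ofRealCLM.hasDerivAt (x := t)).const_mul (-(Complex.I * ν))
  have h2 := h1.cexp
  simp only [phase]
  convert h2 using 1
  · ext t; push_cast; ring_nf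
  · push_cast; ring_nf

/-! ### Calculus of parametric integrals -/

theorem continuous_intervalIntegral {X : Type*} [TopologicalSpace X] [FirstCountableTopology X]
    {a b : X → ℝ} {f : X → ℝ → ℂ}
    (ha : Continuous a) (hb : Continuous b) (hf : Continuous fun p : X × ℝ => f p.1 p.2) :
    Continuous fun x => ∫ y in (a x)..(b x), f x y := by
  have hf' : Continuous (Function.uncurry f) := hf
  have h (x : X) : ∫ y in (a x)..(b x), f x y =
      (∫ y in (0 : ℝ)..(b x), f x y) - ∫ y in (0 : ℝ)..(a x), f x y := by
    have hc : Continuous (f x) := hf.comp (Continuous.prodMk_right x)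
    rw [intervalIntegral.integral_interval_sub_left] <;> exact hc.intervalIntegrable _ _
  simp only [h]
  exact (intervalIntegral.continuous_parametric_intervalIntegral_of_continuous hf' hb).sub
    (intervalIntegral.continuous_parametric_intervalIntegral_of_continuous hf' ha)

theorem intervalIntegral_swap {f : ℝ → ℝ → ℂ} (hf : Continuous fun p : ℝ × ℝ => f p.1 p.2)
    (a b c d : ℝ) :
    ∫ y in a..b, ∫ z in c..d, f y z = ∫ z in c..d, ∫ y in a..b, f y z := by
  apply intervalIntegral_intervalIntegral_swap
  have hf' : Continuous (Function.uncurry f) := hf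
  exact (hf'.continuousOn.integrableOn_compact (isCompact_uIcc.prod isCompact_uIcc)).mono_set
    (Set.prod_mono Set.uIoc_subset_uIcc Set.uIoc_subset_uIcc)

/-- The right derivative of a primitive that is cut off at `a`. -/
theorem hasDerivWithinAt_integral_min {f : ℝ → ℂ} (hf : Continuous f) (a t : ℝ) :
    HasDerivWithinAt (fun t => ∫ y in (min t a)..a, f y) (if t < a then -f t else 0)
      (Set.Ici t) t := by
  split_ifs with h
  · have h1 : HasDerivAt (fun t => ∫ y in t..a, f y) (-f t) t :=
      intervalIntegral.integral_hasDerivAt_left (hf.intervalIntegrable _ _)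
        (hf.stronglyMeasurableAtFilter _ _) hf.continuousAt
    refine (h1.congr_of_eventuallyEq ?_).hasDerivWithinAt
    filter_upwards [eventually_lt_nhds h] with s hs
    rw [min_eq_left hs.le]
  · refine (hasDerivWithinAt_const t _ (0 : ℂ)).congr_of_mem ?_ Set.self_mem_Ici
    intro s hs
    rw [min_eq_right ((not_lt.1 h).trans hs), intervalIntegral.integral_same]

/-- Over an interval that shrinks to a point, the dependence of the integrand on `s` does not
contribute to first order, so joint continuity suffices and no derivative of `f` in its first
argument is needed. -/
theorem hasDerivAt_integral_diag {f : ℝ → ℝ → ℂ} (hf : Continuous fun p : ℝ × ℝ => f p.1 p.2)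
    (t : ℝ) : HasDerivAt (fun s => ∫ y in t..s, f s y) (f t t) t := by
  have h0 : ∫ y in t..t, f t y = 0 := intervalIntegral.integral_same
  rw [hasDerivAt_iff_isLittleO, h0]
  rw [Asymptotics.isLittleO_iff]
  intro c hc
  have hcont := Metric.continuous_iff.1 hf (t, t) c hc
  obtain ⟨δ, hδ, h⟩ := hcont
  filter_upwards [Metric.ball_mem_nhds t hδ] with s hs
  have hs' : |s - t| < δ := by simpa [Real.dist_eq] using hs
  have hc1 : Continuous (f s) := hf.comp (Continuous.prodMk_right s)
  have : (∫ y in t..s, f s y) - 0 - (s - t) • f t t = ∫ y in t..s, (f s y - f t t) := by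
    rw [intervalIntegral.integral_sub (hc1.intervalIntegrable _ _) (by simp)]
    simp
  rw [this]
  refine intervalIntegral.norm_integral_le_of_norm_le_const fun y hy => ?_
  have hy' : |y - t| ≤ |s - t| := by
    have := Set.uIoc_subset_uIcc hy
    exact Set.abs_sub_left_of_mem_uIcc this
  have h3 := h (s, y) (by
    rw [Prod.dist_eq, Real.dist_eq, Real.dist_eq]; exact max_lt hs' (hy'.trans_lt hs'))
  rw [← dist_eq_norm]; exact h3.le

/-! ### The integral equation of particle creation -/

/-- The right-hand side of the integral equation whose solution is `b⁺_ν f`; the first argument of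
`g` is the position of the new particle. -/
def duhamel (γ : ℝ) (ν : ℂ) {N : ℕ} (f : (Fin N → ℝ) → ℂ) (g : ℝ → (Fin N → ℝ) → ℂ)
    (t : ℝ) (x : Fin N → ℝ) : ℂ :=
  phase ν t * f x + γ * ∑ j, ∫ y in (min t (x j))..(x j),
    phase ν (t - y) * g (x j) (Function.update x j y)

/-- The number of coordinates of `x` that exceed `t`. -/
def numAbove {N : ℕ} (t : ℝ) (x : Fin N → ℝ) : ℕ := (Finset.univ.filter fun j => t < x j).card

theorem numAbove_le {N : ℕ} (t : ℝ) (x : Fin N → ℝ) : numAbove t x ≤ N :=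
  (Finset.card_le_univ _).trans (by simp)

/-- The descent behind all inductions below: coordinate `j` drops out of the count, and raising the
threshold from `t` to `s` adds none. -/
theorem numAbove_update_lt {N : ℕ} {s t : ℝ} {x : Fin N → ℝ} {j : Fin N} {y : ℝ} (hj : t < x j)
    (hs : t ≤ s) (hy : y ≤ s) : numAbove s (Function.update x j y) < numAbove t x := by
  refine Finset.card_lt_card (Finset.ssubset_iff_of_subset ?_ |>.2 ⟨j, by simpa using hj, ?_⟩)
  · intro k hk
    rcases eq_or_ne k j with rfl | h
    · simpa using hj
    · simp only [Finset.mem_filter, Finset.mem_univ, true_and, Function.update_of_ne h] at hk ⊢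
      exact hs.trans_lt hk
  · simpa using hy

theorem integral_min_congr {a t : ℝ} {f g : ℝ → ℂ}
    (h : t < a → ∀ y, t ≤ y → y ≤ a → f y = g y) :
    ∫ y in (min t a)..a, f y = ∫ y in (min t a)..a, g y := by
  rcases lt_or_ge t a with hta | hta
  · rw [min_eq_left hta.le]
    refine intervalIntegral.integral_congr fun y hy => ?_
    rw [Set.uIcc_of_le hta.le] at hy
    exact h hta y hy.1 hy.2
  · rw [min_eq_right hta, intervalIntegral.integral_same, intervalIntegral.integral_same]

theorem duhamel_congr {γ : ℝ} {ν : ℂ} {N : ℕ} {f : (Fin N → ℝ) → ℂ}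
    {g g' : ℝ → (Fin N → ℝ) → ℂ} {t : ℝ} {x : Fin N → ℝ}
    (h : ∀ j, t < x j → ∀ y, t ≤ y → y ≤ x j →
      g (x j) (Function.update x j y) = g' (x j) (Function.update x j y)) :
    duhamel γ ν f g t x = duhamel γ ν f g' t x := by
  unfold duhamel
  congr 2
  refine Finset.sum_congr rfl fun j _ => integral_min_congr fun hj y hy hy' => ?_
  rw [h j hj y hy hy']

/-- Every application evaluates its argument only at configurations with fewer coordinates above the
new particle. After more iterations than there are such coordinates the starting function is never
consulted; existence and uniqueness of the fixed point follow. -/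
theorem iterate_duhamel_eq {γ : ℝ} {ν : ℂ} {N : ℕ} {f : (Fin N → ℝ) → ℂ} (n m : ℕ)
    (g g' : ℝ → (Fin N → ℝ) → ℂ) (t : ℝ) (x : Fin N → ℝ)
    (hn : numAbove t x < n) (hm : numAbove t x < m) :
    (duhamel γ ν f)^[n] g t x = (duhamel γ ν f)^[m] g' t x := by
  induction n generalizing m t x with
  | zero => omega
  | succ n ih =>
    obtain ⟨m, rfl⟩ : ∃ m', m = m' + 1 := ⟨m - 1, by omega⟩
    rw [Function.iterate_succ_apply', Function.iterate_succ_apply']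
    refine duhamel_congr fun j hj y hy hy' => ?_
    have := numAbove_update_lt hj hj.le hy'
    exact ih _ _ _ (by omega) (by omega)

/-- The solution of the integral equation of particle creation. -/
def create (γ : ℝ) (ν : ℂ) {N : ℕ} (f : (Fin N → ℝ) → ℂ) : ℝ → (Fin N → ℝ) → ℂ :=
  (duhamel γ ν f)^[N + 1] 0

theorem duhamel_create (γ : ℝ) (ν : ℂ) {N : ℕ} (f : (Fin N → ℝ) → ℂ) (t : ℝ) (x : Fin N → ℝ) :
    duhamel γ ν f (create γ ν f) t x = create γ ν f t x := by
  have := numAbove_le t x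
  rw [create, ← Function.iterate_succ_apply' (duhamel γ ν f)]
  exact iterate_duhamel_eq _ _ _ _ _ _ (by omega) (by omega)

theorem eq_create {γ : ℝ} {ν : ℂ} {N : ℕ} {f : (Fin N → ℝ) → ℂ} {g : ℝ → (Fin N → ℝ) → ℂ}
    (hg : ∀ t x, duhamel γ ν f g t x = g t x) : g = create γ ν f := by
  have : ∀ n, (duhamel γ ν f)^[n] g = g := fun n =>
    Function.iterate_fixed (funext fun t => funext fun x => hg t x) n
  funext t x
  have hx := numAbove_le t x
  rw [← this (N + 1), create]
  exact iterate_duhamel_eq _ _ _ _ _ _ (by omega) (by omega)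

/-- Local uniqueness: it suffices to have the integral equation on a set of configurations that is
stable under the moves that occur in the equation. -/
theorem eq_create_of_stable {γ : ℝ} {ν : ℂ} {N : ℕ} {f : (Fin N → ℝ) → ℂ}
    {g : ℝ → (Fin N → ℝ) → ℂ} (p : ℝ → (Fin N → ℝ) → Prop)
    (hp : ∀ t x, p t x → ∀ j, t < x j → ∀ y, t ≤ y → y ≤ x j → p (x j) (Function.update x j y))
    (hg : ∀ t x, p t x → duhamel γ ν f g t x = g t x) {t : ℝ} {x : Fin N → ℝ} (hx : p t x) :
    g t x = create γ ν f t x := by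
  induction hn : numAbove t x using Nat.strong_induction_on generalizing t x with
  | _ n ih =>
    rw [← hg t x hx, ← duhamel_create]
    refine duhamel_congr fun j hj y hy hy' => ?_
    exact ih _ (hn ▸ numAbove_update_lt hj hj.le hy') (hp t x hx j hj y hy hy') rfl

theorem duhamel_of_forall_le {γ : ℝ} {ν : ℂ} {N : ℕ} {f : (Fin N → ℝ) → ℂ}
    {g : ℝ → (Fin N → ℝ) → ℂ} {t : ℝ} {x : Fin N → ℝ} (h : ∀ j, x j ≤ t) :
    duhamel γ ν f g t x = phase ν t * f x := by
  rw [duhamel, Finset.sum_eq_zero, mul_zero, add_zero]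
  intro j _
  rw [min_eq_right (h j), intervalIntegral.integral_same]

theorem create_of_forall_le {γ : ℝ} {ν : ℂ} {N : ℕ} {f : (Fin N → ℝ) → ℂ} {t : ℝ}
    {x : Fin N → ℝ} (h : ∀ j, x j ≤ t) : create γ ν f t x = phase ν t * f x := by
  rw [← duhamel_create, duhamel_of_forall_le h]

theorem continuous_duhamel {X : Type*} [TopologicalSpace X] [FirstCountableTopology X] (γ : ℝ)
    {N : ℕ} {ν : X → ℂ} {f : X → (Fin N → ℝ) → ℂ} {g : X → ℝ → (Fin N → ℝ) → ℂ}
    (hν : Continuous ν) (hf : Continuous fun p : X × (Fin N → ℝ) => f p.1 p.2)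
    (hg : Continuous fun p : X × ℝ × (Fin N → ℝ) => g p.1 p.2.1 p.2.2) :
    Continuous fun p : X × ℝ × (Fin N → ℝ) => duhamel γ (ν p.1) (f p.1) (g p.1) p.2.1 p.2.2 := by
  unfold duhamel
  refine Continuous.add ?_ (continuous_const.mul (continuous_finsetSum _ fun j _ => ?_))
  · exact (continuous_phase (by fun_prop) (by fun_prop)).mul
      (hf.comp (by fun_prop : Continuous fun p : X × ℝ × (Fin N → ℝ) => (p.1, p.2.2)))
  · refine continuous_intervalIntegral (by fun_prop) (by fun_prop) ?_
    refine (continuous_phase (by fun_prop) (by fun_prop)).mul ?_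
    exact hg.comp (by fun_prop :
      Continuous fun q : (X × ℝ × (Fin N → ℝ)) × ℝ =>
        (q.1.1, q.1.2.2 j, Function.update q.1.2.2 j q.2))

theorem continuous_create_param {X : Type*} [TopologicalSpace X] [FirstCountableTopology X] (γ : ℝ)
    {N : ℕ} {ν : X → ℂ} {f : X → (Fin N → ℝ) → ℂ}
    (hν : Continuous ν) (hf : Continuous fun p : X × (Fin N → ℝ) => f p.1 p.2) :
    Continuous fun p : X × ℝ × (Fin N → ℝ) => create γ (ν p.1) (f p.1) p.2.1 p.2.2 := by
  unfold create
  induction N + 1 with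
  | zero => simp only [Function.iterate_zero, id, Pi.zero_apply]; exact continuous_const
  | succ n ih =>
    simp only [Function.iterate_succ_apply']
    exact continuous_duhamel γ (g := fun q => (duhamel γ (ν q) (f q))^[n] 0) hν hf ih

attribute [irreducible] create

theorem continuous_create (γ : ℝ) (ν : ℂ) {N : ℕ} {f : (Fin N → ℝ) → ℂ} (hf : Continuous f) :
    Continuous fun p : ℝ × (Fin N → ℝ) => create γ ν f p.1 p.2 := by
  have hf' : Continuous fun p : Unit × (Fin N → ℝ) => (fun _ : Unit => f) p.1 p.2 :=
    hf.comp continuous_snd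
  have h := continuous_create_param (X := Unit) γ (ν := fun _ => ν) (f := fun _ => f)
    continuous_const hf'
  exact h.comp (by fun_prop : Continuous fun p : ℝ × (Fin N → ℝ) => ((), p))

/-- A particle below the created one is a spectator. -/
theorem create_cons_of_le (γ : ℝ) (ν : ℂ) {N : ℕ} (F : (Fin (N + 1) → ℝ) → ℂ) {t a : ℝ}
    (x : Fin N → ℝ) (ha : a ≤ t) :
    create γ ν F t (Fin.cons a x : Fin (N + 1) → ℝ) =
      create γ ν (fun x => F (Fin.cons a x)) t x := by
  -- The created particle only ever moves up, so `a ≤ t` persists, and under it the term of the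
  -- extra coordinate is an integral over a degenerate interval.
  refine eq_create_of_stable (g := fun t x => create γ ν F t (Fin.cons a x))
    (fun t _ => a ≤ t) (fun t x h j hj _ _ _ => h.trans hj.le) (fun t x h => ?_) ha
  rw [← duhamel_create γ ν F]
  simp only [duhamel, Fin.sum_univ_succ, Fin.cons_zero, Fin.cons_succ, Fin.cons_update,
    min_eq_right h, intervalIntegral.integral_same, zero_add]

/-- Creation is equivariant under permutations of the other particles. -/
theorem create_comp_perm (γ : ℝ) (ν : ℂ) {N : ℕ} (f : (Fin N → ℝ) → ℂ) (σ : Equiv.Perm (Fin N))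
    (t : ℝ) (x : Fin N → ℝ) :
    create γ ν (fun x => f (x ∘ σ)) t x = create γ ν f t (x ∘ σ) := by
  have : (fun t x => create γ ν f t (x ∘ σ)) = create γ ν (fun x => f (x ∘ σ)) := by
    refine eq_create fun t x => ?_
    rw [← duhamel_create γ ν f]
    simp only [duhamel]
    congr 2
    rw [← Equiv.sum_comp σ]
    refine Finset.sum_congr rfl fun j _ => ?_
    simp only [Function.comp_apply, Function.update_comp_equiv, Equiv.symm_apply_apply]
  rw [← this]

theorem create_linear_combination (γ : ℝ) (ν : ℂ) {N : ℕ} {f g : (Fin N → ℝ) → ℂ}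
    (hf : Continuous f) (hg : Continuous g) (a b : ℂ) (t : ℝ) (x : Fin N → ℝ) :
    create γ ν (fun x => a * f x + b * g x) t x =
      a * create γ ν f t x + b * create γ ν g t x := by
  have : (fun t x => a * create γ ν f t x + b * create γ ν g t x) =
      create γ ν (fun x => a * f x + b * g x) := by
    refine eq_create fun t x => ?_
    rw [← duhamel_create γ ν f t x, ← duhamel_create γ ν g t x]
    have h1 : ∀ j, Continuous fun y =>
        phase ν (t - y) * create γ ν f (x j) (Function.update x j y) := fun j =>
      (by fun_prop : Continuous fun y => phase ν (t - y)).mul ((continuous_create γ ν hf).comp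
        (by fun_prop : Continuous fun y => (x j, Function.update x j y)))
    have h2 : ∀ j, Continuous fun y =>
        phase ν (t - y) * create γ ν g (x j) (Function.update x j y) := fun j =>
      (by fun_prop : Continuous fun y => phase ν (t - y)).mul ((continuous_create γ ν hg).comp
        (by fun_prop : Continuous fun y => (x j, Function.update x j y)))
    have h3 : ∀ j, ∫ y in (min t (x j))..(x j), phase ν (t - y) *
        (a * create γ ν f (x j) (Function.update x j y) +
          b * create γ ν g (x j) (Function.update x j y)) =
        a * (∫ y in (min t (x j))..(x j),
          phase ν (t - y) * create γ ν f (x j) (Function.update x j y)) +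
        b * ∫ y in (min t (x j))..(x j),
          phase ν (t - y) * create γ ν g (x j) (Function.update x j y) := fun j => by
      rw [← intervalIntegral.integral_const_mul, ← intervalIntegral.integral_const_mul,
        ← intervalIntegral.integral_add (((h1 j).const_mul a).intervalIntegrable _ _)
          (((h2 j).const_mul b).intervalIntegrable _ _)]
      exact intervalIntegral.integral_congr fun y _ => by ring
    simp only [duhamel, h3, Finset.sum_add_distrib, ← Finset.mul_sum]
    ring
  rw [← this]

/-! ### Two creation operators -/

/-- `b⁺_l b⁺_m f`, as a function of the positions `s`, `t` of the two new particles. -/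
def create₂ (γ : ℝ) (l m : ℂ) {N : ℕ} (f : (Fin N → ℝ) → ℂ) (s t : ℝ) (x : Fin N → ℝ) : ℂ :=
  create γ l (fun z : Fin (N + 1) → ℝ => create γ m f (z 0) (Fin.tail z)) s
    (Fin.cons t x : Fin (N + 1) → ℝ)

theorem continuous_create₂ (γ : ℝ) (l m : ℂ) {N : ℕ} {f : (Fin N → ℝ) → ℂ} (hf : Continuous f) :
    Continuous fun p : ℝ × ℝ × (Fin N → ℝ) => create₂ γ l m f p.1 p.2.1 p.2.2 := by
  have h1 : Continuous fun z : Fin (N + 1) → ℝ => create γ m f (z 0) (Fin.tail z) :=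
    (continuous_create γ m hf).comp (by unfold Fin.tail; fun_prop :
      Continuous fun z : Fin (N + 1) → ℝ => (z 0, Fin.tail z))
  exact (continuous_create γ l h1).comp (by fun_prop : Continuous
    fun p : ℝ × ℝ × (Fin N → ℝ) => (p.1, (Fin.cons p.2.1 p.2.2 : Fin (N + 1) → ℝ)))

theorem Continuous.create₂ {X : Type*} [TopologicalSpace X] {γ : ℝ} {l m : ℂ} {N : ℕ}
    {f : (Fin N → ℝ) → ℂ} (hf : Continuous f) {s t : X → ℝ} {x : X → Fin N → ℝ}
    (hs : Continuous s) (ht : Continuous t) (hx : Continuous x) :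
    Continuous fun p => create₂ γ l m f (s p) (t p) (x p) :=
  (continuous_create₂ γ l m hf).comp (hs.prodMk (ht.prodMk hx))

theorem Continuous.create {X : Type*} [TopologicalSpace X] {γ : ℝ} {l : ℂ} {N : ℕ}
    {f : (Fin N → ℝ) → ℂ} (hf : Continuous f) {t : X → ℝ} {x : X → Fin N → ℝ}
    (ht : Continuous t) (hx : Continuous x) :
    Continuous fun p => create γ l f (t p) (x p) :=
  (continuous_create γ l hf).comp (ht.prodMk hx)

/-- The inner particle is one of the coordinates that the outer one can hit. This collision puts the
outer particle at `t` and the inner one at `y`; it is the source of the coefficient in the exchange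
relation. -/
theorem create₂_eq (γ : ℝ) (l m : ℂ) {N : ℕ} (f : (Fin N → ℝ) → ℂ) (s t : ℝ) (x : Fin N → ℝ) :
    create₂ γ l m f s t x = phase l s * create γ m f t x +
      γ * ((∫ y in (min s t)..t, phase l (s - y) * create₂ γ l m f t y x) +
        ∑ j, ∫ y in (min s (x j))..(x j),
          phase l (s - y) * create₂ γ l m f (x j) t (Function.update x j y)) := by
  unfold create₂
  rw [← duhamel_create]
  simp only [duhamel, Fin.sum_univ_succ, Fin.cons_zero, Fin.cons_succ, Fin.update_cons_zero,
    Fin.cons_update, Fin.tail_cons]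

theorem phase_mul_create (γ : ℝ) (m : ℂ) {N : ℕ} (f : (Fin N → ℝ) → ℂ) (t : ℝ)
    (x : Fin N → ℝ) : phase m (-t) * create γ m f t x = f x +
      γ * ∑ j, ∫ y in (min t (x j))..(x j),
        phase m (-y) * create γ m f (x j) (Function.update x j y) := by
  rw [← duhamel_create, duhamel, mul_add, ← mul_assoc, phase_neg_mul_self, one_mul, mul_left_comm,
    Finset.mul_sum]
  congr 3; funext j
  rw [← intervalIntegral.integral_const_mul]
  refine intervalIntegral.integral_congr fun y _ => ?_
  simp only [phase_sub, ← mul_assoc, phase_neg_mul_self, one_mul]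

theorem phase_mul_create_sub (γ : ℝ) (m : ℂ) {N : ℕ} {f : (Fin N → ℝ) → ℂ} (hf : Continuous f)
    (a b : ℝ) (x : Fin N → ℝ) :
    phase m (-a) * create γ m f a x - phase m (-b) * create γ m f b x =
      γ * ∑ j, ∫ y in (min a (x j))..(min b (x j)),
        phase m (-y) * create γ m f (x j) (Function.update x j y) := by
  rw [phase_mul_create, phase_mul_create, add_sub_add_left_eq_sub, ← mul_sub,
    ← Finset.sum_sub_distrib]
  congr 2; funext j
  have hc : Continuous fun y => phase m (-y) * create γ m f (x j) (Function.update x j y) :=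
    (by fun_prop : Continuous fun y => phase m (-y)).mul
      (Continuous.create hf (by fun_prop) (by fun_prop))
  rw [sub_eq_iff_eq_add, intervalIntegral.integral_add_adjacent_intervals] <;>
    exact hc.intervalIntegrable _ _

theorem create₂_of_le (γ : ℝ) (l m : ℂ) {N : ℕ} (f : (Fin N → ℝ) → ℂ) {s t : ℝ} (h : t ≤ s)
    (x : Fin N → ℝ) :
    create₂ γ l m f s t x = phase l s * create γ m f t x +
      γ * ∑ j, ∫ y in (min s (x j))..(x j),
          phase l (s - y) * create₂ γ l m f (x j) t (Function.update x j y) := by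
  rw [create₂_eq, min_eq_right h, intervalIntegral.integral_same, zero_add]

/-- The integral equation in the second position, below the first one. -/
theorem phase_mul_create₂_sub (γ : ℝ) (l m : ℂ) {N : ℕ} {f : (Fin N → ℝ) → ℂ}
    (hf : Continuous f) {a b s : ℝ} (hab : a ≤ b) (hbs : b ≤ s) (x : Fin N → ℝ) :
    phase m (-a) * create₂ γ l m f s a x - phase m (-b) * create₂ γ l m f s b x =
      γ * ∑ k, ∫ y in (min a (x k))..(min b (x k)),
        phase m (-y) * create₂ γ l m f s (x k) (Function.update x k y) := by
  induction hn : numAbove s x using Nat.strong_induction_on generalizing s x with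
  | _ n ih =>
  -- The integrand of a double move: the outer particle hits coordinate `j` and leaves `z` there,
  -- then the inner one hits coordinate `k` and leaves `y`. Both sides produce the same double
  -- integrals of `W`, in opposite orders of integration.
  set W : Fin N → Fin N → ℝ → ℝ → ℂ := fun j k z y => phase l (s - z) * (phase m (-y) *
    create₂ γ l m f (x j) (Function.update x j z k)
      (Function.update (Function.update x j z) k y)) with hW
  have hWc : ∀ j k, Continuous fun p : ℝ × ℝ => W j k p.1 p.2 := fun j k =>
    (by fun_prop : Continuous fun p : ℝ × ℝ => phase l (s - p.1)).mul
      ((by fun_prop : Continuous fun p : ℝ × ℝ => phase m (-p.2)).mul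
        (Continuous.create₂ hf (by fun_prop) (by fun_prop) (by fun_prop)))
  have hWs : ∀ j k, Continuous fun p : ℝ × ℝ => W j k p.2 p.1 := fun j k =>
    (hWc j k).comp (continuous_snd.prodMk continuous_fst)
  have hc : ∀ (j : Fin N) (a : ℝ), Continuous fun z => phase l (s - z) *
      create₂ γ l m f (x j) a (Function.update x j z) := fun j a =>
    (by fun_prop : Continuous fun z => phase l (s - z)).mul
      (Continuous.create₂ hf (by fun_prop) (by fun_prop) (by fun_prop))
  have hL : ∀ j, phase m (-a) * (∫ z in (min s (x j))..(x j), phase l (s - z) *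
        create₂ γ l m f (x j) a (Function.update x j z)) -
      phase m (-b) * (∫ z in (min s (x j))..(x j), phase l (s - z) *
        create₂ γ l m f (x j) b (Function.update x j z)) =
      γ * ∑ k, ∫ z in (min s (x j))..(x j), ∫ y in (min a (x k))..(min b (x k)), W j k z y := by
    intro j
    rw [← intervalIntegral.integral_const_mul, ← intervalIntegral.integral_const_mul,
      ← intervalIntegral.integral_sub (((hc j a).const_mul _).intervalIntegrable _ _)
        (((hc j b).const_mul _).intervalIntegrable _ _),
      ← intervalIntegral.integral_finsetSum, ← intervalIntegral.integral_const_mul]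
    · refine integral_min_congr fun hj z hz hz' => ?_
      have := ih _ (hn ▸ numAbove_update_lt hj hj.le hz') (hbs.trans hj.le)
        (Function.update x j z) rfl
      rw [mul_left_comm, mul_left_comm (phase m (-b)), ← mul_sub, this, mul_left_comm,
        Finset.mul_sum]
      congr 2; funext k
      rw [← intervalIntegral.integral_const_mul]
      -- The outer move may change coordinate `k`, on which the limits depend. For `k = j` the old
      -- and the new value both lie at or above `s ≥ b`, so the cutoffs return `a` and `b` in either
      -- case.
      rcases eq_or_ne k j with rfl | hk
      · rw [Function.update_self, min_eq_left (hab.trans (hbs.trans hz)),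
          min_eq_left (hbs.trans hz), min_eq_left (hab.trans (hbs.trans hj.le)),
          min_eq_left (hbs.trans hj.le)]
        simp only [hW, Function.update_self]
      · simp only [hW, Function.update_of_ne hk]
    · intro k _
      exact (continuous_intervalIntegral continuous_const continuous_const
        (hWc j k)).intervalIntegrable _ _
  have hR : ∀ k, ∫ y in (min a (x k))..(min b (x k)),
        phase m (-y) * create₂ γ l m f s (x k) (Function.update x k y) =
      phase l s * (∫ y in (min a (x k))..(min b (x k)),
        phase m (-y) * create γ m f (x k) (Function.update x k y)) +
      γ * ∑ j, ∫ z in (min s (x j))..(x j), ∫ y in (min a (x k))..(min b (x k)), W j k z y := by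
    intro k
    have h1 : Continuous fun y => phase m (-y) * create γ m f (x k) (Function.update x k y) :=
      (by fun_prop : Continuous fun y => phase m (-y)).mul
        (Continuous.create hf (by fun_prop) (by fun_prop))
    simp only [intervalIntegral_swap (hWc _ k)]
    rw [← intervalIntegral.integral_const_mul, ← intervalIntegral.integral_finsetSum,
      ← intervalIntegral.integral_const_mul, ← intervalIntegral.integral_add]
    · refine intervalIntegral.integral_congr fun y hy => ?_
      rw [Set.uIcc_of_le (min_le_min_right _ hab)] at hy
      have hys : y ≤ s := hy.2.trans ((min_le_left _ _).trans hbs)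
      rw [create₂_eq, mul_add, mul_left_comm, mul_left_comm _ (γ : ℂ)]
      congr 2
      -- With the inner particle at `x k` and coordinate `k` at `y ≤ s`, the summand `j = k`
      -- vanishes. The collision of the outer particle with the inner one takes exactly its place.
      rw [mul_add, Finset.mul_sum, ← Finset.add_sum_erase _ _ (Finset.mem_univ k),
        ← Finset.add_sum_erase _ _ (Finset.mem_univ k), Function.update_self, min_eq_right hys,
        intervalIntegral.integral_same, mul_zero, zero_add]
      congr 1
      · rw [← intervalIntegral.integral_const_mul]
        refine intervalIntegral.integral_congr fun z _ => ?_
        simp only [hW, Function.update_self, Function.update_idem]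
        ring
      · refine Finset.sum_congr rfl fun j hj => ?_
        have hjk := Finset.ne_of_mem_erase hj
        rw [← intervalIntegral.integral_const_mul, Function.update_of_ne hjk]
        refine intervalIntegral.integral_congr fun z _ => ?_
        simp only [hW, Function.update_of_ne hjk.symm, Function.update_comm hjk]
        ring
    · exact (h1.const_mul _).intervalIntegrable _ _
    · refine Continuous.intervalIntegrable (Continuous.const_mul (continuous_finsetSum _ fun j _ =>
        continuous_intervalIntegral continuous_const continuous_const ?_) _) _ _
      exact hWs j k
    · intro j _
      exact (continuous_intervalIntegral continuous_const continuous_const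
        (hWs j k)).intervalIntegrable _ _
  simp only [hR]
  rw [create₂_of_le γ l m f (hab.trans hbs), create₂_of_le γ l m f hbs, Finset.sum_add_distrib,
    ← Finset.mul_sum, ← Finset.mul_sum, Finset.sum_comm]
  have h1 := phase_mul_create_sub γ m hf a b x
  have h2 := Finset.sum_congr (rfl : (Finset.univ : Finset (Fin N)) = _) fun j _ => hL j
  rw [Finset.sum_sub_distrib, ← Finset.mul_sum, ← Finset.mul_sum, ← Finset.mul_sum] at h2
  linear_combination phase l s * h1 + γ * h2

/-! ### The exchange relation -/

theorem continuous_phase_neg_mul_create₂ (γ : ℝ) (l m ν : ℂ) {N : ℕ} {f : (Fin N → ℝ) → ℂ}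
    (hf : Continuous f) {X : Type*} [TopologicalSpace X] {r s t : X → ℝ} {x : X → Fin N → ℝ}
    (hr : Continuous r) (hs : Continuous s) (ht : Continuous t) (hx : Continuous x) :
    Continuous fun p => phase ν (-(r p)) * create₂ γ l m f (s p) (t p) (x p) :=
  (continuous_phase continuous_const hr.neg).mul (Continuous.create₂ hf hs ht hx)

/-- Once the free phase is removed, `s` occurs only in lower limits, so the derivative consists of
boundary terms. It is one-sided because the cutoffs `min s _` have kinks. -/
theorem hasDerivWithinAt_create₂_fst (γ : ℝ) (l m : ℂ) {N : ℕ} {f : (Fin N → ℝ) → ℂ}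
    (hf : Continuous f) (s t : ℝ) (x : Fin N → ℝ) :
    HasDerivWithinAt (fun s => phase l (-s) * create₂ γ l m f s t x)
      (γ * ((if s < t then -(phase l (-s) * create₂ γ l m f t s x) else 0) +
        ∑ j, if s < x j then
          -(phase l (-s) * create₂ γ l m f (x j) t (Function.update x j s)) else 0))
      (Set.Ici s) s := by
  have h : ∀ s, phase l (-s) * create₂ γ l m f s t x = create γ m f t x +
      γ * ((∫ y in (min s t)..t, phase l (-y) * create₂ γ l m f t y x) +
        ∑ j, ∫ y in (min s (x j))..(x j),
          phase l (-y) * create₂ γ l m f (x j) t (Function.update x j y)) := by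
    intro s
    have hs := phase_neg_mul_self l s
    rw [create₂_eq]
    simp only [phase_sub, mul_assoc, intervalIntegral.integral_const_mul, ← Finset.mul_sum]
    linear_combination (create γ m f t x +
      γ * ((∫ y in (min s t)..t, phase l (-y) * create₂ γ l m f t y x) +
        ∑ j, ∫ y in (min s (x j))..(x j),
          phase l (-y) * create₂ γ l m f (x j) t (Function.update x j y))) * hs
  simp only [h]
  refine HasDerivWithinAt.const_add _ (HasDerivWithinAt.const_mul _ (HasDerivWithinAt.add ?_
    (HasDerivWithinAt.fun_sum fun j _ => ?_)))
  · exact hasDerivWithinAt_integral_min (continuous_phase_neg_mul_create₂ γ l m l hf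
      continuous_id continuous_const continuous_id continuous_const) t s
  · exact hasDerivWithinAt_integral_min (continuous_phase_neg_mul_create₂ γ l m l hf
      continuous_id continuous_const continuous_const (by fun_prop)) (x j) s

/-- The integral equation in the second slot holds only up to the height `s` of the first particle.
It is anchored there, and `t < s` leaves room for a right neighbourhood of `t`. -/
theorem hasDerivWithinAt_create₂_snd (γ : ℝ) (l m : ℂ) {N : ℕ} {f : (Fin N → ℝ) → ℂ}
    (hf : Continuous f) {s t : ℝ} (hts : t < s) (x : Fin N → ℝ) :
    HasDerivWithinAt (fun t => phase m (-t) * create₂ γ l m f s t x)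
      (γ * ∑ j, if t < x j then
          -(phase m (-t) * create₂ γ l m f s (x j) (Function.update x j t)) else 0)
      (Set.Ici t) t := by
  have hc : ∀ j, Continuous fun y => phase m (-y) *
      create₂ γ l m f s (x j) (Function.update x j y) := fun j =>
    continuous_phase_neg_mul_create₂ γ l m m hf continuous_id continuous_const continuous_const
      (by fun_prop)
  have h1 : HasDerivWithinAt (fun t => (phase m (-s) * create₂ γ l m f s s x -
      γ * ∑ j, ∫ y in (min s (x j))..(x j),
        phase m (-y) * create₂ γ l m f s (x j) (Function.update x j y)) +
      γ * ∑ j, ∫ y in (min t (x j))..(x j),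
        phase m (-y) * create₂ γ l m f s (x j) (Function.update x j y))
      (γ * ∑ j, if t < x j then
          -(phase m (-t) * create₂ γ l m f s (x j) (Function.update x j t)) else 0)
      (Set.Ici t) t :=
    HasDerivWithinAt.const_add _ (HasDerivWithinAt.const_mul _
      (HasDerivWithinAt.fun_sum fun j _ => hasDerivWithinAt_integral_min (hc j) (x j) t))
  have h2 : ∀ t ≤ s, phase m (-t) * create₂ γ l m f s t x =
      (phase m (-s) * create₂ γ l m f s s x -
      γ * ∑ j, ∫ y in (min s (x j))..(x j),
        phase m (-y) * create₂ γ l m f s (x j) (Function.update x j y)) +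
      γ * ∑ j, ∫ y in (min t (x j))..(x j),
        phase m (-y) * create₂ γ l m f s (x j) (Function.update x j y) := by
    intro t ht
    have h3 := phase_mul_create₂_sub γ l m hf ht le_rfl x
    have h4 : ∀ j, (∫ y in (min t (x j))..(min s (x j)),
        phase m (-y) * create₂ γ l m f s (x j) (Function.update x j y)) =
        (∫ y in (min t (x j))..(x j),
        phase m (-y) * create₂ γ l m f s (x j) (Function.update x j y)) -
        ∫ y in (min s (x j))..(x j),
        phase m (-y) * create₂ γ l m f s (x j) (Function.update x j y) := fun j => by
      rw [eq_sub_iff_add_eq, intervalIntegral.integral_add_adjacent_intervals] <;>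
        exact (hc j).intervalIntegrable _ _
    simp only [h4, Finset.sum_sub_distrib] at h3
    linear_combination h3
  refine h1.congr_of_eventuallyEq ?_ (h2 t hts.le)
  filter_upwards [mem_nhdsWithin_of_mem_nhds (Iio_mem_nhds hts)] with r hr using h2 r (le_of_lt hr)

/-- Moving the second particle from `r` back to the fixed height `s` by `phase_mul_create₂_sub`
leaves a function of the first slot alone and integrals over intervals shrinking to a point. No
collision term appears at `r = s`, since its condition is strict. -/
theorem hasDerivWithinAt_create₂_diag (γ : ℝ) (l m : ℂ) {N : ℕ} {f : (Fin N → ℝ) → ℂ}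
    (hf : Continuous f) (s : ℝ) (x : Fin N → ℝ) :
    HasDerivWithinAt (fun s => phase (l + m) (-s) * create₂ γ l m f s s x)
      (γ * ∑ j, if s < x j then -(phase (l + m) (-s) *
          (create₂ γ l m f (x j) s (Function.update x j s) +
            create₂ γ l m f s (x j) (Function.update x j s))) else 0)
      (Set.Ici s) s := by
  have h1 := (hasDerivWithinAt_create₂_fst γ l m hf s s x).const_mul (phase m (-s))
  have h2 : ∀ j, HasDerivWithinAt (fun r => ∫ y in (min s (x j))..(min r (x j)),
      phase l (-r) * (phase m (-y) * create₂ γ l m f r (x j) (Function.update x j y)))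
      (if s < x j then phase l (-s) *
        (phase m (-s) * create₂ γ l m f s (x j) (Function.update x j s)) else 0)
      (Set.Ici s) s := by
    intro j
    split_ifs with h
    · have hd := hasDerivAt_integral_diag (f := fun r y => phase l (-r) * (phase m (-y) *
        create₂ γ l m f r (x j) (Function.update x j y)))
        ((by fun_prop : Continuous fun p : ℝ × ℝ => phase l (-p.1)).mul
          (continuous_phase_neg_mul_create₂ γ l m m hf continuous_snd continuous_fst
            continuous_const (by fun_prop))) s
      refine (hd.congr_of_eventuallyEq ?_).hasDerivWithinAt
      filter_upwards [eventually_lt_nhds h] with r hr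
      rw [min_eq_left hr.le, min_eq_left h.le]
    · refine (hasDerivWithinAt_const s _ (0 : ℂ)).congr_of_mem ?_ Set.self_mem_Ici
      intro r hr
      rw [min_eq_right (not_lt.1 h), min_eq_right ((not_lt.1 h).trans hr),
        intervalIntegral.integral_same]
  have h3 := h1.sub ((HasDerivWithinAt.fun_sum fun j (_ : j ∈ Finset.univ) => h2 j).const_mul
    (γ : ℂ))
  refine (h3.congr_of_mem ?_ Set.self_mem_Ici).congr_deriv ?_
  · intro r hr
    have h4 := phase_mul_create₂_sub γ l m hf (s := r) hr le_rfl x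
    simp only [Pi.sub_apply, intervalIntegral.integral_const_mul, ← Finset.mul_sum,
      phase_momentum_add]
    linear_combination (-phase l (-r)) * h4
  · simp only [lt_irrefl, if_false, zero_add, phase_momentum_add]
    rw [mul_left_comm, ← mul_sub, Finset.mul_sum, ← Finset.sum_sub_distrib]
    congr 2; funext j
    split_ifs <;> ring

/-- The coefficient in the exchange relation. -/
def exchangeCoeff (γ : ℝ) (l m : ℂ) : ℂ := γ / (Complex.I * (l - m))

theorem exchangeCoeff_swap (γ : ℝ) (l m : ℂ) : exchangeCoeff γ m l = -exchangeCoeff γ l m := by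
  rw [exchangeCoeff, exchangeCoeff, ← neg_sub l m, mul_neg, div_neg]

theorem exchangeCoeff_mul {γ : ℝ} {l m : ℂ} (h : l ≠ m) :
    exchangeCoeff γ l m * (Complex.I * (l - m)) = γ :=
  div_mul_cancel₀ _ (mul_ne_zero Complex.I_ne_zero (sub_ne_zero.2 h))

/-- The exchange relation at the positions `s`, `t`. -/
def Exchange (γ : ℝ) (l m : ℂ) {N : ℕ} (f : (Fin N → ℝ) → ℂ) (s t : ℝ) (x : Fin N → ℝ) : Prop :=
  exchangeCoeff γ l m * create₂ γ l m f s t x + (1 - exchangeCoeff γ l m) * create₂ γ m l f s t x =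
    create₂ γ l m f t s x

/-- On the pair of momentum orders the relation acts by the matrix with rows `(κ, 1 - κ)` and `(1 +
κ, -κ)`, where `κ = exchangeCoeff γ l m`; this matrix is an involution. -/
theorem Exchange.swap {γ : ℝ} {l m : ℂ} {N : ℕ} {f : (Fin N → ℝ) → ℂ} {s t : ℝ} {x : Fin N → ℝ}
    (h : Exchange γ l m f s t x) (h' : Exchange γ m l f s t x) : Exchange γ l m f t s x := by
  unfold Exchange at *
  rw [exchangeCoeff_swap] at h'
  linear_combination (-exchangeCoeff γ l m) * h - (1 - exchangeCoeff γ l m) * h'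

/-- Above all coordinates both creations are free and the two sides agree. Going down from there,
the right derivative of the difference contains only sums over the two assignments of positions,
which the exchange relations for `(l, m)` and `(m, l)` make equal for both momentum orders. -/
theorem create₂_diag_of_exchange {γ : ℝ} {l m : ℂ} {N : ℕ} {f : (Fin N → ℝ) → ℂ}
    (hf : Continuous f) {s : ℝ} {x : Fin N → ℝ}
    (h : ∀ r j, s ≤ r → r < x j → Exchange γ l m f (x j) r (Function.update x j r) ∧
      Exchange γ m l f (x j) r (Function.update x j r)) :
    create₂ γ l m f s s x = create₂ γ m l f s s x := by
  obtain ⟨T, hT⟩ : ∃ T, s ≤ T ∧ ∀ j, x j ≤ T := by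
    obtain ⟨T, hT⟩ := (Set.finite_range x).bddAbove
    exact ⟨max s T, le_max_left _ _, fun j => (hT ⟨j, rfl⟩).trans (le_max_right _ _)⟩
  have hconst := constant_of_has_deriv_right_zero (a := s) (b := T) (f := fun s =>
    phase (l + m) (-s) * create₂ γ l m f s s x - phase (m + l) (-s) * create₂ γ m l f s s x)
    (Continuous.continuousOn ?_) (fun r hr => ?_) T ⟨hT.1, le_rfl⟩
  · have htop : ∀ l m, create₂ γ l m f T T x = phase l T * (phase m T * f x) := fun l m => by
      rw [create₂, create_of_forall_le, Fin.cons_zero, Fin.tail_cons, create_of_forall_le hT.2]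
      exact Fin.cases le_rfl hT.2
    simp only [htop, add_comm m l, ← mul_sub] at hconst
    have h2 := (mul_eq_zero.1 (hconst.symm.trans (by ring))).resolve_left (phase_ne_zero _ _)
    exact sub_eq_zero.1 h2
  · exact (continuous_phase_neg_mul_create₂ γ l m _ hf continuous_id continuous_id continuous_id
      continuous_const).sub (continuous_phase_neg_mul_create₂ γ m l _ hf continuous_id
      continuous_id continuous_id continuous_const)
  · refine ((hasDerivWithinAt_create₂_diag γ l m hf r x).sub
      (hasDerivWithinAt_create₂_diag γ m l hf r x)).congr_deriv ?_
    rw [← mul_sub, ← Finset.sum_sub_distrib, Finset.sum_eq_zero, mul_zero]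
    intro j _
    split_ifs with hj
    · obtain ⟨h1, h2⟩ := h r j hr.1 hj
      unfold Exchange at h1 h2
      rw [exchangeCoeff_swap] at h2
      rw [add_comm m l]
      linear_combination phase (l + m) (-r) * (h1 - h2)
    · ring

/-- At `t = s` the relation is the symmetry `hdiag`. Below `s` the defect has zero right derivative:
the boundary terms at the coordinates cancel by `h`, and the collision term cancels against the
derivative of `phase (l - m)` because `exchangeCoeff γ l m * (i (l - m)) = γ`. -/
theorem exchange_of_le {γ : ℝ} {l m : ℂ} (hlm : l ≠ m) {N : ℕ} {f : (Fin N → ℝ) → ℂ}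
    (hf : Continuous f) {s t : ℝ} (hts : t ≤ s) {x : Fin N → ℝ}
    (hdiag : create₂ γ l m f s s x = create₂ γ m l f s s x)
    (h : ∀ r j, t ≤ r → r < s → r < x j → Exchange γ l m f s (x j) (Function.update x j r)) :
    Exchange γ l m f s t x := by
  have hsplit : ∀ r, phase l (-r) = phase (l - m) (-r) * phase m (-r) := fun r => by
    rw [← phase_momentum_add, sub_add_cancel]
  -- The whole defect is multiplied by `phase l (-t)`. In its first term the second slot carries
  -- momentum `m`, so the phase is split as `phase (l - m)` times `phase m` to match
  -- `hasDerivWithinAt_create₂_snd`.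
  have hconst := constant_of_has_deriv_right_zero (a := t) (b := s) (f := fun t =>
    (exchangeCoeff γ l m * (phase (l - m) (-t) * (phase m (-t) * create₂ γ l m f s t x)) +
      (1 - exchangeCoeff γ l m) * (phase l (-t) * create₂ γ m l f s t x)) -
      phase l (-t) * create₂ γ l m f t s x)
    (Continuous.continuousOn ?_) (fun r hr => ?_) s ⟨hts, le_rfl⟩
  · simp only [← mul_assoc (phase (l - m) _), ← hsplit, hdiag] at hconst
    have h2 : phase l (-t) * (exchangeCoeff γ l m * create₂ γ l m f s t x +
        (1 - exchangeCoeff γ l m) * create₂ γ m l f s t x - create₂ γ l m f t s x) = 0 := by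
      linear_combination -hconst
    exact sub_eq_zero.1 ((mul_eq_zero.1 h2).resolve_left (phase_ne_zero _ _))
  · refine Continuous.sub (Continuous.add (Continuous.const_mul ((by fun_prop : Continuous
      fun t : ℝ => phase (l - m) (-t)).mul ?_) _) (Continuous.const_mul ?_ _)) ?_ <;>
    exact continuous_phase_neg_mul_create₂ γ _ _ _ hf (by fun_prop) (by fun_prop) (by fun_prop)
      (by fun_prop)
  · have d1 := ((hasDerivAt_phase_neg (l - m) r).hasDerivWithinAt (s := Set.Ici r)).mul
      (hasDerivWithinAt_create₂_snd γ l m hf hr.2 x)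
    have d2 := hasDerivWithinAt_create₂_snd γ m l hf hr.2 x
    have d3 := hasDerivWithinAt_create₂_fst γ l m hf r s x
    refine (((d1.const_mul (exchangeCoeff γ l m)).add
      (d2.const_mul (1 - exchangeCoeff γ l m))).sub d3).congr_deriv ?_
    have hk := exchangeCoeff_mul (γ := γ) hlm
    have hsum : exchangeCoeff γ l m * (phase (l - m) (-r) * ∑ j, if r < x j then
          -(phase m (-r) * create₂ γ l m f s (x j) (Function.update x j r)) else 0) +
        (1 - exchangeCoeff γ l m) * (∑ j, if r < x j then
          -(phase l (-r) * create₂ γ m l f s (x j) (Function.update x j r)) else 0) =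
        ∑ j, if r < x j then
          -(phase l (-r) * create₂ γ l m f (x j) s (Function.update x j r)) else 0 := by
      simp only [Finset.mul_sum]
      rw [← Finset.sum_add_distrib]
      refine Finset.sum_congr rfl fun j _ => ?_
      split_ifs with hj
      · have h1 := h r j hr.1 hr.2 hj
        unfold Exchange at h1
        rw [hsplit]
        linear_combination (-(phase (l - m) (-r) * phase m (-r))) * h1
      · ring
    rw [if_pos hr.2, hsplit]
    rw [hsplit] at hsum
    linear_combination γ * hsum -
      phase (l - m) (-r) * phase m (-r) * create₂ γ l m f s r x * hk

/-- Induction on the number of coordinates above the lower of the two particles: all relations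
needed on the boundary terms have fewer. `Exchange.swap` reduces to the case in which the second
particle is the lower one. -/
theorem exchange_aux (γ : ℝ) {N : ℕ} {f : (Fin N → ℝ) → ℂ} (hf : Continuous f) (n : ℕ) :
    ∀ l m, l ≠ m → ∀ s t x, numAbove (min s t) x < n → Exchange γ l m f s t x := by
  induction n with
  | zero => intro l m _ s t x h; omega
  | succ n ih =>
    have hle : ∀ l m, l ≠ m → ∀ s t x, t ≤ s → numAbove t x ≤ n → Exchange γ l m f s t x := by
      intro l m hlm s t x hts hn
      -- After the move, coordinate `j` sits at `r`, not above either particle, so the induction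
      -- hypothesis applies.
      have key : ∀ r r' j, t ≤ r → r < x j → r ≤ r' → ∀ l m, l ≠ m →
          Exchange γ l m f (x j) r' (Function.update x j r) := by
        intro r r' j hr hj hr' l m hlm
        refine ih l m hlm _ _ _ (lt_of_lt_of_le ?_ hn)
        have := numAbove_update_lt (x := x) (y := r) (hr.trans_lt hj)
          (hr.trans (le_min hj.le hr')) (le_min hj.le hr')
        exact this
      refine exchange_of_le hlm hf hts (create₂_diag_of_exchange hf fun r j hr hj => ?_)
        fun r j hr hrs hj => ?_
      · exact ⟨key r r j (hts.trans hr) hj le_rfl l m hlm,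
          key r r j (hts.trans hr) hj le_rfl m l hlm.symm⟩
      · exact (key r s j hr hj hrs.le l m hlm).swap (key r s j hr hj hrs.le m l hlm.symm)
    intro l m hlm s t x hn
    rcases le_total t s with hts | hst
    · rw [min_eq_right hts] at hn
      exact hle l m hlm s t x hts (by omega)
    · rw [min_eq_left hst] at hn
      exact (hle l m hlm t s x hst (by omega)).swap (hle m l hlm.symm t s x hst (by omega))

theorem exchange (γ : ℝ) {l m : ℂ} (hlm : l ≠ m) {N : ℕ} {f : (Fin N → ℝ) → ℂ}
    (hf : Continuous f) (s t : ℝ) (x : Fin N → ℝ) : Exchange γ l m f s t x :=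
  exchange_aux γ hf _ l m hlm s t x (Nat.lt_succ_self _)

theorem create₂_diag (γ : ℝ) (l m : ℂ) {N : ℕ} {f : (Fin N → ℝ) → ℂ}
    (hf : Continuous f) (s : ℝ) (x : Fin N → ℝ) :
    create₂ γ l m f s s x = create₂ γ m l f s s x := by
  rcases eq_or_ne l m with rfl | hlm
  · rfl
  · exact create₂_diag_of_exchange hf fun _ _ _ _ => ⟨exchange γ hlm hf _ _ _,
      exchange γ hlm.symm hf _ _ _⟩

/-! ### The explicit formula for particle creation -/

theorem next_last {n : ℕ} (v : Fin (n + 1) → ℝ) (b : ℝ) : next v b (Fin.last n) = b := by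
  simp [next]

theorem init_next {n : ℕ} (v : Fin (n + 1) → ℝ) (b : ℝ) :
    Fin.init (next v b) = next (Fin.init v) (v (Fin.last n)) := by
  ext m
  simp only [Fin.init, next]
  rw [← Fin.castSucc_succ, Fin.snoc_castSucc]
  conv_lhs => rw [← Fin.snoc_init_self v]

theorem setIntegral_Icc_snoc {n : ℕ} {F : (Fin (n + 1) → ℝ) → ℂ} (hF : Continuous F)
    (a b : Fin (n + 1) → ℝ) :
    ∫ y in Set.Icc a b, F y = ∫ z in Set.Icc (a (Fin.last n)) (b (Fin.last n)),
      ∫ y in Set.Icc (Fin.init a) (Fin.init b), F (Fin.snoc y z : Fin (n + 1) → ℝ) := by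
  have hmp := (volume_preserving_piFinSuccAbove (fun _ : Fin (n + 1) => ℝ) (Fin.last n)).symm
  rw [← hmp.setIntegral_preimage_emb (MeasurableEquiv.measurableEmbedding _)]
  have hpre : (MeasurableEquiv.piFinSuccAbove (fun _ : Fin (n + 1) => ℝ) (Fin.last n)).symm ⁻¹'
      Set.Icc a b = Set.Icc (a (Fin.last n)) (b (Fin.last n)) ×ˢ
        Set.Icc (Fin.init a) (Fin.init b) := by
    ext ⟨z, y⟩
    simp only [Set.mem_preimage, Set.mem_prod, Set.mem_Icc, Pi.le_def,
      MeasurableEquiv.piFinSuccAbove_symm_apply, Fin.insertNthEquiv, Equiv.coe_fn_mk,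
      Fin.insertNth_last', Fin.forall_fin_succ', Fin.snoc_castSucc, Fin.snoc_last, Fin.init]
    tauto
  rw [hpre, Measure.volume_eq_prod, setIntegral_prod]
  · simp only [MeasurableEquiv.piFinSuccAbove_symm_apply, Fin.insertNthEquiv, Equiv.coe_fn_mk,
      Fin.insertNth_last']
  · refine ContinuousOn.integrableOn_compact (isCompact_Icc.prod isCompact_Icc)
      (Continuous.continuousOn (hF.comp ?_))
    simp only [MeasurableEquiv.piFinSuccAbove_symm_apply, Fin.insertNthEquiv, Equiv.coe_fn_mk,
      Fin.insertNth_last']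
    fun_prop

theorem extend_snoc {N n : ℕ} (i : Fin (n + 1) ↪ Fin N) (y : Fin n → ℝ) (z : ℝ)
    (x : Fin N → ℝ) :
    Function.extend i (Fin.snoc y z : Fin (n + 1) → ℝ) x =
      Function.extend (Fin.castSuccEmb.trans i) y (Function.update x (i (Fin.last n)) z) := by
  ext j
  by_cases h : ∃ m, i m = j
  · obtain ⟨m, rfl⟩ := h
    rw [i.injective.extend_apply]
    induction m using Fin.lastCases with
    | last =>
      rw [Fin.snoc_last, Function.extend_apply', Function.update_self]
      rintro ⟨m, hm⟩
      exact (Fin.castSucc_lt_last m).ne (i.injective hm)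
    | cast m =>
      rw [Fin.snoc_castSucc]
      exact ((Fin.castSuccEmb.trans i).injective.extend_apply _ _ m).symm
  · rw [Function.extend_apply' _ _ _ h, Function.extend_apply', Function.update_of_ne]
    · rintro rfl; exact h ⟨_, rfl⟩
    · rintro ⟨m, hm⟩; exact h ⟨_, hm⟩

theorem continuous_extend {N n : ℕ} (i : Fin n ↪ Fin N) :
    Continuous fun p : (Fin n → ℝ) × (Fin N → ℝ) => Function.extend i p.1 p.2 := by
  refine continuous_pi fun j => ?_
  by_cases h : ∃ m, i m = j
  · obtain ⟨m, rfl⟩ := h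
    simp only [i.injective.extend_apply]; fun_prop
  · simp only [Function.extend_apply' _ _ _ h]; fun_prop

theorem strictAnti_snoc_iff {n : ℕ} (v : Fin (n + 1) → ℝ) (t : ℝ) :
    StrictAnti (Fin.snoc v t : Fin (n + 2) → ℝ) ↔
      t < v (Fin.last n) ∧ StrictAnti v := by
  rw [Fin.strictAnti_iff_succ_lt, Fin.strictAnti_iff_succ_lt, Fin.forall_fin_succ', and_comm]
  simp only [Fin.succ_last, Fin.snoc_last, Fin.snoc_castSucc, Fin.succ_castSucc]

theorem eHatPlus_zero {N : ℕ} (ν : ℂ) (i : Fin 0 ↪ Fin N) (f : (Fin N → ℝ) → ℂ) (t : ℝ)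
    (x : Fin N → ℝ) :
    eHatPlus ν i f (Fin.cons t x : Fin (N + 1) → ℝ) = phase ν t * f x := by
  have h1 : StrictAnti (Fin.snoc (fun m => (Fin.cons t x : Fin (N + 1) → ℝ) (i m).succ)
      ((Fin.cons t x : Fin (N + 1) → ℝ) 0) : Fin (0 + 1) → ℝ) := by
    intro a b hab; omega
  have h2 : ∀ y : Fin 0 → ℝ, Function.extend i y x = x := fun y => by
    ext j; exact Function.extend_apply' _ _ _ (by rintro ⟨m, -⟩; exact m.elim0)
  rw [eHatPlus]
  simp only
  rw [if_pos h1]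
  simp only [Finset.univ_eq_empty, Finset.sum_empty, sub_zero, phase_zero, one_mul, h2,
    Fin.tail_cons, Fin.cons_zero]
  have h3 : ∀ a b : Fin 0 → ℝ, Set.Icc a b = Set.univ := fun a b => by
    ext y; simp [Subsingleton.elim a y, Subsingleton.elim b y]
  rw [h3, Measure.restrict_univ, volume_pi, Measure.pi_of_empty, integral_dirac]

/-- Only the last variable of the chain is integrated over an interval ending at `t`. With it set
aside, what remains is the same operator of one degree less, with the new particle at `x (i
(Fin.last n))` and `z` in that coordinate. -/
theorem eHatPlus_succ {N n : ℕ} (ν : ℂ) (i : Fin (n + 1) ↪ Fin N) {f : (Fin N → ℝ) → ℂ}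
    (hf : Continuous f) (t : ℝ) (x : Fin N → ℝ) :
    eHatPlus ν i f (Fin.cons t x : Fin (N + 1) → ℝ) =
      ∫ z in (min t (x (i (Fin.last n))))..(x (i (Fin.last n))),
        phase ν (t - z) * eHatPlus ν (Fin.castSuccEmb.trans i) f
          (Fin.cons (x (i (Fin.last n))) (Function.update x (i (Fin.last n)) z) :
            Fin (N + 1) → ℝ) := by
  set j := i (Fin.last n) with hj
  have hne : ∀ m : Fin n, i m.castSucc ≠ j := fun m h =>
    (Fin.castSucc_lt_last m).ne (i.injective h)
  have hv : (fun m => x (i m)) = (Fin.snoc (fun m : Fin n => x (i m.castSucc)) (x j) :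
      Fin (n + 1) → ℝ) := by
    ext m; induction m using Fin.lastCases <;> simp [hj]
  unfold eHatPlus
  simp only [Fin.cons_zero, Fin.cons_succ, Fin.tail_cons, Function.Embedding.trans_apply,
    Fin.coe_castSuccEmb, Function.update_of_ne (hne _), strictAnti_snoc_iff]
  rw [← hj]
  rcases le_or_gt (x j) t with htj | htj
  · rw [if_neg (fun h => htj.not_gt h.1), min_eq_right htj, intervalIntegral.integral_same]
  by_cases hs : StrictAnti (fun m => x (i m))
  · rw [if_pos ⟨htj, hs⟩]
    rw [hv] at hs
    simp only [if_pos hs]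
    rw [min_eq_left htj.le, intervalIntegral.integral_of_le htj.le, ← integral_Icc_eq_integral_Ioc,
      setIntegral_Icc_snoc, next_last, init_next, ← hj, ← integral_const_mul]
    · refine integral_congr_ae (Filter.Eventually.of_forall fun z => ?_)
      simp only
      rw [← integral_const_mul, ← mul_assoc, ← integral_const_mul]
      refine integral_congr_ae (Filter.Eventually.of_forall fun y => ?_)
      simp only [Fin.sum_univ_castSucc, Fin.snoc_castSucc, Fin.snoc_last, ← hj]
      rw [extend_snoc, ← hj, ← mul_assoc, ← mul_assoc, ← phase_add, ← phase_add, ← phase_add]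
      congr 2
      ring
    · exact (by fun_prop : Continuous fun y : Fin (n + 1) → ℝ =>
        phase ν (∑ m, x (i m) - ∑ m, y m)).mul (hf.comp ((continuous_extend i).comp
          (Continuous.prodMk_left x)))
  · rw [if_neg fun h => hs h.2]
    rw [hv] at hs
    simp only [if_neg hs, mul_zero, intervalIntegral.integral_zero]

theorem eHatPlus_of_mem_range {N n : ℕ} (ν : ℂ) (i : Fin n ↪ Fin N) (f : (Fin N → ℝ) → ℂ)
    {t : ℝ} {x : Fin N → ℝ} {m : Fin n} (h : x (i m) ≤ t) :
    eHatPlus ν i f (Fin.cons t x : Fin (N + 1) → ℝ) = 0 := by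
  rw [eHatPlus]
  simp only
  rw [if_neg]
  intro hs
  have := hs (Fin.castSucc_lt_last m)
  simp only [Fin.snoc_last, Fin.snoc_castSucc, Fin.cons_zero, Fin.cons_succ] at this
  exact h.not_gt this

/-- The sum of all `ê⁺` of the same degree. -/
def hatSum {N : ℕ} (ν : ℂ) (f : (Fin N → ℝ) → ℂ) (n : ℕ) (t : ℝ) (x : Fin N → ℝ) : ℂ :=
  ∑ i : Fin n ↪ Fin N, eHatPlus ν i f (Fin.cons t x : Fin (N + 1) → ℝ)

theorem hatSum_zero {N : ℕ} (ν : ℂ) (f : (Fin N → ℝ) → ℂ) (t : ℝ) (x : Fin N → ℝ) :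
    hatSum ν f 0 t x = phase ν t * f x := by
  rw [hatSum, Fintype.sum_eq_single (⟨Fin.elim0, fun a => a.elim0⟩ : Fin 0 ↪ Fin N)]
  · exact eHatPlus_zero ν _ f t x
  · intro i hi; exact absurd (Subsingleton.elim _ _) hi


/-- An embedding of `Fin (n + 1)` is its last value `j` together with an embedding `i` that avoids
`j`. The remaining pairs may be included for free: there coordinate `j` has become `z ≤ x j`, so the
chain condition above `x j` fails. -/
theorem hatSum_succ_aux {N : ℕ} (ν : ℂ) {f : (Fin N → ℝ) → ℂ} (hf : Continuous f) (n : ℕ)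
    (t : ℝ) (x : Fin N → ℝ) :
    hatSum ν f (n + 1) t x = ∑ j, ∑ i : Fin n ↪ Fin N, ∫ z in (min t (x j))..(x j),
      phase ν (t - z) * eHatPlus ν i f
        (Fin.cons (x j) (Function.update x j z) : Fin (N + 1) → ℝ) := by
  rw [hatSum, ← Fintype.sum_prod_type']
  refine Finset.sum_of_injOn
    (fun i : Fin (n + 1) ↪ Fin N => (i (Fin.last n), Fin.castSuccEmb.trans i))
    ?_ (fun _ _ => Finset.mem_coe.2 (Finset.mem_univ _)) ?_ ?_
  · intro i _ i' _ h
    simp only [Prod.mk.injEq] at h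
    refine DFunLike.ext _ _ fun m => ?_
    induction m using Fin.lastCases with
    | last => exact h.1
    | cast m => exact DFunLike.congr_fun h.2 m
  · rintro ⟨j, i⟩ _ hi
    simp only
    -- Otherwise `Fin.snoc i j` would be an embedding mapped to this pair.
    have hj : ∃ m, i m = j := by
      by_contra hj
      push Not at hj
      refine hi ⟨⟨Fin.snoc i j, ?_⟩, Finset.mem_coe.2 (Finset.mem_univ _), ?_⟩
      · intro a b hab
        induction a using Fin.lastCases with
        | last =>
          induction b using Fin.lastCases with
          | last => rfl
          | cast b => simp only [Fin.snoc_last, Fin.snoc_castSucc] at hab; exact absurd hab.symm (hj b)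
        | cast a =>
          induction b using Fin.lastCases with
          | last => simp only [Fin.snoc_last, Fin.snoc_castSucc] at hab; exact absurd hab (hj a)
          | cast b =>
            simp only [Fin.snoc_castSucc] at hab; rw [i.injective hab]
      · refine Prod.ext ?_ (DFunLike.ext _ _ fun m => ?_)
        · exact Fin.snoc_last (α := fun _ => Fin N) _ _
        · exact Fin.snoc_castSucc (α := fun _ => Fin N) _ _ _
    obtain ⟨m, rfl⟩ := hj
    rw [integral_min_congr (g := fun _ => 0), intervalIntegral.integral_zero]
    intro _ z _ hz
    rw [eHatPlus_of_mem_range (m := m), mul_zero]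
    simpa using hz
  · intro i _
    exact eHatPlus_succ ν i hf t x

/-- The cutoff by the chain condition causes no jumps, because the interval of integration in the
recursion closes up exactly where the condition starts to fail. -/
theorem continuous_eHatPlus {N n : ℕ} (ν : ℂ) (i : Fin n ↪ Fin N) {f : (Fin N → ℝ) → ℂ}
    (hf : Continuous f) :
    Continuous fun p : ℝ × (Fin N → ℝ) =>
      eHatPlus ν i f (Fin.cons p.1 p.2 : Fin (N + 1) → ℝ) := by
  induction n with
  | zero =>
    simp only [eHatPlus_zero]
    exact (by fun_prop : Continuous fun p : ℝ × (Fin N → ℝ) => phase ν p.1).mul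
      (hf.comp continuous_snd)
  | succ n ih =>
    simp only [eHatPlus_succ ν i hf]
    refine continuous_intervalIntegral (by fun_prop) (by fun_prop) ?_
    refine (by fun_prop : Continuous fun p : (ℝ × (Fin N → ℝ)) × ℝ =>
      phase ν (p.1.1 - p.2)).mul ((ih (Fin.castSuccEmb.trans i)).comp
      (by fun_prop : Continuous fun p : (ℝ × (Fin N → ℝ)) × ℝ =>
        (p.1.2 (i (Fin.last n)), Function.update p.1.2 (i (Fin.last n)) p.2)))

theorem continuous_hatSum {N : ℕ} (ν : ℂ) {f : (Fin N → ℝ) → ℂ} (hf : Continuous f) (n : ℕ) :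
    Continuous fun p : ℝ × (Fin N → ℝ) => hatSum ν f n p.1 p.2 :=
  continuous_finsetSum _ fun i _ => continuous_eHatPlus ν i hf

theorem hatSum_succ {N : ℕ} (ν : ℂ) {f : (Fin N → ℝ) → ℂ} (hf : Continuous f) (n : ℕ)
    (t : ℝ) (x : Fin N → ℝ) :
    hatSum ν f (n + 1) t x = ∑ j, ∫ z in (min t (x j))..(x j),
      phase ν (t - z) * hatSum ν f n (x j) (Function.update x j z) := by
  rw [hatSum_succ_aux ν hf]
  refine Finset.sum_congr rfl fun j _ => ?_
  rw [← intervalIntegral.integral_finsetSum]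
  · simp only [hatSum, Finset.mul_sum]
  · intro i _
    exact ((by fun_prop : Continuous fun z : ℝ => phase ν (t - z)).mul
      ((continuous_eHatPlus ν i hf).comp (by fun_prop : Continuous fun z : ℝ =>
        (x j, Function.update x j z)))).intervalIntegrable _ _

/-- On continuous functions the explicit formula for `b⁺_ν` solves the integral equation. -/
theorem bPlusFun_cons (γ : ℝ) (ν : ℂ) {N : ℕ} {f : (Fin N → ℝ) → ℂ} (hf : Continuous f)
    (t : ℝ) (x : Fin N → ℝ) :
    bPlusFun γ ν f (Fin.cons t x : Fin (N + 1) → ℝ) = create γ ν f t x := by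
  have key : ∀ t x, bPlusFun γ ν f (Fin.cons t x : Fin (N + 1) → ℝ) =
      ∑ n ∈ Finset.range (N + 1), (γ : ℂ) ^ n * hatSum ν f n t x := fun t x => rfl
  refine congrFun (congrFun (eq_create (γ := γ) (ν := ν) (f := f)
    (g := fun t x => bPlusFun γ ν f (Fin.cons t x : Fin (N + 1) → ℝ)) fun t x => ?_) t) x
  -- No multi-index has more than `N` distinct entries, so the shift of degree by the integral
  -- equation loses nothing at the top.
  have htop : hatSum ν f (N + 1) t x = 0 := by
    have : IsEmpty (Fin (N + 1) ↪ Fin N) :=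
      ⟨fun i => by simpa using Fintype.card_le_of_embedding i⟩
    exact Finset.sum_eq_zero fun i _ => this.elim i
  simp only [key, duhamel]
  rw [Finset.sum_range_succ', hatSum_zero, pow_zero, one_mul, add_comm]
  congr 1
  have h1 : ∀ j, ∫ y in (min t (x j))..(x j), phase ν (t - y) *
      ∑ n ∈ Finset.range (N + 1), (γ : ℂ) ^ n * hatSum ν f n (x j) (Function.update x j y) =
      ∑ n ∈ Finset.range (N + 1), (γ : ℂ) ^ n * ∫ y in (min t (x j))..(x j),
        phase ν (t - y) * hatSum ν f n (x j) (Function.update x j y) := by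
    intro j
    simp only [← intervalIntegral.integral_const_mul]
    rw [← intervalIntegral.integral_finsetSum (s := Finset.range (N + 1))]
    · simp only [Finset.mul_sum, mul_left_comm]
    · intro n _
      exact (((by fun_prop : Continuous fun z : ℝ => phase ν (t - z)).mul
        ((continuous_hatSum ν hf n).comp (by fun_prop : Continuous fun z : ℝ =>
          (x j, Function.update x j z)))).const_mul _).intervalIntegrable _ _
  simp only [h1]
  rw [Finset.sum_comm, Finset.sum_range_succ]
  simp only [← Finset.mul_sum, ← hatSum_succ ν hf, htop, mul_zero, add_zero]
  rw [Finset.mul_sum]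
  refine Finset.sum_congr rfl fun n _ => ?_
  rw [pow_succ]; ring

/-! ### Reflection -/

/-- The reflection `(x_1, …, x_N) ↦ (-x_N, …, -x_1)`. -/
def refl {N : ℕ} (x : Fin N → ℝ) : Fin N → ℝ := fun j => -x j.rev

theorem refl_refl {N : ℕ} (x : Fin N → ℝ) : refl (refl x) = x := by
  ext j; simp [refl]

@[fun_prop]
theorem continuous_refl {N : ℕ} : Continuous (refl : (Fin N → ℝ) → Fin N → ℝ) := by
  unfold refl; fun_prop

theorem measurePreserving_comp_equiv {ι κ : Type*} [Fintype ι] [Fintype κ] (μ : Measure ℝ)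
    [SigmaFinite μ] (e : ι ≃ κ) :
    MeasurePreserving (fun (x : κ → ℝ) => x ∘ e) (Measure.pi fun _ => μ)
      (Measure.pi fun _ => μ) := by
  have h := (measurePreserving_piCongrLeft (α := fun _ : ι => ℝ) (fun _ => μ) e.symm)
  convert h using 1
  ext x j
  simp only [Function.comp_apply]
  obtain ⟨k, rfl⟩ := e.symm.surjective j
  rw [MeasurableEquiv.piCongrLeft_apply_apply, Equiv.apply_symm_apply]

theorem measurePreserving_refl {N : ℕ} {μ : Measure ℝ} [SigmaFinite μ]
    (h : MeasurePreserving (fun t : ℝ => -t) μ μ) :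
    MeasurePreserving (refl : (Fin N → ℝ) → Fin N → ℝ) (Measure.pi fun _ => μ)
      (Measure.pi fun _ => μ) :=
  (measurePreserving_pi (fun _ : Fin N => μ) (fun _ => μ) fun _ => h).comp
    (measurePreserving_comp_equiv μ (Fin.revPerm (n := N)))

/-- The reflection as a measurable equivalence. -/
def reflEquiv (N : ℕ) : (Fin N → ℝ) ≃ᵐ (Fin N → ℝ) where
  toFun := refl
  invFun := refl
  left_inv := refl_refl
  right_inv := refl_refl
  measurable_toFun := continuous_refl.measurable
  measurable_invFun := continuous_refl.measurable

theorem setIntegral_Icc_refl {n : ℕ} (F : (Fin n → ℝ) → ℂ) (a b : Fin n → ℝ) :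
    ∫ y in Set.Icc (refl b) (refl a), F y = ∫ y in Set.Icc a b, F (refl y) := by
  have hmp : MeasurePreserving (refl : (Fin n → ℝ) → Fin n → ℝ) volume volume :=
    measurePreserving_refl (Measure.measurePreserving_neg volume)
  rw [← hmp.setIntegral_preimage_emb (reflEquiv n).measurableEmbedding]
  congr 2
  ext y
  simp only [Set.mem_preimage, Set.mem_Icc, Pi.le_def, refl, neg_le_neg_iff]
  rw [and_comm, Fin.revPerm.forall_congr_left (p := fun j => a j.rev ≤ y j.rev),
    Fin.revPerm.forall_congr_left (p := fun j => y j.rev ≤ b j.rev)]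
  simp

theorem strictAnti_refl_iff {n : ℕ} {v : Fin n → ℝ} : StrictAnti (refl v) ↔ StrictAnti v := by
  have h : ∀ {v : Fin n → ℝ}, StrictAnti v → StrictAnti (refl v) := fun hv a b hab =>
    neg_lt_neg (hv (Fin.rev_lt_rev.2 hab))
  exact ⟨fun hv => refl_refl v ▸ h hv, h⟩

theorem snoc_refl {n : ℕ} (v : Fin n → ℝ) (s : ℝ) :
    (Fin.snoc (refl v) (-s) : Fin (n + 1) → ℝ) = refl (Fin.cons s v : Fin (n + 1) → ℝ) := by
  ext m
  induction m using Fin.lastCases with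
  | last => rw [Fin.snoc_last, refl, Fin.rev_last, Fin.cons_zero]
  | cast m => rw [Fin.snoc_castSucc, refl, refl, Fin.rev_castSucc, Fin.cons_succ]

theorem cons_refl {n : ℕ} (v : Fin n → ℝ) (s : ℝ) :
    (Fin.cons (-s) (refl v) : Fin (n + 1) → ℝ) = refl (Fin.snoc v s : Fin (n + 1) → ℝ) := by
  have := snoc_refl (refl v) (-s)
  rw [refl_refl, neg_neg] at this
  rw [this, refl_refl]

theorem next_refl {n : ℕ} (v : Fin n → ℝ) (s : ℝ) : next (refl v) (-s) = refl (prev s v) := by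
  ext m
  rw [next, snoc_refl, refl, refl, prev, Fin.rev_succ]

theorem tail_refl {n : ℕ} (y : Fin (n + 1) → ℝ) : Fin.tail (refl y) = refl (Fin.init y) := by
  ext m; simp only [Fin.tail, refl, Fin.init, Fin.rev_succ]

theorem sum_refl {n : ℕ} (y : Fin n → ℝ) : ∑ m, refl y m = -∑ m, y m := by
  simp only [refl, Finset.sum_neg_distrib]
  rw [← Equiv.sum_comp Fin.revPerm y]; rfl

/-- The embedding conjugated by order reversal. -/
def revEmb {N n : ℕ} (i : Fin n ↪ Fin N) : Fin n ↪ Fin N :=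
  (Fin.revPerm.toEmbedding.trans i).trans Fin.revPerm.toEmbedding

theorem revEmb_apply {N n : ℕ} (i : Fin n ↪ Fin N) (m : Fin n) :
    revEmb i m = (i m.rev).rev := rfl

theorem revEmb_involutive {N n : ℕ} : Function.Involutive (revEmb (N := N) (n := n)) := fun i =>
  DFunLike.ext _ _ fun m => by simp [revEmb_apply]

theorem sum_revEmb {N n : ℕ} (F : (Fin n ↪ Fin N) → ℂ) : ∑ i, F (revEmb i) = ∑ i, F i :=
  Equiv.sum_comp revEmb_involutive.toPerm F

theorem extend_refl {N n : ℕ} (i : Fin n ↪ Fin N) (y : Fin n → ℝ) (x : Fin N → ℝ) :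
    Function.extend (revEmb i) (refl y) (refl x) = refl (Function.extend i y x) := by
  ext j
  by_cases h : ∃ m, revEmb i m = j
  · obtain ⟨m, rfl⟩ := h
    rw [(revEmb i).injective.extend_apply, refl, refl, revEmb_apply, Fin.rev_rev,
      i.injective.extend_apply]
  · rw [Function.extend_apply' _ _ _ h, refl, refl, Function.extend_apply']
    rintro ⟨m, hm⟩
    exact h ⟨m.rev, by rw [revEmb_apply, Fin.rev_rev, hm, Fin.rev_rev]⟩

/-- Negation reverses a decreasing chain and reversal of the indices restores its order; the sign in
the phases is absorbed by the momentum. Hence only the operators of type `+` need analysis. -/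
theorem eHatMinus_eq {N n : ℕ} (ν : ℂ) (i : Fin n ↪ Fin N) (f : (Fin N → ℝ) → ℂ)
    (x : Fin (N + 1) → ℝ) :
    eHatMinus ν i f x = eHatPlus (-ν) (revEmb i) (fun x => f (refl x)) (refl x) := by
  have hv : (fun m => refl x (revEmb i m).succ) = refl fun m => x (i m).castSucc := by
    ext m; simp only [refl, revEmb_apply, Fin.rev_succ, Fin.rev_rev]
  have hs : refl x 0 = -x (Fin.last N) := by rw [refl, Fin.rev_zero]
  unfold eHatMinus eHatPlus
  simp only [hv, hs, snoc_refl, strictAnti_refl_iff, next_refl, setIntegral_Icc_refl, tail_refl,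
    extend_refl, refl_refl, phase_neg_momentum, neg_neg]
  simp only [sum_refl, neg_sub, sub_neg_eq_add, neg_add_eq_sub]

theorem eBarMinus_eq (L : ℝ) {N n : ℕ} (ν : ℂ) (i : Fin n ↪ Fin N) (f : (Fin N → ℝ) → ℂ)
    (x : Fin N → ℝ) :
    eBarMinus L ν i f x = eBarPlus L (-ν) (revEmb i) (fun x => f (refl x)) (refl x) := by
  have hv : (fun m => refl x (revEmb i m)) = refl fun m => x (i m) := by
    ext m; simp only [refl, revEmb_apply, Fin.rev_rev]
  unfold eBarMinus eBarPlus
  simp only [hv, strictAnti_refl_iff, next_refl, setIntegral_Icc_refl,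
    extend_refl, refl_refl, phase_neg_momentum, neg_neg]
  simp only [sum_refl, neg_sub, sub_neg_eq_add, neg_add_eq_sub]

theorem eCheckMinus_eq (L : ℝ) {N n : ℕ} (ν : ℂ) (i : Fin n ↪ Fin N)
    (f : (Fin (N + 1) → ℝ) → ℂ) (x : Fin N → ℝ) :
    eCheckMinus L ν i f x = eCheckPlus L (-ν) (revEmb i) (fun x => f (refl x)) (refl x) := by
  have hv : (fun m => refl x (revEmb i m)) = refl fun m => x (i m) := by
    ext m; simp only [refl, revEmb_apply, Fin.rev_rev]
  have hc : (Fin.cons (L / 2) (refl fun m => x (i m)) : Fin (n + 1) → ℝ) =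
      refl (Fin.snoc (fun m => x (i m)) (-(L / 2)) : Fin (n + 1) → ℝ) := by
    rw [← cons_refl, neg_neg]
  have hy : ∀ y : Fin (n + 1) → ℝ, refl y 0 = -y (Fin.last n) := fun y => by
    rw [refl, Fin.rev_zero]
  unfold eCheckMinus eCheckPlus
  simp only [hv, strictAnti_refl_iff, snoc_refl, hc, setIntegral_Icc_refl, tail_refl,
    extend_refl, refl_refl, phase_neg_momentum, hy]
  simp only [sum_refl, neg_sub, sub_neg_eq_add, neg_add_eq_sub]

theorem bMinusFun_eq (γ : ℝ) (ν : ℂ) {N : ℕ} (f : (Fin N → ℝ) → ℂ) (x : Fin (N + 1) → ℝ) :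
    bMinusFun γ ν f x = bPlusFun γ (-ν) (fun x => f (refl x)) (refl x) := by
  simp only [bMinusFun, bPlusFun, eHatMinus_eq]
  refine Finset.sum_congr rfl fun n _ => ?_
  rw [sum_revEmb fun i => eHatPlus (-ν) i (fun x => f (refl x)) (refl x)]

theorem dFun_eq (L γ : ℝ) (ν : ℂ) {N : ℕ} (f : (Fin N → ℝ) → ℂ) (x : Fin N → ℝ) :
    dFun L γ ν f x = aFun L γ (-ν) (fun x => f (refl x)) (refl x) := by
  simp only [dFun, aFun, eBarMinus_eq]
  refine Finset.sum_congr rfl fun n _ => ?_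
  rw [sum_revEmb fun i => eBarPlus L (-ν) i (fun x => f (refl x)) (refl x)]

theorem cMinusFun_eq (L γ : ℝ) (ν : ℂ) {N : ℕ} (f : (Fin (N + 1) → ℝ) → ℂ) (x : Fin N → ℝ) :
    cMinusFun L γ ν f x = cPlusFun L γ (-ν) (fun x => f (refl x)) (refl x) := by
  simp only [cMinusFun, cPlusFun, eCheckMinus_eq]
  refine Finset.sum_congr rfl fun n _ => ?_
  rw [sum_revEmb fun i => eCheckPlus L (-ν) i (fun x => f (refl x)) (refl x)]

/-- In the interior of the cube, `a_ν` is `b⁺_ν` with the new particle at the left end. -/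
theorem aFun_eq (L γ : ℝ) (ν : ℂ) {N : ℕ} (f : (Fin N → ℝ) → ℂ) {x : Fin N → ℝ}
    (hx : ∀ j, -(L / 2) < x j) :
    aFun L γ ν f x = bPlusFun γ ν f (Fin.cons (-(L / 2)) x : Fin (N + 1) → ℝ) := by
  simp only [aFun, bPlusFun]
  refine Finset.sum_congr rfl fun n _ => ?_
  congr 2; funext i
  unfold eBarPlus eHatPlus
  simp only [Fin.cons_zero, Fin.cons_succ, Fin.tail_cons]
  have : StrictAnti (Fin.snoc (fun m => x (i m)) (-(L / 2)) : Fin (n + 1) → ℝ) ↔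
      StrictAnti fun m => x (i m) := by
    cases n with
    | zero => exact ⟨fun _ a => a.elim0, fun _ a b hab => by omega⟩
    | succ n => rw [strictAnti_snoc_iff]; exact and_iff_right (hx _)
  simp only [this]

/-! ### Integral operators on `L²` -/

section Kernel

set_option linter.unusedSectionVars false

open scoped ENNReal

variable {X Y Z W : Type*} [MeasurableSpace X] [MeasurableSpace Y] [MeasurableSpace Z]
  [MeasurableSpace W] {μ : Measure X} {ν : Measure Y} {ρ : Measure Z} {σ : Measure W}
  [IsFiniteMeasure μ] [IsFiniteMeasure ν] [IsFiniteMeasure ρ] [IsFiniteMeasure σ]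

/-- Cauchy–Schwarz in the inner variable against the constant `1`, followed by Tonelli. -/
theorem eLpNorm_integral_prod_le {F : X × Y → ℂ} (hF : AEStronglyMeasurable F (μ.prod ν)) :
    eLpNorm (fun x => ∫ y, F (x, y) ∂ν) 2 μ ≤
      ν Set.univ ^ (1 / 2 : ℝ) * eLpNorm F 2 (μ.prod ν) := by
  have hsq : ∀ a : ℝ≥0∞, (a ^ (1 / 2 : ℝ)) ^ (2 : ℝ) = a := fun a => by
    rw [← ENNReal.rpow_mul]; norm_num
  have key : ∀ᵐ x ∂μ, ‖∫ y, F (x, y) ∂ν‖ₑ ^ (2 : ℝ) ≤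
      ν Set.univ * ∫⁻ y, ‖F (x, y)‖ₑ ^ (2 : ℝ) ∂ν := by
    filter_upwards [hF.prodMk_left] with x hx
    have h1 : ‖∫ y, F (x, y) ∂ν‖ₑ ≤ eLpNorm (fun y => F (x, y)) 2 ν * ν Set.univ ^ (1 / 2 : ℝ) := by
      refine (enorm_integral_le_lintegral_enorm _).trans ?_
      rw [← eLpNorm_one_eq_lintegral_enorm]
      refine (eLpNorm_le_eLpNorm_mul_rpow_measure_univ (q := 2) (by norm_num) hx).trans_eq ?_
      norm_num
    calc ‖∫ y, F (x, y) ∂ν‖ₑ ^ (2 : ℝ)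
        ≤ (eLpNorm (fun y => F (x, y)) 2 ν * ν Set.univ ^ (1 / 2 : ℝ)) ^ (2 : ℝ) := by gcongr
      _ = _ := by
        rw [ENNReal.mul_rpow_of_nonneg _ _ (by norm_num), hsq, mul_comm,
          eLpNorm_eq_lintegral_rpow_enorm_toReal (by norm_num) (by norm_num)]
        simp only [ENNReal.toReal_ofNat]
        rw [hsq]
  rw [eLpNorm_eq_lintegral_rpow_enorm_toReal (by norm_num) (by norm_num),
    eLpNorm_eq_lintegral_rpow_enorm_toReal (by norm_num) (by norm_num)]
  simp only [ENNReal.toReal_ofNat]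
  rw [← ENNReal.mul_rpow_of_nonneg _ _ (by norm_num)]
  gcongr
  rw [lintegral_prod _ (hF.enorm.pow_const _), ← lintegral_const_mul' _ _ (measure_ne_top _ _)]
  exact lintegral_mono_ae key

/-- The integral operator `f ↦ ∫ k (x, y) f ((Θ (x, y)).1) dy`. -/
def kernelFun (ν : Measure Y) (Θ : X × Y → Z × W) (k : X × Y → ℂ) (f : Z → ℂ) (x : X) : ℂ :=
  ∫ y, k (x, y) * f (Θ (x, y)).1 ∂ν

theorem memLp_comp_fst {Θ : X × Y → Z × W}
    (hΘ : MeasurePreserving Θ (μ.prod ν) (ρ.prod σ)) {f : Z → ℂ} (hf : MemLp f 2 ρ) :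
    MemLp (fun p => f (Θ p).1) 2 (μ.prod ν) :=
  (hf.comp_fst σ).comp_measurePreserving hΘ

theorem eLpNorm_comp_fst {Θ : X × Y → Z × W}
    (hΘ : MeasurePreserving Θ (μ.prod ν) (ρ.prod σ)) {f : Z → ℂ}
    (hf : AEStronglyMeasurable f ρ) :
    eLpNorm (fun p => f (Θ p).1) 2 (μ.prod ν) = σ Set.univ ^ (1 / 2 : ℝ) * eLpNorm f 2 ρ := by
  have h0 : AEStronglyMeasurable f (Measure.map Prod.fst (ρ.prod σ)) := by
    rw [Measure.map_fst_prod]; exact hf.smul_measure _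
  have h1 := eLpNorm_comp_measurePreserving (p := 2) (h0.comp_measurable measurable_fst) hΘ
  rw [← eLpNorm_map_measure h0 measurable_fst.aemeasurable, Measure.map_fst_prod,
    eLpNorm_smul_measure_of_ne_top (by norm_num)] at h1
  rw [show (fun p => f (Θ p).1) = (f ∘ Prod.fst) ∘ Θ from rfl, h1]
  norm_num

theorem memLp_kernel_mul {Θ : X × Y → Z × W}
    (hΘ : MeasurePreserving Θ (μ.prod ν) (ρ.prod σ)) {k : X × Y → ℂ}
    (hk : MemLp k ∞ (μ.prod ν)) {f : Z → ℂ} (hf : MemLp f 2 ρ) :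
    MemLp (fun p => k p * f (Θ p).1) 2 (μ.prod ν) :=
  (memLp_comp_fst hΘ hf).mul' hk

/-- Because `Θ` preserves measure, pulling `f` back through it costs only a factor from the total
mass of `σ`. This makes the formulas meaningful on `L²` classes although `f` is evaluated at points
that mix `x` and `y`. -/
theorem eLpNorm_kernelFun_le {Θ : X × Y → Z × W}
    (hΘ : MeasurePreserving Θ (μ.prod ν) (ρ.prod σ)) {k : X × Y → ℂ}
    (hk : MemLp k ∞ (μ.prod ν)) {f : Z → ℂ} (hf : MemLp f 2 ρ) :
    eLpNorm (kernelFun ν Θ k f) 2 μ ≤ (ν Set.univ ^ (1 / 2 : ℝ) *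
      (eLpNorm k ∞ (μ.prod ν) * σ Set.univ ^ (1 / 2 : ℝ))) * eLpNorm f 2 ρ := by
  refine (eLpNorm_integral_prod_le (memLp_kernel_mul hΘ hk hf).1).trans ?_
  rw [mul_assoc, mul_assoc]
  gcongr
  rw [← eLpNorm_comp_fst hΘ hf.1]
  change eLpNorm (k • fun p => f (Θ p).1) 2 (μ.prod ν) ≤ _
  exact eLpNorm_smul_le_mul_eLpNorm (p := ∞) (q := 2) (r := 2) (memLp_comp_fst hΘ hf).1 hk.1

theorem kernelBound_ne_top {k : X × Y → ℂ} (hk : MemLp k ∞ (μ.prod ν)) :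
    (ν Set.univ ^ (1 / 2 : ℝ) * (eLpNorm k ∞ (μ.prod ν) * σ Set.univ ^ (1 / 2 : ℝ))) ≠ ∞ :=
  ENNReal.mul_ne_top (ENNReal.rpow_ne_top_of_nonneg (by norm_num) (measure_ne_top _ _))
    (ENNReal.mul_ne_top hk.2.ne (ENNReal.rpow_ne_top_of_nonneg (by norm_num) (measure_ne_top _ _)))

theorem memLp_kernelFun {Θ : X × Y → Z × W}
    (hΘ : MeasurePreserving Θ (μ.prod ν) (ρ.prod σ)) {k : X × Y → ℂ}
    (hk : MemLp k ∞ (μ.prod ν)) {f : Z → ℂ} (hf : MemLp f 2 ρ) :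
    MemLp (kernelFun ν Θ k f) 2 μ :=
  ⟨(memLp_kernel_mul hΘ hk hf).1.integral_prod_right',
    (eLpNorm_kernelFun_le hΘ hk hf).trans_lt
      (ENNReal.mul_lt_top (kernelBound_ne_top hk).lt_top hf.2)⟩

theorem ae_integrable_kernel {Θ : X × Y → Z × W}
    (hΘ : MeasurePreserving Θ (μ.prod ν) (ρ.prod σ)) {k : X × Y → ℂ}
    (hk : MemLp k ∞ (μ.prod ν)) {f : Z → ℂ} (hf : MemLp f 2 ρ) :
    ∀ᵐ x ∂μ, Integrable (fun y => k (x, y) * f (Θ (x, y)).1) ν :=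
  ((memLp_kernel_mul hΘ hk hf).integrable (by norm_num)).prod_right_ae

theorem kernelFun_congr {Θ : X × Y → Z × W}
    (hΘ : MeasurePreserving Θ (μ.prod ν) (ρ.prod σ)) (k : X × Y → ℂ) {f g : Z → ℂ}
    (hfg : f =ᵐ[ρ] g) : kernelFun ν Θ k f =ᵐ[μ] kernelFun ν Θ k g := by
  have h1 : ∀ᵐ q ∂ρ.prod σ, f q.1 = g q.1 := Measure.quasiMeasurePreserving_fst.ae hfg
  have h2 : ∀ᵐ p ∂μ.prod ν, f (Θ p).1 = g (Θ p).1 := hΘ.quasiMeasurePreserving.ae h1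
  filter_upwards [Measure.ae_ae_of_ae_prod h2] with x hx
  refine integral_congr_ae ?_
  filter_upwards [hx] with y hy
  simp only [hy]

/-- The integral operator as a bounded operator. -/
def kernelCLM (Θ : X × Y → Z × W) (hΘ : MeasurePreserving Θ (μ.prod ν) (ρ.prod σ))
    (k : X × Y → ℂ) (hk : MemLp k ∞ (μ.prod ν)) : Lp ℂ 2 ρ →L[ℂ] Lp ℂ 2 μ :=
  LinearMap.mkContinuous
    { toFun := fun f => (memLp_kernelFun hΘ hk (Lp.memLp f)).toLp _
      map_add' := fun f g => by
        rw [← MemLp.toLp_add]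
        refine MemLp.toLp_congr _ _ ?_
        filter_upwards [kernelFun_congr hΘ k (Lp.coeFn_add f g),
          ae_integrable_kernel hΘ hk (Lp.memLp f), ae_integrable_kernel hΘ hk (Lp.memLp g)]
          with x hx hf hg
        rw [hx, Pi.add_apply, kernelFun, kernelFun, kernelFun, ← integral_add hf hg]
        simp only [Pi.add_apply, mul_add]
      map_smul' := fun c f => by
        rw [RingHom.id_apply, ← MemLp.toLp_const_smul]
        refine MemLp.toLp_congr _ _ ?_
        filter_upwards [kernelFun_congr hΘ k (Lp.coeFn_smul c f)] with x hx
        rw [hx, Pi.smul_apply, kernelFun, kernelFun, ← integral_smul]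
        simp only [Pi.smul_apply, smul_eq_mul, mul_left_comm] }
    (ν Set.univ ^ (1 / 2 : ℝ) *
      (eLpNorm k ∞ (μ.prod ν) * σ Set.univ ^ (1 / 2 : ℝ))).toReal fun f => by
    simp only [LinearMap.coe_mk, AddHom.coe_mk, Lp.norm_toLp]
    rw [Lp.norm_def, ← ENNReal.toReal_mul]
    exact ENNReal.toReal_mono (ENNReal.mul_ne_top (kernelBound_ne_top hk) (Lp.eLpNorm_ne_top f))
      (eLpNorm_kernelFun_le hΘ hk (Lp.memLp f))

theorem coeFn_kernelCLM (Θ : X × Y → Z × W) (hΘ : MeasurePreserving Θ (μ.prod ν) (ρ.prod σ))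
    (k : X × Y → ℂ) (hk : MemLp k ∞ (μ.prod ν)) (f : Lp ℂ 2 ρ) :
    kernelCLM Θ hΘ k hk f =ᵐ[μ] kernelFun ν Θ k f :=
  MemLp.coeFn_toLp (memLp_kernelFun hΘ hk (Lp.memLp f))

/-- The transpose of an integral operator. -/
theorem integral_mul_kernelFun (Θ : X × Y ≃ᵐ Z × W)
    (hΘ : MeasurePreserving Θ (μ.prod ν) (ρ.prod σ)) {k : X × Y → ℂ}
    (hk : MemLp k ∞ (μ.prod ν)) {k' : Z × W → ℂ}
    (hkk' : ∀ᵐ p ∂μ.prod ν, k' (Θ p) = k p) {f : Z → ℂ} (hf : MemLp f 2 ρ)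
    {g : X → ℂ} (hg : MemLp g 2 μ) :
    ∫ x, g x * kernelFun ν Θ k f x ∂μ = ∫ z, f z * kernelFun σ Θ.symm k' g z ∂ρ := by
  have h1 : Integrable (fun p : X × Y => g p.1 * (k p * f (Θ p).1)) (μ.prod ν) :=
    (hg.comp_fst ν).integrable_mul (memLp_kernel_mul hΘ hk hf)
  have h2 : (fun p : X × Y => g p.1 * (k p * f (Θ p).1)) =ᵐ[μ.prod ν]
      (fun q : Z × W => f q.1 * (k' q * g (Θ.symm q).1)) ∘ Θ := by
    filter_upwards [hkk'] with p hp
    simp only [Function.comp_apply, hp, MeasurableEquiv.symm_apply_apply]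
    ring
  have h3 : Integrable (fun q : Z × W => f q.1 * (k' q * g (Θ.symm q).1)) (ρ.prod σ) := by
    rw [← hΘ.integrable_comp_emb Θ.measurableEmbedding]
    exact h1.congr h2
  simp only [kernelFun, ← integral_const_mul]
  rw [← integral_prod _ h1, ← integral_prod _ h3, integral_congr_ae h2,
    ← hΘ.integral_comp Θ.measurableEmbedding]
  rfl

end Kernel

open scoped ENNReal

/-! ### The cube -/

instance (L : ℝ) (N : ℕ) : IsFiniteMeasure (boxMeasure L N) := by
  unfold boxMeasure; infer_instance

/-- The cube `J ^ N`. -/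
def cube (L : ℝ) (N : ℕ) : Set (Fin N → ℝ) := Set.Icc (fun _ => -(L / 2)) fun _ => L / 2

theorem boxMeasure_eq_restrict (L : ℝ) (N : ℕ) :
    boxMeasure L N = volume.restrict (cube L N) := by
  rw [boxMeasure, cube, ← Set.pi_univ_Icc, volume_pi, Measure.restrict_pi_pi]

theorem measurableSet_cube (L : ℝ) (N : ℕ) : MeasurableSet (cube L N) := measurableSet_Icc

theorem isCompact_cube (L : ℝ) (N : ℕ) : IsCompact (cube L N) := isCompact_Icc

theorem mem_cube {L : ℝ} {N : ℕ} {x : Fin N → ℝ} :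
    x ∈ cube L N ↔ ∀ j, -(L / 2) ≤ x j ∧ x j ≤ L / 2 := by
  simp only [cube, Set.mem_Icc, Pi.le_def, forall_and]

theorem ae_mem_cube (L : ℝ) (N : ℕ) : ∀ᵐ x ∂boxMeasure L N, x ∈ cube L N := by
  rw [boxMeasure_eq_restrict]; exact ae_restrict_mem (measurableSet_cube L N)

theorem ae_mem_interior (L : ℝ) (N : ℕ) :
    ∀ᵐ x ∂boxMeasure L N, ∀ j, -(L / 2) < x j ∧ x j < L / 2 := by
  rw [ae_all_iff]
  intro j
  have h : ∀ᵐ t ∂(volume.restrict (Set.Icc (-(L / 2)) (L / 2))), -(L / 2) < t ∧ t < L / 2 := by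
    rw [Measure.restrict_congr_set Ioo_ae_eq_Icc.symm]
    exact ae_restrict_mem measurableSet_Ioo
  exact (Measure.tendsto_eval_ae_ae (μ := fun _ : Fin N =>
    volume.restrict (Set.Icc (-(L / 2)) (L / 2))) (i := j)).eventually h

theorem ae_injective (L : ℝ) (N : ℕ) : ∀ᵐ x ∂boxMeasure L N, Function.Injective x := by
  have h : ∀ᵐ x : Fin N → ℝ, ∀ j k, j ≠ k → x j ≠ x k := by
    rw [ae_all_iff]; intro j
    rw [ae_all_iff]; intro k
    by_cases hjk : j = k
    · exact Filter.Eventually.of_forall fun x h => absurd hjk h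
    let p : (Fin N → ℝ) →ₗ[ℝ] ℝ :=
      (LinearMap.proj j : (Fin N → ℝ) →ₗ[ℝ] ℝ) - (LinearMap.proj k : (Fin N → ℝ) →ₗ[ℝ] ℝ)
    have hp : LinearMap.ker p ≠ ⊤ := by
      intro htop
      have : p (Pi.single j 1) = 0 := LinearMap.mem_ker.1 (htop ▸ Submodule.mem_top)
      simp [p, Ne.symm hjk] at this
    have := Measure.addHaar_submodule volume (LinearMap.ker p) hp
    refine Filter.mem_of_superset (compl_mem_ae_iff.2 this) fun x hx _ heq => hx ?_
    simp [p, heq]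
  rw [boxMeasure_eq_restrict]
  filter_upwards [ae_restrict_of_ae h] with x hx j k hjk
  by_contra hne
  exact hx j k hne hjk

theorem setIntegral_eq_integral_indicator {L : ℝ} {n : ℕ} {S : Set (Fin n → ℝ)}
    (hS : MeasurableSet S) (hSL : S ⊆ cube L n) (g : (Fin n → ℝ) → ℂ) :
    ∫ y in S, g y = ∫ y, S.indicator g y ∂boxMeasure L n := by
  rw [integral_indicator hS, boxMeasure_eq_restrict, Measure.restrict_restrict hS,
    Set.inter_eq_left.2 hSL]

theorem memLp_top_indicator (L : ℝ) {N n : ℕ} {S : Set ((Fin N → ℝ) × (Fin n → ℝ))}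
    (hS : MeasurableSet S) {φ : (Fin N → ℝ) × (Fin n → ℝ) → ℂ} (hφ : Continuous φ) :
    MemLp (S.indicator φ) ∞ ((boxMeasure L N).prod (boxMeasure L n)) := by
  obtain ⟨C, hC⟩ := ((isCompact_cube L N).prod (isCompact_cube L n)).exists_bound_of_continuousOn
    hφ.continuousOn
  refine memLp_top_of_bound (hφ.stronglyMeasurable.indicator hS).aestronglyMeasurable C ?_
  have h1 : ∀ᵐ p ∂(boxMeasure L N).prod (boxMeasure L n), p.1 ∈ cube L N :=
    Measure.quasiMeasurePreserving_fst.ae (ae_mem_cube L N)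
  have h2 : ∀ᵐ p ∂(boxMeasure L N).prod (boxMeasure L n), p.2 ∈ cube L n :=
    Measure.quasiMeasurePreserving_snd.ae (ae_mem_cube L n)
  filter_upwards [h1, h2] with p hp1 hp2
  exact (norm_indicator_le_norm_self _ _).trans (hC p ⟨hp1, hp2⟩)

theorem memLp_of_continuous (L : ℝ) {N : ℕ} {f : (Fin N → ℝ) → ℂ} (hf : Continuous f) :
    MemLp f 2 (boxMeasure L N) := by
  obtain ⟨C, hC⟩ := (isCompact_cube L N).exists_bound_of_continuousOn hf.continuousOn
  refine MemLp.of_bound hf.aestronglyMeasurable C ?_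
  filter_upwards [ae_mem_cube L N] with x hx using hC x hx

/-! ### Exchanging variables -/

/-- A relabelling of the factors of a power of `μ`, grouped into two blocks before and after. The
exchanges of `x` and `y` variables below are of this form. -/
theorem measurePreserving_split {ι κ ι' κ' : Type*} [Fintype ι] [Fintype κ] [Fintype ι']
    [Fintype κ'] (μ : Measure ℝ) [SigmaFinite μ] (e : ι' ⊕ κ' ≃ ι ⊕ κ) :
    MeasurePreserving (fun p : (ι → ℝ) × (κ → ℝ) =>
        ((fun j => Sum.elim p.1 p.2 (e (Sum.inl j)), fun k => Sum.elim p.1 p.2 (e (Sum.inr k))) :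
          (ι' → ℝ) × (κ' → ℝ)))
      ((Measure.pi fun _ => μ).prod (Measure.pi fun _ => μ))
      ((Measure.pi fun _ => μ).prod (Measure.pi fun _ => μ)) := by
  have h1 := measurePreserving_sumPiEquivProdPi_symm (X := fun _ : ι ⊕ κ => ℝ) fun _ => μ
  have h2 := measurePreserving_sumPiEquivProdPi (X := fun _ : ι' ⊕ κ' => ℝ) fun _ => μ
  have h3 := h2.comp ((measurePreserving_comp_equiv μ e).comp h1)
  convert h3 using 1
  ext p j
  · simp only [Function.comp_apply, MeasurableEquiv.coe_sumPiEquivProdPi,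
      MeasurableEquiv.coe_sumPiEquivProdPi_symm, Equiv.sumPiEquivProdPi_apply]
    cases e (Sum.inl j) <;> rfl
  · simp only [Function.comp_apply, MeasurableEquiv.coe_sumPiEquivProdPi,
      MeasurableEquiv.coe_sumPiEquivProdPi_symm, Equiv.sumPiEquivProdPi_apply]
    cases e (Sum.inr j) <;> rfl

theorem extend_eq_elim {N n : ℕ} {ι : Type*} (i : Fin n ↪ Fin N) (x : ι → ℝ) (y : Fin n → ℝ)
    (u : Fin N → ι) (j : Fin N) :
    Sum.elim x y (Function.extend i Sum.inr (fun j => Sum.inl (u j)) j) =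
      Function.extend i y (fun j => x (u j)) j := by
  by_cases h : ∃ m, i m = j
  · obtain ⟨m, rfl⟩ := h
    rw [i.injective.extend_apply, i.injective.extend_apply, Sum.elim_inr]
  · rw [Function.extend_apply' _ _ _ h, Function.extend_apply' _ _ _ h, Sum.elim_inl]

theorem extend_comp_self {N n : ℕ} (i : Fin n ↪ Fin N) (y : Fin n → ℝ) (x : Fin N → ℝ) :
    Function.extend i (fun m => x (i m)) (Function.extend i y x) = x := by
  ext j
  by_cases h : ∃ m, i m = j
  · obtain ⟨m, rfl⟩ := h; rw [i.injective.extend_apply]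
  · rw [Function.extend_apply' _ _ _ h, Function.extend_apply' _ _ _ h]

/-- `(x, y) ↦ (x_{i → y}, (x_{i_1}, …, x_{i_n}))`. -/
def barEquiv {N n : ℕ} (i : Fin n ↪ Fin N) :
    (Fin N → ℝ) × (Fin n → ℝ) ≃ᵐ (Fin N → ℝ) × (Fin n → ℝ) where
  toFun p := (Function.extend i p.2 p.1, fun m => p.1 (i m))
  invFun p := (Function.extend i p.2 p.1, fun m => p.1 (i m))
  left_inv p := Prod.ext (extend_comp_self i _ _)
    (funext fun m => i.injective.extend_apply _ _ m)
  right_inv p := Prod.ext (extend_comp_self i _ _)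
    (funext fun m => i.injective.extend_apply _ _ m)
  measurable_toFun := (((continuous_extend i).comp continuous_swap).prodMk
    (by fun_prop)).measurable
  measurable_invFun := (((continuous_extend i).comp continuous_swap).prodMk
    (by fun_prop)).measurable

theorem measurePreserving_barEquiv (L : ℝ) {N n : ℕ} (i : Fin n ↪ Fin N) :
    MeasurePreserving (barEquiv i) ((boxMeasure L N).prod (boxMeasure L n))
      ((boxMeasure L N).prod (boxMeasure L n)) := by
  have hb : Function.Bijective (Sum.elim (Function.extend i Sum.inr Sum.inl)
      (fun m => Sum.inl (i m)) : Fin N ⊕ Fin n → Fin N ⊕ Fin n) := by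
    refine Finite.injective_iff_bijective.1 (Finite.injective_iff_surjective.2 ?_)
    rintro (j | m)
    · by_cases h : ∃ m, i m = j
      · obtain ⟨m, rfl⟩ := h; exact ⟨Sum.inr m, rfl⟩
      · exact ⟨Sum.inl j, by rw [Sum.elim_inl, Function.extend_apply' _ _ _ h]⟩
    · exact ⟨Sum.inl (i m), by rw [Sum.elim_inl, i.injective.extend_apply]⟩
  have hmp := measurePreserving_split (volume.restrict (Set.Icc (-(L / 2)) (L / 2)))
    (Equiv.ofBijective _ hb)
  refine Eq.mp (congrArg (fun F => MeasurePreserving F _ _) ?_) hmp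
  symm
  ext p j
  · simp only [barEquiv, MeasurableEquiv.coe_mk, Equiv.coe_fn_mk, Equiv.ofBijective_apply,
      Sum.elim_inl]
    exact (extend_eq_elim i p.1 p.2 id j).symm
  · rfl

/-- `(x, y) ↦ (x''_{i → y}, (x''_{i_1}, …, x''_{i_n}, x_1))`. -/
def hatEquiv {N n : ℕ} (i : Fin n ↪ Fin N) :
    (Fin (N + 1) → ℝ) × (Fin n → ℝ) ≃ᵐ (Fin N → ℝ) × (Fin (n + 1) → ℝ) where
  toFun p := (Function.extend i p.2 (Fin.tail p.1),
    (Fin.snoc (fun m => p.1 (i m).succ) (p.1 0) : Fin (n + 1) → ℝ))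
  invFun q := ((Fin.cons (q.2 (Fin.last n)) (Function.extend i (Fin.init q.2) q.1) :
    Fin (N + 1) → ℝ), fun m => q.1 (i m))
  left_inv p := by
    refine Prod.ext ?_ (funext fun m => i.injective.extend_apply _ _ m)
    simp only [Fin.snoc_last, Fin.init_snoc]
    conv_rhs => rw [← Fin.cons_self_tail p.1]
    congr 1
    exact extend_comp_self i _ (Fin.tail p.1)
  right_inv q := by
    refine Prod.ext ?_ ?_
    · simp only [Fin.tail_cons]; exact extend_comp_self i _ _
    · simp only [Fin.cons_succ, Fin.cons_zero, i.injective.extend_apply]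
      exact Fin.snoc_init_self q.2
  measurable_toFun := (((continuous_extend i).comp (by unfold Fin.tail; fun_prop : Continuous
    fun p : (Fin (N + 1) → ℝ) × (Fin n → ℝ) => (p.2, Fin.tail p.1))).prodMk
    (by fun_prop)).measurable
  measurable_invFun := ((Continuous.finCons (by fun_prop) ((continuous_extend i).comp
    (by unfold Fin.init; fun_prop : Continuous
    fun q : (Fin N → ℝ) × (Fin (n + 1) → ℝ) => ((Fin.init q.2 : Fin n → ℝ), q.1)))).prodMk
    (by fun_prop)).measurable

theorem measurePreserving_hatEquiv (L : ℝ) {N n : ℕ} (i : Fin n ↪ Fin N) :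
    MeasurePreserving (hatEquiv i) ((boxMeasure L (N + 1)).prod (boxMeasure L n))
      ((boxMeasure L N).prod (boxMeasure L (n + 1))) := by
  have hb : Function.Bijective (Sum.elim (Function.extend i Sum.inr fun j => Sum.inl j.succ)
      (fun m => Sum.inl ((Fin.snoc (fun m => (i m).succ) 0 : Fin (n + 1) → Fin (N + 1)) m)) :
        Fin N ⊕ Fin (n + 1) → Fin (N + 1) ⊕ Fin n) := by
    rw [Fintype.bijective_iff_surjective_and_card]
    refine ⟨?_, by simp only [Fintype.card_sum, Fintype.card_fin]; ring⟩
    rintro (j | m)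
    · induction j using Fin.cases with
      | zero => exact ⟨Sum.inr (Fin.last n), by rw [Sum.elim_inr, Fin.snoc_last]⟩
      | succ j =>
        by_cases h : ∃ m, i m = j
        · obtain ⟨m, rfl⟩ := h
          exact ⟨Sum.inr m.castSucc, by rw [Sum.elim_inr, Fin.snoc_castSucc]⟩
        · exact ⟨Sum.inl j, by rw [Sum.elim_inl, Function.extend_apply' _ _ _ h]⟩
    · exact ⟨Sum.inl (i m), by rw [Sum.elim_inl, i.injective.extend_apply]⟩
  have hmp := measurePreserving_split (volume.restrict (Set.Icc (-(L / 2)) (L / 2)))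
    (Equiv.ofBijective _ hb)
  refine Eq.mp (congrArg (fun F => MeasurePreserving F _ _) ?_) hmp
  symm
  ext p j
  · simp only [hatEquiv, MeasurableEquiv.coe_mk, Equiv.coe_fn_mk, Equiv.ofBijective_apply,
      Sum.elim_inl]
    exact (extend_eq_elim i p.1 p.2 Fin.succ j).symm
  · simp only [hatEquiv, MeasurableEquiv.coe_mk, Equiv.coe_fn_mk, Equiv.ofBijective_apply,
      Sum.elim_inl, Sum.elim_inr]
    induction j using Fin.lastCases <;> simp

/-! ### The kernels of the elementary integral operators -/

theorem measurableSet_strictAnti {X : Type*} [TopologicalSpace X] [MeasurableSpace X]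
    [OpensMeasurableSpace X] {n : ℕ} {v : X → Fin n → ℝ} (hv : Continuous v) :
    MeasurableSet {p | StrictAnti (v p)} := by
  have : {p | StrictAnti (v p)} = ⋂ a, ⋂ b, {p | a < b → v p b < v p a} := by
    ext p; simp only [Set.mem_ofPred_eq, Set.mem_iInter, StrictAnti]
  rw [this]
  refine MeasurableSet.iInter fun a => MeasurableSet.iInter fun b => ?_
  by_cases hab : a < b
  · simp only [hab, true_imp_iff]
    exact (isOpen_lt (by fun_prop) (by fun_prop)).measurableSet
  · simp only [hab, false_imp_iff, Set.ofPred_true, MeasurableSet.univ]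

theorem continuous_next {X : Type*} [TopologicalSpace X] {n : ℕ} {v : X → Fin n → ℝ} {b : X → ℝ}
    (hv : Continuous v) (hb : Continuous b) : Continuous fun p => next (v p) (b p) :=
  continuous_pi fun m => (continuous_apply m.succ).comp (Continuous.finSnoc hv hb)

theorem continuous_prev {X : Type*} [TopologicalSpace X] {n : ℕ} {v : X → Fin n → ℝ} {b : X → ℝ}
    (hv : Continuous v) (hb : Continuous b) : Continuous fun p => prev (b p) (v p) :=
  continuous_pi fun m => (continuous_apply m.castSucc).comp (Continuous.finCons hb hv)

theorem next_mem_cube {L : ℝ} {n : ℕ} {v : Fin n → ℝ} {b : ℝ} (hv : ∀ m, -(L / 2) ≤ v m)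
    (hb : -(L / 2) ≤ b) (m : Fin n) : -(L / 2) ≤ next v b m := by
  unfold next
  induction m.succ using Fin.lastCases with
  | last => rwa [Fin.snoc_last]
  | cast m => rw [Fin.snoc_castSucc]; exact hv m

theorem prev_mem_cube {L : ℝ} {n : ℕ} {v : Fin n → ℝ} {b : ℝ} (hv : ∀ m, v m ≤ L / 2)
    (hb : b ≤ L / 2) (m : Fin n) : prev b v m ≤ L / 2 := by
  unfold prev
  induction m.castSucc using Fin.cases with
  | zero => rwa [Fin.cons_zero]
  | succ m => rw [Fin.cons_succ]; exact hv m

theorem ite_setIntegral_eq {L : ℝ} {n : ℕ} (P : Prop) {a b : Fin n → ℝ} [Decidable P]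
    [∀ y, Decidable (P ∧ a ≤ y ∧ y ≤ b)]
    (ha : ∀ m, -(L / 2) ≤ a m) (hb : ∀ m, b m ≤ L / 2) (c : ℂ) (φ F : (Fin n → ℝ) → ℂ) :
    (if P then c * ∫ y in Set.Icc a b, φ y * F y else 0) =
      ∫ y, (if P ∧ a ≤ y ∧ y ≤ b then c * φ y else 0) * F y ∂boxMeasure L n := by
  by_cases hP : P
  · rw [if_pos hP, setIntegral_eq_integral_indicator (L := L) measurableSet_Icc
      (fun y hy => mem_cube.2 fun m => ⟨(ha m).trans (hy.1 m), (hy.2 m).trans (hb m)⟩),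
      ← integral_const_mul]
    congr 1; funext y
    classical
    simp only [Set.indicator_apply, Set.mem_Icc, hP, true_and, mul_ite, mul_zero,
      ite_mul, zero_mul, mul_assoc]
  · simp [hP]

/-- The kernel of `ē⁺`. -/
def barPlusKernel (L : ℝ) (ν : ℂ) {N n : ℕ} (i : Fin n ↪ Fin N) :
    (Fin N → ℝ) × (Fin n → ℝ) → ℂ :=
  {p | StrictAnti (fun m => p.1 (i m)) ∧ next (fun m => p.1 (i m)) (-(L / 2)) ≤ p.2 ∧
    p.2 ≤ fun m => p.1 (i m)}.indicator
    fun p => phase ν (-(L / 2)) * phase ν (∑ m, p.1 (i m) - ∑ m, p.2 m)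

/-- The kernel of `ē⁻`. -/
def barMinusKernel (L : ℝ) (ν : ℂ) {N n : ℕ} (i : Fin n ↪ Fin N) :
    (Fin N → ℝ) × (Fin n → ℝ) → ℂ :=
  {p | StrictAnti (fun m => p.1 (i m)) ∧ (fun m => p.1 (i m)) ≤ p.2 ∧
    p.2 ≤ prev (L / 2) fun m => p.1 (i m)}.indicator
    fun p => phase ν (L / 2) * phase ν (∑ m, p.1 (i m) - ∑ m, p.2 m)

/-- The kernel of `ê⁺`. -/
def hatPlusKernel (ν : ℂ) {N n : ℕ} (i : Fin n ↪ Fin N) :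
    (Fin (N + 1) → ℝ) × (Fin n → ℝ) → ℂ :=
  {p | StrictAnti (Fin.snoc (fun m => p.1 (i m).succ) (p.1 0) : Fin (n + 1) → ℝ) ∧
    next (fun m => p.1 (i m).succ) (p.1 0) ≤ p.2 ∧ p.2 ≤ fun m => p.1 (i m).succ}.indicator
    fun p => phase ν (p.1 0) * phase ν (∑ m, p.1 (i m).succ - ∑ m, p.2 m)

/-- The kernel of `ě⁻`. -/
def checkMinusKernel (L : ℝ) (ν : ℂ) {N n : ℕ} (i : Fin n ↪ Fin N) :
    (Fin N → ℝ) × (Fin (n + 1) → ℝ) → ℂ :=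
  {p | StrictAnti (fun m => p.1 (i m)) ∧
    (Fin.snoc (fun m => p.1 (i m)) (-(L / 2)) : Fin (n + 1) → ℝ) ≤ p.2 ∧
    p.2 ≤ (Fin.cons (L / 2) fun m => p.1 (i m) : Fin (n + 1) → ℝ)}.indicator
    fun p => 1 * phase ν (∑ m, p.1 (i m) - ∑ m, p.2 m)

section

variable (L : ℝ) (ν : ℂ) {N n : ℕ} (i : Fin n ↪ Fin N)

theorem memLp_barPlusKernel :
    MemLp (barPlusKernel L ν i) ∞ ((boxMeasure L N).prod (boxMeasure L n)) := by
  have hv : Continuous fun p : (Fin N → ℝ) × (Fin n → ℝ) => fun m => p.1 (i m) := by fun_prop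
  refine memLp_top_indicator L ?_ (continuous_const.mul (continuous_phase continuous_const
    (by fun_prop)))
  exact (measurableSet_strictAnti hv).inter
    ((isClosed_le (continuous_next hv continuous_const) continuous_snd).measurableSet.inter
      (isClosed_le continuous_snd hv).measurableSet)

theorem memLp_barMinusKernel :
    MemLp (barMinusKernel L ν i) ∞ ((boxMeasure L N).prod (boxMeasure L n)) := by
  have hv : Continuous fun p : (Fin N → ℝ) × (Fin n → ℝ) => fun m => p.1 (i m) := by fun_prop
  refine memLp_top_indicator L ?_ (continuous_const.mul (continuous_phase continuous_const
    (by fun_prop)))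
  exact (measurableSet_strictAnti hv).inter ((isClosed_le hv continuous_snd).measurableSet.inter
    (isClosed_le continuous_snd (continuous_prev hv continuous_const)).measurableSet)

theorem memLp_hatPlusKernel :
    MemLp (hatPlusKernel ν i) ∞ ((boxMeasure L (N + 1)).prod (boxMeasure L n)) := by
  have hv : Continuous fun p : (Fin (N + 1) → ℝ) × (Fin n → ℝ) => fun m => p.1 (i m).succ := by
    fun_prop
  have h0 : Continuous fun p : (Fin (N + 1) → ℝ) × (Fin n → ℝ) => p.1 0 := by fun_prop
  refine memLp_top_indicator L ?_ ((continuous_phase continuous_const (by fun_prop)).mul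
    (continuous_phase continuous_const (by fun_prop)))
  exact (measurableSet_strictAnti (Continuous.finSnoc hv h0)).inter
    ((isClosed_le (continuous_next hv h0) continuous_snd).measurableSet.inter
      (isClosed_le continuous_snd hv).measurableSet)

theorem memLp_checkMinusKernel :
    MemLp (checkMinusKernel L ν i) ∞ ((boxMeasure L N).prod (boxMeasure L (n + 1))) := by
  have hv : Continuous fun p : (Fin N → ℝ) × (Fin (n + 1) → ℝ) => fun m => p.1 (i m) := by
    fun_prop
  refine memLp_top_indicator L ?_ (continuous_const.mul (continuous_phase continuous_const
    (by fun_prop)))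
  exact (measurableSet_strictAnti hv).inter
    ((isClosed_le (Continuous.finSnoc hv continuous_const) continuous_snd).measurableSet.inter
      (isClosed_le continuous_snd (Continuous.finCons continuous_const hv)).measurableSet)

variable {L}

theorem eBarPlus_eq_kernelFun (f : (Fin N → ℝ) → ℂ) {x : Fin N → ℝ}
    (hx : x ∈ cube L N) :
    eBarPlus L ν i f x = kernelFun (boxMeasure L n) (barEquiv i) (barPlusKernel L ν i) f x := by
  rw [mem_cube] at hx
  classical
  simp only [eBarPlus, kernelFun, barPlusKernel, Set.indicator_apply, Set.mem_ofPred_eq]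
  refine (ite_setIntegral_eq (L := L) _ ?_ ?_ _ _ _).trans ?_
  · exact next_mem_cube (fun m => (hx _).1) le_rfl
  · exact fun m => (hx _).2
  · rfl

theorem eBarMinus_eq_kernelFun (f : (Fin N → ℝ) → ℂ) {x : Fin N → ℝ}
    (hx : x ∈ cube L N) :
    eBarMinus L ν i f x = kernelFun (boxMeasure L n) (barEquiv i) (barMinusKernel L ν i) f x := by
  rw [mem_cube] at hx
  classical
  simp only [eBarMinus, kernelFun, barMinusKernel, Set.indicator_apply, Set.mem_ofPred_eq]
  refine (ite_setIntegral_eq (L := L) _ ?_ ?_ _ _ _).trans ?_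
  · exact fun m => (hx _).1
  · exact prev_mem_cube (fun m => (hx _).2) le_rfl
  · rfl

theorem eHatPlus_eq_kernelFun (f : (Fin N → ℝ) → ℂ) {x : Fin (N + 1) → ℝ}
    (hx : x ∈ cube L (N + 1)) :
    eHatPlus ν i f x = kernelFun (boxMeasure L n) (hatEquiv i) (hatPlusKernel ν i) f x := by
  rw [mem_cube] at hx
  classical
  simp only [eHatPlus, kernelFun, hatPlusKernel, Set.indicator_apply, Set.mem_ofPred_eq]
  refine (ite_setIntegral_eq (L := L) _ ?_ ?_ _ _ _).trans ?_
  · exact next_mem_cube (fun m => (hx _).1) (hx 0).1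
  · exact fun m => (hx _).2
  · rfl

theorem eCheckMinus_eq_kernelFun (f : (Fin (N + 1) → ℝ) → ℂ) {x : Fin N → ℝ}
    (hx : x ∈ cube L N) :
    eCheckMinus L ν i f x =
      kernelFun (boxMeasure L (n + 1)) (hatEquiv i).symm (checkMinusKernel L ν i) f x := by
  rw [mem_cube] at hx
  classical
  have h := ite_setIntegral_eq (L := L) (StrictAnti fun m => x (i m))
    (a := (Fin.snoc (fun m => x (i m)) (-(L / 2)) : Fin (n + 1) → ℝ))
    (b := (Fin.cons (L / 2) fun m => x (i m) : Fin (n + 1) → ℝ)) (fun m => by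
      induction m using Fin.lastCases with
      | last => rw [Fin.snoc_last]
      | cast m => rw [Fin.snoc_castSucc]; exact (hx _).1) (fun m => by
      induction m using Fin.cases with
      | zero => rw [Fin.cons_zero]
      | succ m => rw [Fin.cons_succ]; exact (hx _).2) 1
    (fun y => phase ν (∑ m, x (i m) - ∑ m, y m))
    fun y => f (Fin.cons (y (Fin.last n)) (Function.extend i (Fin.init y) x))
  rw [one_mul] at h
  simp only [eCheckMinus, kernelFun, checkMinusKernel, Set.indicator_apply, Set.mem_ofPred_eq]
  exact h.trans (by rfl)

end

/-! ### Transposes -/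

/-- Both sides describe one chain `a ≥ v_1 ≥ y_1 ≥ v_2 ≥ ⋯ ≥ v_n ≥ y_n ≥ b`, and injectivity makes
the inequalities within `v` and within `y` strict. This symmetry is why `a` and `d` are transposes
of each other. -/
theorem interlacing_bar {n : ℕ} {a b : ℝ} {v y : Fin n → ℝ} (hv : Function.Injective v)
    (hy : Function.Injective y) (hva : ∀ m, v m ≤ a) (hyb : ∀ m, b ≤ y m) :
    (StrictAnti v ∧ next v b ≤ y ∧ y ≤ v) ↔ (StrictAnti y ∧ y ≤ v ∧ v ≤ prev a y) := by
  cases n with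
  | zero => exact ⟨fun _ => ⟨fun i => i.elim0, fun i => i.elim0, fun i => i.elim0⟩,
      fun _ => ⟨fun i => i.elim0, fun i => i.elim0, fun i => i.elim0⟩⟩
  | succ k =>
    have h1 : next v b ≤ y ↔ ∀ m : Fin k, v m.succ ≤ y m.castSucc := by
      rw [Pi.le_def, Fin.forall_fin_succ']
      simp only [next, Fin.succ_last, Fin.snoc_last, hyb, and_true]
      simp only [← Fin.castSucc_succ, Fin.snoc_castSucc]
    have h2 : v ≤ prev a y ↔ ∀ m : Fin k, v m.succ ≤ y m.castSucc := by
      rw [Pi.le_def, Fin.forall_fin_succ]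
      simp only [prev, Fin.castSucc_zero, Fin.cons_zero, hva, true_and]
      simp only [Fin.castSucc_succ, Fin.cons_succ]
    rw [h1, h2, Fin.strictAnti_iff_succ_lt, Fin.strictAnti_iff_succ_lt]
    constructor
    · rintro ⟨_, h, hyv⟩
      exact ⟨fun m => lt_of_le_of_ne ((hyv _).trans (h m))
        (hy.ne (Fin.castSucc_lt_succ (i := m)).ne'), hyv, h⟩
    · rintro ⟨_, hyv, h⟩
      exact ⟨fun m => lt_of_le_of_ne ((h m).trans (hyv _))
        (hv.ne (Fin.castSucc_lt_succ (i := m)).ne'), h, hyv⟩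

/-- The same with one more `w` than `y`: the chain `a ≥ w_1 ≥ y_1 ≥ ⋯ ≥ y_n ≥ w_{n+1} ≥ b`. It pairs
`b⁺`, where the position of the new particle is the last `w`, with `c⁻`, where that entry is an
integration variable. -/
theorem interlacing_hat {n : ℕ} {a b : ℝ} {w : Fin (n + 1) → ℝ} {y : Fin n → ℝ}
    (hw : Function.Injective w) (hy : Function.Injective y) (hwa : ∀ m, w m ≤ a)
    (hwb : ∀ m, b ≤ w m) :
    (StrictAnti w ∧ (fun m => w m.succ) ≤ y ∧ y ≤ fun m => w m.castSucc) ↔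
      (StrictAnti y ∧ (Fin.snoc y b : Fin (n + 1) → ℝ) ≤ w ∧
        w ≤ (Fin.cons a y : Fin (n + 1) → ℝ)) := by
  have h1 : (Fin.snoc y b : Fin (n + 1) → ℝ) ≤ w ↔ y ≤ fun m => w m.castSucc := by
    rw [Pi.le_def, Fin.forall_fin_succ']
    simp only [Fin.snoc_last, Fin.snoc_castSucc, hwb, and_true, Pi.le_def]
  have h2 : w ≤ (Fin.cons a y : Fin (n + 1) → ℝ) ↔ (fun m => w m.succ) ≤ y := by
    rw [Pi.le_def, Fin.forall_fin_succ]
    simp only [Fin.cons_zero, Fin.cons_succ, hwa, true_and, Pi.le_def]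
  rw [h1, h2]
  constructor
  · rintro ⟨h, hl, hr⟩
    refine ⟨?_, hr, hl⟩
    cases n with
    | zero => exact fun i => i.elim0
    | succ k =>
      rw [Fin.strictAnti_iff_succ_lt]
      exact fun m => lt_of_le_of_ne ((hr m.succ).trans (hl m.castSucc))
        (hy.ne (Fin.castSucc_lt_succ (i := m)).ne')
  · rintro ⟨h, hr, hl⟩
    refine ⟨?_, hl, hr⟩
    rw [Fin.strictAnti_iff_succ_lt]
    exact fun m => lt_of_le_of_ne ((hl m).trans (hr m))
      (hw.ne (Fin.castSucc_lt_succ (i := m)).ne')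

theorem barMinusKernel_barEquiv (L : ℝ) (ν : ℂ) {N n : ℕ} (i : Fin n ↪ Fin N) :
    ∀ᵐ p ∂(boxMeasure L N).prod (boxMeasure L n),
      barMinusKernel L (-ν) i (barEquiv i p) = barPlusKernel L ν i p := by
  filter_upwards [Measure.quasiMeasurePreserving_fst.ae (ae_injective L N),
    Measure.quasiMeasurePreserving_snd.ae (ae_injective L n),
    Measure.quasiMeasurePreserving_fst.ae (ae_mem_cube L N),
    Measure.quasiMeasurePreserving_snd.ae (ae_mem_cube L n)] with p h1 h2 h3 h4
  rw [mem_cube] at h3 h4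
  have hi := interlacing_bar (a := L / 2) (b := -(L / 2)) (h1.comp i.injective) h2
    (fun m => (h3 _).2) fun m => (h4 m).1
  have he : ∀ m, (barEquiv i p).1 (i m) = p.2 m := fun m => i.injective.extend_apply _ _ m
  classical
  simp only [barMinusKernel, barPlusKernel, Set.indicator_apply, Set.mem_ofPred_eq, he]
  refine if_congr hi.symm ?_ rfl
  change phase (-ν) _ * phase (-ν) (∑ m, p.2 m - ∑ m, p.1 (i m)) = _
  rw [phase_neg_momentum, phase_neg_momentum, neg_sub]

theorem checkMinusKernel_hatEquiv (L : ℝ) (ν : ℂ) {N n : ℕ} (i : Fin n ↪ Fin N) :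
    ∀ᵐ p ∂(boxMeasure L (N + 1)).prod (boxMeasure L n),
      checkMinusKernel L (-ν) i (hatEquiv i p) = hatPlusKernel ν i p := by
  have hq := (measurePreserving_hatEquiv L i).quasiMeasurePreserving
  filter_upwards [hq.ae (Measure.quasiMeasurePreserving_snd.ae (ae_injective L (n + 1))),
    Measure.quasiMeasurePreserving_snd.ae (ae_injective L n),
    hq.ae (Measure.quasiMeasurePreserving_snd.ae (ae_mem_cube L (n + 1)))] with p h1 h2 h3
  rw [mem_cube] at h3
  have hi := interlacing_hat (a := L / 2) (b := -(L / 2)) h1 h2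
    (fun m => (h3 _).2) fun m => (h3 m).1
  have he : ∀ m, (hatEquiv i p).1 (i m) = p.2 m := fun m => i.injective.extend_apply _ _ m
  have hw : (hatEquiv i p).2 = (Fin.snoc (fun m => p.1 (i m).succ) (p.1 0) : Fin (n + 1) → ℝ) :=
    rfl
  have hc : ∀ m, (hatEquiv i p).2 (Fin.castSucc m) = p.1 (i m).succ := fun m => by
    rw [hw, Fin.snoc_castSucc]
  simp only [hc] at hi
  classical
  simp only [checkMinusKernel, hatPlusKernel, Set.indicator_apply, Set.mem_ofPred_eq, he]
  refine if_congr hi.symm ?_ rfl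
  rw [one_mul, phase_neg_momentum, neg_sub, Fin.sum_univ_castSucc (f := (hatEquiv i p).2),
    ← phase_add]
  simp only [hc]
  congr 1
  rw [hw, Fin.snoc_last]
  ring

/-! ### The operators on the sectors -/

section

variable {L : ℝ} {N : ℕ}

theorem toSector_of_memLp {g : (Fin N → ℝ) → ℂ} (h : MemLp g 2 (boxMeasure L N)) :
    toSector L g = h.toLp g := by
  rw [toSector, dif_pos h]

theorem coeFn_toSector {g : (Fin N → ℝ) → ℂ} (h : MemLp g 2 (boxMeasure L N)) :
    toSector L g =ᵐ[boxMeasure L N] g := by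
  rw [toSector_of_memLp h]; exact h.coeFn_toLp

theorem toSector_eq_of_ae {g : (Fin N → ℝ) → ℂ} {F : Sector L N} (h : F =ᵐ[boxMeasure L N] g) :
    toSector L g = F := by
  have hg : MemLp g 2 (boxMeasure L N) := (memLp_congr_ae h).1 (Lp.memLp F)
  exact Lp.ext ((coeFn_toSector hg).trans h.symm)

theorem toSector_congr {f g : (Fin N → ℝ) → ℂ} (hg : MemLp g 2 (boxMeasure L N))
    (h : f =ᵐ[boxMeasure L N] g) : toSector L f = toSector L g :=
  toSector_eq_of_ae ((coeFn_toSector hg).trans h.symm)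

theorem toSector_coeFn (F : Sector L N) : toSector L F = F :=
  toSector_eq_of_ae (Filter.EventuallyEq.refl _ _)

theorem toSector_linear_combination {f g : (Fin N → ℝ) → ℂ} (hf : MemLp f 2 (boxMeasure L N))
    (hg : MemLp g 2 (boxMeasure L N)) (a b : ℂ) :
    toSector L (fun x => a * f x + b * g x) = a • toSector L f + b • toSector L g := by
  refine toSector_eq_of_ae ?_
  filter_upwards [Lp.coeFn_add (a • toSector L f) (b • toSector L g),
    Lp.coeFn_smul a (toSector L f), Lp.coeFn_smul b (toSector L g), coeFn_toSector hf,
    coeFn_toSector hg] with x h1 h2 h3 h4 h5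
  rw [h1, Pi.add_apply, h2, h3, Pi.smul_apply, Pi.smul_apply, h4, h5, smul_eq_mul, smul_eq_mul]

/-- Bounded operators that agree on continuous functions are equal. -/
theorem clm_ext_continuous {E : Type*} [NormedAddCommGroup E] [NormedSpace ℂ E]
    {S T : Sector L N →L[ℂ] E}
    (h : ∀ f : (Fin N → ℝ) → ℂ, Continuous f → S (toSector L f) = T (toSector L f)) : S = T := by
  have hd := BoundedContinuousFunction.toLp_denseRange (E := ℂ) (p := 2) (boxMeasure L N) ℂ
    (by norm_num)
  refine DFunLike.coe_injective (hd.equalizer S.continuous T.continuous ?_)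
  funext f
  have hf := BoundedContinuousFunction.coeFn_toLp (p := 2) (𝕜 := ℂ) (boxMeasure L N) f
  have := h f f.continuous
  rwa [toSector_eq_of_ae hf] at this

end

/-! ### Bounded operators as weighted sums over multi-indices -/

theorem coeFn_finset_sum {L : ℝ} {N : ℕ} {ι : Type*} (s : Finset ι) (F : ι → Sector L N) :
    (∑ i ∈ s, F i : Sector L N) =ᵐ[boxMeasure L N] fun x => ∑ i ∈ s, F i x := by
  classical
  induction s using Finset.induction_on with
  | empty =>
    simp only [Finset.sum_empty]
    exact Lp.coeFn_zero ℂ 2 (boxMeasure L N)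
  | insert a s ha ih =>
    rw [Finset.sum_insert ha]
    filter_upwards [ih, Lp.coeFn_add (F a) (∑ i ∈ s, F i)] with x h1 h2
    rw [h2, Pi.add_apply, h1, Finset.sum_insert ha]

/-- The weighted sum over all multi-indices of a family of operators. -/
def multiSum {L : ℝ} (γ : ℝ) {N M M' : ℕ}
    (K : ∀ n, (Fin n ↪ Fin N) → Sector L M →L[ℂ] Sector L M') : Sector L M →L[ℂ] Sector L M' :=
  ∑ n ∈ Finset.range (N + 1), (γ : ℂ) ^ n • ∑ i, K n i

theorem coeFn_multiSum {L : ℝ} (γ : ℝ) {N M M' : ℕ}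
    {K : ∀ n, (Fin n ↪ Fin N) → Sector L M →L[ℂ] Sector L M'} {F : Sector L M}
    {e : ∀ n, (Fin n ↪ Fin N) → (Fin M' → ℝ) → ℂ}
    (h : ∀ n i, K n i F =ᵐ[boxMeasure L M'] e n i) :
    multiSum γ K F =ᵐ[boxMeasure L M'] fun x =>
      ∑ n ∈ Finset.range (N + 1), (γ : ℂ) ^ n * ∑ i, e n i x := by
  have h1 : multiSum γ K F = ∑ n ∈ Finset.range (N + 1), (γ : ℂ) ^ n • ∑ i, K n i F := by
    simp [multiSum]
  rw [h1]
  have h2 : ∀ᵐ x ∂boxMeasure L M', ∀ n i, K n i F x = e n i x :=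
    ae_all_iff.2 fun n => ae_all_iff.2 fun i => h n i
  have h3 : ∀ᵐ x ∂boxMeasure L M', ∀ n,
      ((γ : ℂ) ^ n • ∑ i, K n i F : Sector L M') x = (γ : ℂ) ^ n * ∑ i, K n i F x := by
    refine ae_all_iff.2 fun n => ?_
    filter_upwards [Lp.coeFn_smul ((γ : ℂ) ^ n) (∑ i, K n i F),
      coeFn_finset_sum Finset.univ fun i => K n i F] with x h4 h5
    rw [h4, Pi.smul_apply, h5, smul_eq_mul]
  filter_upwards [h2, h3, coeFn_finset_sum (Finset.range (N + 1))
    fun n => (γ : ℂ) ^ n • ∑ i, K n i F] with x h4 h5 h6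
  rw [h6]
  simp only [h5, h4]

section

variable (L γ : ℝ) (ν : ℂ) (N : ℕ)

/-- The bounded operator `a_ν`. -/
def aCLM : Sector L N →L[ℂ] Sector L N :=
  multiSum γ fun _ i => kernelCLM (barEquiv i) (measurePreserving_barEquiv L i)
    (barPlusKernel L ν i) (memLp_barPlusKernel L ν i)

/-- The bounded operator `d_ν`. -/
def dCLM : Sector L N →L[ℂ] Sector L N :=
  multiSum γ fun _ i => kernelCLM (barEquiv i) (measurePreserving_barEquiv L i)
    (barMinusKernel L ν i) (memLp_barMinusKernel L ν i)

/-- The bounded operator `b⁺_ν`. -/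
def bPlusCLM : Sector L N →L[ℂ] Sector L (N + 1) :=
  multiSum γ fun _ i => kernelCLM (hatEquiv i) (measurePreserving_hatEquiv L i)
    (hatPlusKernel ν i) (memLp_hatPlusKernel L ν i)

/-- The bounded operator `c⁻_ν`. -/
def cMinusCLM : Sector L (N + 1) →L[ℂ] Sector L N :=
  multiSum γ fun _ i => kernelCLM (hatEquiv i).symm
    ((measurePreserving_hatEquiv L i).symm (hatEquiv i))
    (checkMinusKernel L ν i) (memLp_checkMinusKernel L ν i)

end

section

variable {L γ : ℝ} (ν : ℂ) {N : ℕ}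

theorem coeFn_aCLM_toSector {f : (Fin N → ℝ) → ℂ} (hf : MemLp f 2 (boxMeasure L N)) :
    aCLM L γ ν N (toSector L f) =ᵐ[boxMeasure L N] aFun L γ ν f := by
  refine coeFn_multiSum γ fun n i => ?_
  filter_upwards [coeFn_kernelCLM (barEquiv i) (measurePreserving_barEquiv L i) _
    (memLp_barPlusKernel L ν i) (toSector L f), kernelFun_congr (measurePreserving_barEquiv L i)
    (barPlusKernel L ν i) (coeFn_toSector hf), ae_mem_cube L N] with x h1 h2 h3
  rw [h1, h2, eBarPlus_eq_kernelFun ν i f h3]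

theorem coeFn_dCLM_toSector {f : (Fin N → ℝ) → ℂ} (hf : MemLp f 2 (boxMeasure L N)) :
    dCLM L γ ν N (toSector L f) =ᵐ[boxMeasure L N] dFun L γ ν f := by
  refine coeFn_multiSum γ fun n i => ?_
  filter_upwards [coeFn_kernelCLM (barEquiv i) (measurePreserving_barEquiv L i) _
    (memLp_barMinusKernel L ν i) (toSector L f), kernelFun_congr (measurePreserving_barEquiv L i)
    (barMinusKernel L ν i) (coeFn_toSector hf), ae_mem_cube L N] with x h1 h2 h3
  rw [h1, h2, eBarMinus_eq_kernelFun ν i f h3]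

theorem coeFn_bPlusCLM_toSector {f : (Fin N → ℝ) → ℂ} (hf : MemLp f 2 (boxMeasure L N)) :
    bPlusCLM L γ ν N (toSector L f) =ᵐ[boxMeasure L (N + 1)] bPlusFun γ ν f := by
  refine coeFn_multiSum γ fun n i => ?_
  filter_upwards [coeFn_kernelCLM (hatEquiv i) (measurePreserving_hatEquiv L i) _
    (memLp_hatPlusKernel L ν i) (toSector L f), kernelFun_congr (measurePreserving_hatEquiv L i)
    (hatPlusKernel ν i) (coeFn_toSector hf), ae_mem_cube L (N + 1)] with x h1 h2 h3
  rw [h1, h2, eHatPlus_eq_kernelFun ν i f h3]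

theorem coeFn_cMinusCLM_toSector {f : (Fin (N + 1) → ℝ) → ℂ} (hf : MemLp f 2 (boxMeasure L (N + 1))) :
    cMinusCLM L γ ν N (toSector L f) =ᵐ[boxMeasure L N] cMinusFun L γ ν f := by
  refine coeFn_multiSum γ fun n i => ?_
  have hΘ := (measurePreserving_hatEquiv L i).symm (hatEquiv i)
  filter_upwards [coeFn_kernelCLM (hatEquiv i).symm hΘ _
    (memLp_checkMinusKernel L ν i) (toSector L f), kernelFun_congr hΘ
    (checkMinusKernel L ν i) (coeFn_toSector hf), ae_mem_cube L N] with x h1 h2 h3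
  rw [h1, h2, eCheckMinus_eq_kernelFun ν i f h3]

end

/-! ### The bilinear pairing and transposition -/

section

variable {L : ℝ}

/-- The bilinear pairing `∫ g f`. -/
def pairing {N : ℕ} (g f : Sector L N) : ℂ := inner ℂ (star g) f

theorem pairing_eq {N : ℕ} (g f : Sector L N) :
    pairing g f = ∫ x, g x * f x ∂boxMeasure L N := by
  rw [pairing, L2.inner_def]
  refine integral_congr_ae ?_
  filter_upwards [Lp.coeFn_star g] with x hx
  rw [hx]
  simp [mul_comm]

theorem pairing_comm {N : ℕ} (g f : Sector L N) : pairing g f = pairing f g := by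
  simp only [pairing_eq, mul_comm]

theorem ext_pairing {N : ℕ} {f f' : Sector L N} (h : ∀ g, pairing g f = pairing g f') : f = f' :=
  ext_inner_left ℂ fun g => by simpa only [pairing, star_star] using h (star g)

/-- `T` is the transpose of `S` with respect to the bilinear pairings. -/
def IsTranspose {M N : ℕ} (S : Sector L M →L[ℂ] Sector L N) (T : Sector L N →L[ℂ] Sector L M) :
    Prop :=
  ∀ f g, pairing g (S f) = pairing f (T g)

variable {M N K : ℕ}

theorem IsTranspose.symm {S : Sector L M →L[ℂ] Sector L N} {T : Sector L N →L[ℂ] Sector L M}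
    (h : IsTranspose S T) : IsTranspose T S := fun f g => (h g f).symm

theorem IsTranspose.comp {S : Sector L M →L[ℂ] Sector L N} {T : Sector L N →L[ℂ] Sector L M}
    (h : IsTranspose S T) {S' : Sector L N →L[ℂ] Sector L K} {T' : Sector L K →L[ℂ] Sector L N}
    (h' : IsTranspose S' T') : IsTranspose (S' ∘L S) (T ∘L T') := fun f g =>
  by
  rw [ContinuousLinearMap.comp_apply, ContinuousLinearMap.comp_apply, h', pairing_comm, h]

theorem IsTranspose.add {S S' : Sector L M →L[ℂ] Sector L N} {T T' : Sector L N →L[ℂ] Sector L M}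
    (h : IsTranspose S T) (h' : IsTranspose S' T') : IsTranspose (S + S') (T + T') := fun f g => by
  have h1 := h f g
  have h2 := h' f g
  simp only [pairing] at *
  simp only [add_apply, inner_add_right, h1, h2]

theorem IsTranspose.smul {S : Sector L M →L[ℂ] Sector L N} {T : Sector L N →L[ℂ] Sector L M}
    (h : IsTranspose S T) (c : ℂ) : IsTranspose (c • S) (c • T) := fun f g => by
  have h1 := h f g
  simp only [pairing] at *
  simp only [smul_apply, inner_smul_right, h1]

theorem IsTranspose.zero : IsTranspose (0 : Sector L M →L[ℂ] Sector L N) 0 := fun f g => by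
  simp [pairing]

theorem IsTranspose.sub {S S' : Sector L M →L[ℂ] Sector L N} {T T' : Sector L N →L[ℂ] Sector L M}
    (h : IsTranspose S T) (h' : IsTranspose S' T') : IsTranspose (S - S') (T - T') := by
  simpa [sub_eq_add_neg] using h.add (h'.smul (-1))

theorem IsTranspose.sum {ι : Type*} (s : Finset ι) {S : ι → Sector L M →L[ℂ] Sector L N}
    {T : ι → Sector L N →L[ℂ] Sector L M} (h : ∀ i, IsTranspose (S i) (T i)) :
    IsTranspose (∑ i ∈ s, S i) (∑ i ∈ s, T i) := by
  classical
  induction s using Finset.induction_on with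
  | empty => exact IsTranspose.zero
  | insert a s ha ih => rw [Finset.sum_insert ha, Finset.sum_insert ha]; exact (h a).add ih

theorem IsTranspose.multiSum {γ : ℝ} {S : ∀ n, (Fin n ↪ Fin K) → Sector L M →L[ℂ] Sector L N}
    {T : ∀ n, (Fin n ↪ Fin K) → Sector L N →L[ℂ] Sector L M}
    (h : ∀ n i, IsTranspose (S n i) (T n i)) : IsTranspose (multiSum γ S) (multiSum γ T) :=
  IsTranspose.sum _ fun n => (IsTranspose.sum _ fun i => h n i).smul _

/-- The transfer principle: since the pairing is nondegenerate, an identity between operators passes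
to their transposes, with the order of products reversed by `IsTranspose.comp`. -/
theorem IsTranspose.unique {S S' : Sector L M →L[ℂ] Sector L N}
    {T T' : Sector L N →L[ℂ] Sector L M} (h : IsTranspose S T) (h' : IsTranspose S' T')
    (e : S = S') : T = T' := by
  subst e
  exact ContinuousLinearMap.ext fun g => ext_pairing fun f => (h f g).symm.trans (h' f g)

variable (L) (γ : ℝ) (ν : ℂ) (N)

/-- Exchanging the replaced coordinates with the integration variables carries one kernel to the
other and negates the phase. The pairing is bilinear, so the momentum changes sign without being
conjugated. -/
theorem isTranspose_a_d : IsTranspose (aCLM L γ ν N) (dCLM L γ (-ν) N) := by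
  refine IsTranspose.multiSum fun n i f g => ?_
  rw [pairing_eq, pairing_eq]
  refine Eq.trans ?_ ((integral_mul_kernelFun (barEquiv i) (measurePreserving_barEquiv L i)
    (memLp_barPlusKernel L ν i) (barMinusKernel_barEquiv L ν i) (Lp.memLp f) (Lp.memLp g)).trans ?_)
  · refine integral_congr_ae ?_
    filter_upwards [coeFn_kernelCLM (barEquiv i) (measurePreserving_barEquiv L i) _
      (memLp_barPlusKernel L ν i) f] with x hx
    rw [hx]
  · refine integral_congr_ae ?_
    filter_upwards [coeFn_kernelCLM (barEquiv i) (measurePreserving_barEquiv L i) _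
      (memLp_barMinusKernel L (-ν) i) g] with x hx
    rw [hx]; rfl

theorem isTranspose_bPlus_cMinus : IsTranspose (bPlusCLM L γ ν N) (cMinusCLM L γ (-ν) N) := by
  refine IsTranspose.multiSum fun n i f g => ?_
  rw [pairing_eq, pairing_eq]
  refine Eq.trans ?_ ((integral_mul_kernelFun (hatEquiv i) (measurePreserving_hatEquiv L i)
    (memLp_hatPlusKernel L ν i) (checkMinusKernel_hatEquiv L ν i) (Lp.memLp f)
    (Lp.memLp g)).trans ?_)
  · refine integral_congr_ae ?_
    filter_upwards [coeFn_kernelCLM (hatEquiv i) (measurePreserving_hatEquiv L i) _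
      (memLp_hatPlusKernel L ν i) f] with x hx
    rw [hx]
  · refine integral_congr_ae ?_
    filter_upwards [coeFn_kernelCLM (hatEquiv i).symm
      ((measurePreserving_hatEquiv L i).symm (hatEquiv i)) _
      (memLp_checkMinusKernel L (-ν) i) g] with x hx
    rw [hx]

end

/-! ### Reflection of the operators -/

theorem measurePreserving_refl_box (L : ℝ) (N : ℕ) :
    MeasurePreserving (refl : (Fin N → ℝ) → Fin N → ℝ) (boxMeasure L N) (boxMeasure L N) := by
  refine measurePreserving_refl ?_
  have h := (Measure.measurePreserving_neg (volume : Measure ℝ)).restrict_preimage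
    (measurableSet_Icc : MeasurableSet (Set.Icc (-(L / 2)) (L / 2)))
  have hI : Neg.neg ⁻¹' Set.Icc (-(L / 2)) (L / 2) = Set.Icc (-(L / 2)) (L / 2) := by
    ext t
    simp only [Set.mem_Icc, Set.mem_preimage]
    constructor <;> rintro ⟨h1, h2⟩ <;> constructor <;> linarith
  rwa [hI] at h

/-- The reflection operator on a sector. -/
def reflCLM (L : ℝ) (N : ℕ) : Sector L N →L[ℂ] Sector L N :=
  (Lp.compMeasurePreservingₗᵢ ℂ refl (measurePreserving_refl_box L N)).toContinuousLinearMap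

section

variable {L : ℝ} {N : ℕ}

theorem coeFn_reflCLM (f : Sector L N) :
    reflCLM L N f =ᵐ[boxMeasure L N] fun x => f (refl x) :=
  Lp.coeFn_compMeasurePreserving f (measurePreserving_refl_box L N)

theorem memLp_refl {f : (Fin N → ℝ) → ℂ} (hf : MemLp f 2 (boxMeasure L N)) :
    MemLp (fun x => f (refl x)) 2 (boxMeasure L N) :=
  hf.comp_measurePreserving (measurePreserving_refl_box L N)

theorem reflCLM_toSector {f : (Fin N → ℝ) → ℂ} (hf : MemLp f 2 (boxMeasure L N)) :
    reflCLM L N (toSector L f) = toSector L fun x => f (refl x) := by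
  refine (toSector_eq_of_ae ?_).symm
  filter_upwards [coeFn_reflCLM (toSector L f),
    (measurePreserving_refl_box L N).quasiMeasurePreserving.ae (coeFn_toSector hf)] with x h1 h2
  rw [h1, h2]

theorem reflCLM_reflCLM (f : Sector L N) : reflCLM L N (reflCLM L N f) = f := by
  rw [← toSector_coeFn f, reflCLM_toSector (Lp.memLp f), reflCLM_toSector (memLp_refl (Lp.memLp f))]
  simp only [refl_refl]

theorem isTranspose_refl (L : ℝ) (N : ℕ) : IsTranspose (reflCLM L N) (reflCLM L N) := by
  intro f g
  rw [pairing_eq, pairing_eq]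
  have hmp := measurePreserving_refl_box L N
  rw [← hmp.integral_comp (reflEquiv N).measurableEmbedding]
  refine integral_congr_ae ?_
  filter_upwards [coeFn_reflCLM g, hmp.quasiMeasurePreserving.ae (coeFn_reflCLM f)] with x h1 h2
  rw [h1, h2, refl_refl, mul_comm]

end

section

variable (L γ : ℝ) (ν : ℂ) (N : ℕ)

/-- The bounded operator `b⁻_ν`. -/
def bMinusCLM : Sector L N →L[ℂ] Sector L (N + 1) :=
  reflCLM L (N + 1) ∘L bPlusCLM L γ (-ν) N ∘L reflCLM L N

/-- The bounded operator `c⁺_ν`. -/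
def cPlusCLM : Sector L (N + 1) →L[ℂ] Sector L N :=
  reflCLM L N ∘L cMinusCLM L γ (-ν) N ∘L reflCLM L (N + 1)

variable {L N}

theorem toSector_reflected {M K : ℕ} {S T : Sector L M →L[ℂ] Sector L K}
    {φ ψ : ((Fin M → ℝ) → ℂ) → (Fin K → ℝ) → ℂ}
    (hS : ∀ f, MemLp f 2 (boxMeasure L M) → S (toSector L f) =ᵐ[boxMeasure L K] φ f)
    (hψ : ∀ f x, ψ f x = φ (fun x => f (refl x)) (refl x))
    (hT : T = reflCLM L K ∘L S ∘L reflCLM L M) {f : (Fin M → ℝ) → ℂ}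
    (hf : MemLp f 2 (boxMeasure L M)) :
    T (toSector L f) = toSector L (ψ f) := by
  have h := hS _ (memLp_refl hf)
  have hφ := (memLp_congr_ae h).1 (Lp.memLp _)
  rw [hT, ContinuousLinearMap.comp_apply, ContinuousLinearMap.comp_apply, reflCLM_toSector hf,
    ← toSector_eq_of_ae h, reflCLM_toSector hφ, funext (hψ f)]

variable {γ}

theorem aCLM_toSector {f : (Fin N → ℝ) → ℂ} (hf : MemLp f 2 (boxMeasure L N)) :
    aCLM L γ ν N (toSector L f) = toSector L (aFun L γ ν f) :=
  (toSector_eq_of_ae (coeFn_aCLM_toSector ν hf)).symm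

theorem dCLM_toSector {f : (Fin N → ℝ) → ℂ} (hf : MemLp f 2 (boxMeasure L N)) :
    dCLM L γ ν N (toSector L f) = toSector L (dFun L γ ν f) :=
  (toSector_eq_of_ae (coeFn_dCLM_toSector ν hf)).symm

theorem bPlusCLM_toSector {f : (Fin N → ℝ) → ℂ} (hf : MemLp f 2 (boxMeasure L N)) :
    bPlusCLM L γ ν N (toSector L f) = toSector L (bPlusFun γ ν f) :=
  (toSector_eq_of_ae (coeFn_bPlusCLM_toSector ν hf)).symm

theorem cMinusCLM_toSector {f : (Fin (N + 1) → ℝ) → ℂ}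
    (hf : MemLp f 2 (boxMeasure L (N + 1))) :
    cMinusCLM L γ ν N (toSector L f) = toSector L (cMinusFun L γ ν f) :=
  (toSector_eq_of_ae (coeFn_cMinusCLM_toSector ν hf)).symm

theorem bMinusCLM_toSector {f : (Fin N → ℝ) → ℂ} (hf : MemLp f 2 (boxMeasure L N)) :
    bMinusCLM L γ ν N (toSector L f) = toSector L (bMinusFun γ ν f) :=
  toSector_reflected (fun _ => coeFn_bPlusCLM_toSector (-ν)) (fun f x => bMinusFun_eq γ ν f x)
    rfl hf

theorem cPlusCLM_toSector {f : (Fin (N + 1) → ℝ) → ℂ}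
    (hf : MemLp f 2 (boxMeasure L (N + 1))) :
    cPlusCLM L γ ν N (toSector L f) = toSector L (cPlusFun L γ ν f) :=
  toSector_reflected (fun _ => coeFn_cMinusCLM_toSector (-ν)) (fun f x => by
    simp only [cMinusFun_eq, refl_refl, neg_neg]) rfl hf

variable (L γ N)

theorem dCLM_eq : dCLM L γ ν N = reflCLM L N ∘L aCLM L γ (-ν) N ∘L reflCLM L N := by
  refine ContinuousLinearMap.ext fun f => ?_
  rw [← toSector_coeFn f, dCLM_toSector ν (Lp.memLp f)]
  exact (toSector_reflected (fun _ => coeFn_aCLM_toSector (-ν)) (fun f x => dFun_eq L γ ν f x)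
    rfl (Lp.memLp f)).symm

theorem isTranspose_bMinus_cPlus : IsTranspose (bMinusCLM L γ ν N) (cPlusCLM L γ (-ν) N) :=
  ((isTranspose_refl L N).comp (isTranspose_bPlus_cMinus L N γ (-ν))).comp
    (isTranspose_refl L (N + 1))

end

/-! ### Commutation relations on the sectors -/

section

variable {L γ : ℝ} (ν : ℂ) {N : ℕ}

theorem continuous_bPlus {f : (Fin N → ℝ) → ℂ} (hf : Continuous f) :
    Continuous fun z : Fin (N + 1) → ℝ => create γ ν f (z 0) (Fin.tail z) :=
  Continuous.create hf (by fun_prop) (by unfold Fin.tail; fun_prop)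

theorem continuous_a (L : ℝ) {f : (Fin N → ℝ) → ℂ} (hf : Continuous f) :
    Continuous fun x : Fin N → ℝ => create γ ν f (-(L / 2)) x :=
  Continuous.create hf (by fun_prop) (by fun_prop)

theorem bPlusCLM_of_continuous {f : (Fin N → ℝ) → ℂ} (hf : Continuous f) :
    bPlusCLM L γ ν N (toSector L f) =
      toSector L fun z : Fin (N + 1) → ℝ => create γ ν f (z 0) (Fin.tail z) := by
  rw [bPlusCLM_toSector ν (memLp_of_continuous L hf)]
  congr 1; funext z
  rw [← bPlusFun_cons γ ν hf, Fin.cons_self_tail]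

theorem aCLM_of_continuous {f : (Fin N → ℝ) → ℂ} (hf : Continuous f) :
    aCLM L γ ν N (toSector L f) = toSector L fun x => create γ ν f (-(L / 2)) x := by
  rw [aCLM_toSector ν (memLp_of_continuous L hf)]
  refine toSector_congr (memLp_of_continuous L (continuous_a ν L hf)) ?_
  filter_upwards [ae_mem_interior L N] with x hx
  rw [aFun_eq L γ ν f fun j => (hx j).1, bPlusFun_cons γ ν hf]

end

section

variable (L γ : ℝ) (N : ℕ) {l m : ℂ}

/-- A particle at `-L/2` is a spectator for another one created at `-L/2`, so the product is
`create₂` with both positions there, and `create₂_diag` applies. -/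
theorem aCLM_comm (l m : ℂ) : aCLM L γ l N ∘L aCLM L γ m N = aCLM L γ m N ∘L aCLM L γ l N := by
  refine clm_ext_continuous fun f hf => ?_
  simp only [ContinuousLinearMap.comp_apply, aCLM_of_continuous _ hf,
    aCLM_of_continuous _ (continuous_a _ L hf)]
  congr 1; funext x
  have h := create₂_diag γ l m hf (-(L / 2)) x
  simpa only [create₂, create_cons_of_le γ _ _ _ (le_refl (-(L / 2))), Fin.cons_zero,
    Fin.tail_cons] using h

/-- The exchange relation with the first particle at `-L/2` and the second at `z 0`. On its
right-hand side the particle at `-L/2` lies below the one at `z 0` and is a spectator, which turns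
the inner creation into `a_m`. -/
theorem bPlus_comp_a (h : l ≠ m) :
    bPlusCLM L γ l N ∘L aCLM L γ m N =
      exchangeCoeff γ l m • (aCLM L γ l (N + 1) ∘L bPlusCLM L γ m N) +
        (1 - exchangeCoeff γ l m) • (aCLM L γ m (N + 1) ∘L bPlusCLM L γ l N) := by
  refine clm_ext_continuous fun f hf => ?_
  simp only [add_apply, smul_apply, ContinuousLinearMap.comp_apply, aCLM_of_continuous _ hf,
    bPlusCLM_of_continuous _ hf, bPlusCLM_of_continuous _ (continuous_a _ L hf),
    aCLM_of_continuous _ (continuous_bPlus _ hf)]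
  rw [← toSector_linear_combination
    (memLp_of_continuous L (continuous_a _ L (continuous_bPlus _ hf)))
    (memLp_of_continuous L (continuous_a _ L (continuous_bPlus _ hf)))]
  refine toSector_congr (memLp_of_continuous L ((continuous_const.mul
    (continuous_a _ L (continuous_bPlus _ hf))).add (continuous_const.mul
    (continuous_a _ L (continuous_bPlus _ hf))))) ?_
  filter_upwards [ae_mem_interior L (N + 1)] with z hz
  have hE := exchange γ h hf (-(L / 2)) (z 0) (Fin.tail z)
  unfold Exchange at hE
  simp only [create₂, Fin.cons_self_tail] at hE
  rw [hE, create_cons_of_le γ _ _ _ (hz 0).1.le]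
  simp only [Fin.cons_zero, Fin.tail_cons]

theorem commutator_bPlus_a (h : l ≠ m) :
    bPlusCLM L γ l N ∘L aCLM L γ m N - aCLM L γ m (N + 1) ∘L bPlusCLM L γ l N =
      exchangeCoeff γ l m • (aCLM L γ l (N + 1) ∘L bPlusCLM L γ m N -
        aCLM L γ m (N + 1) ∘L bPlusCLM L γ l N) := by
  rw [bPlus_comp_a L γ N h]; module

/-- Uses `bPlus_comp_a` in both orders of the momenta; compatibility is again the involution
property behind `Exchange.swap`. -/
theorem commutator_a_bPlus (h : l ≠ m) :
    aCLM L γ l (N + 1) ∘L bPlusCLM L γ m N - bPlusCLM L γ m N ∘L aCLM L γ l N =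
      exchangeCoeff γ l m • (bPlusCLM L γ l N ∘L aCLM L γ m N -
        bPlusCLM L γ m N ∘L aCLM L γ l N) := by
  rw [bPlus_comp_a L γ N h, bPlus_comp_a L γ N h.symm, exchangeCoeff_swap]; module

theorem exchangeCoeff_neg (γ : ℝ) (l m : ℂ) :
    exchangeCoeff γ (-l) (-m) = -exchangeCoeff γ l m := by
  rw [exchangeCoeff, exchangeCoeff, ← div_neg]; ring_nf

theorem dCLM_comp_bMinus (l m : ℂ) :
    dCLM L γ l (N + 1) ∘L bMinusCLM L γ m N = reflCLM L (N + 1) ∘L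
      (aCLM L γ (-l) (N + 1) ∘L bPlusCLM L γ (-m) N) ∘L reflCLM L N := by
  refine ContinuousLinearMap.ext fun f => ?_
  simp only [dCLM_eq, bMinusCLM, ContinuousLinearMap.comp_apply, reflCLM_reflCLM]

theorem bMinusCLM_comp_d (l m : ℂ) :
    bMinusCLM L γ l N ∘L dCLM L γ m N = reflCLM L (N + 1) ∘L
      (bPlusCLM L γ (-l) N ∘L aCLM L γ (-m) N) ∘L reflCLM L N := by
  refine ContinuousLinearMap.ext fun f => ?_
  simp only [dCLM_eq, bMinusCLM, ContinuousLinearMap.comp_apply, reflCLM_reflCLM]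

theorem dCLM_comm (l m : ℂ) : dCLM L γ l N ∘L dCLM L γ m N = dCLM L γ m N ∘L dCLM L γ l N := by
  have h := (isTranspose_a_d L N γ (-m)).comp (isTranspose_a_d L N γ (-l))
  have h' := (isTranspose_a_d L N γ (-l)).comp (isTranspose_a_d L N γ (-m))
  simpa only [neg_neg] using h'.unique h (aCLM_comm L γ N _ _)

/-- Conjugating by the reflection negates both momenta, and `exchangeCoeff` is odd under this,
whence the sign. -/
theorem commutator_bMinus_d (h : l ≠ m) :
    bMinusCLM L γ l N ∘L dCLM L γ m N - dCLM L γ m (N + 1) ∘L bMinusCLM L γ l N =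
      (-exchangeCoeff γ l m) • (dCLM L γ l (N + 1) ∘L bMinusCLM L γ m N -
        dCLM L γ m (N + 1) ∘L bMinusCLM L γ l N) := by
  have hc := commutator_bPlus_a L γ N (neg_injective.ne h)
  rw [exchangeCoeff_neg] at hc
  simp only [dCLM_comp_bMinus, bMinusCLM_comp_d, ← ContinuousLinearMap.comp_sub,
    ← ContinuousLinearMap.sub_comp, hc, ContinuousLinearMap.comp_smul,
    ContinuousLinearMap.smul_comp]

theorem commutator_d_bMinus (h : l ≠ m) :
    dCLM L γ l (N + 1) ∘L bMinusCLM L γ m N - bMinusCLM L γ m N ∘L dCLM L γ l N =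
      (-exchangeCoeff γ l m) • (bMinusCLM L γ l N ∘L dCLM L γ m N -
        bMinusCLM L γ m N ∘L dCLM L γ l N) := by
  have hc := commutator_a_bPlus L γ N (neg_injective.ne h)
  rw [exchangeCoeff_neg] at hc
  simp only [dCLM_comp_bMinus, bMinusCLM_comp_d, ← ContinuousLinearMap.comp_sub,
    ← ContinuousLinearMap.sub_comp, hc, ContinuousLinearMap.comp_smul,
    ContinuousLinearMap.smul_comp]

theorem isTranspose_d_a (ν : ℂ) : IsTranspose (dCLM L γ ν N) (aCLM L γ (-ν) N) := by
  simpa only [neg_neg] using (isTranspose_a_d L N γ (-ν)).symm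

/-- The transpose of `commutator_bPlus_a` at the momenta `(-m, -l)`. Products reverse, while
negating and interchanging the momenta each flip the sign of the coefficient and cancel. The three
commutators that follow are obtained in the same way. -/
theorem commutator_d_cMinus (h : l ≠ m) :
    dCLM L γ l N ∘L cMinusCLM L γ m N - cMinusCLM L γ m N ∘L dCLM L γ l (N + 1) =
      exchangeCoeff γ l m • (cMinusCLM L γ l N ∘L dCLM L γ m (N + 1) -
        cMinusCLM L γ m N ∘L dCLM L γ l (N + 1)) := by
  have hb := fun ν => isTranspose_bPlus_cMinus L N γ ν
  have ha := fun K ν => isTranspose_a_d L K γ ν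
  have hc := commutator_bPlus_a L γ N (neg_injective.ne h.symm)
  rw [exchangeCoeff_neg, exchangeCoeff_swap, neg_neg] at hc
  have := (((ha N (-l)).comp (hb (-m))).sub ((hb (-m)).comp (ha (N + 1) (-l)))).unique
    ((((hb (-l)).comp (ha (N + 1) (-m))).sub ((hb (-m)).comp (ha (N + 1) (-l)))).smul _) hc
  simpa only [neg_neg] using this

theorem commutator_cMinus_d (h : l ≠ m) :
    cMinusCLM L γ l N ∘L dCLM L γ m (N + 1) - dCLM L γ m N ∘L cMinusCLM L γ l N =
      exchangeCoeff γ l m • (dCLM L γ l N ∘L cMinusCLM L γ m N -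
        dCLM L γ m N ∘L cMinusCLM L γ l N) := by
  have hb := fun ν => isTranspose_bPlus_cMinus L N γ ν
  have ha := fun K ν => isTranspose_a_d L K γ ν
  have hc := commutator_a_bPlus L γ N (neg_injective.ne h.symm)
  rw [exchangeCoeff_neg, exchangeCoeff_swap, neg_neg] at hc
  have := ((((hb (-l)).comp (ha (N + 1) (-m))).sub ((ha N (-m)).comp (hb (-l))))).unique
    ((((ha N (-l)).comp (hb (-m))).sub ((ha N (-m)).comp (hb (-l)))).smul _) hc
  simpa only [neg_neg] using this

theorem commutator_a_cPlus (h : l ≠ m) :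
    aCLM L γ l N ∘L cPlusCLM L γ m N - cPlusCLM L γ m N ∘L aCLM L γ l (N + 1) =
      (-exchangeCoeff γ l m) • (cPlusCLM L γ l N ∘L aCLM L γ m (N + 1) -
        cPlusCLM L γ m N ∘L aCLM L γ l (N + 1)) := by
  have hb := fun ν : ℂ => isTranspose_bMinus_cPlus L γ ν N
  have ha := fun (K : ℕ) (ν : ℂ) => isTranspose_d_a L γ K ν
  have hc := commutator_bMinus_d L γ N (neg_injective.ne h.symm)
  rw [exchangeCoeff_neg, exchangeCoeff_swap, neg_neg] at hc
  have := (((ha N (-l)).comp (hb (-m))).sub ((hb (-m)).comp (ha (N + 1) (-l)))).unique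
    ((((hb (-l)).comp (ha (N + 1) (-m))).sub ((hb (-m)).comp (ha (N + 1) (-l)))).smul _) hc
  simpa only [neg_neg] using this

theorem commutator_cPlus_a (h : l ≠ m) :
    cPlusCLM L γ l N ∘L aCLM L γ m (N + 1) - aCLM L γ m N ∘L cPlusCLM L γ l N =
      (-exchangeCoeff γ l m) • (aCLM L γ l N ∘L cPlusCLM L γ m N -
        aCLM L γ m N ∘L cPlusCLM L γ l N) := by
  have hb := fun ν : ℂ => isTranspose_bMinus_cPlus L γ ν N
  have ha := fun (K : ℕ) (ν : ℂ) => isTranspose_d_a L γ K ν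
  have hc := commutator_d_bMinus L γ N (neg_injective.ne h.symm)
  rw [exchangeCoeff_neg, exchangeCoeff_swap, neg_neg] at hc
  have := ((((hb (-l)).comp (ha (N + 1) (-m))).sub ((ha N (-m)).comp (hb (-l))))).unique
    ((((ha N (-l)).comp (hb (-m))).sub ((ha N (-m)).comp (hb (-l)))).smul _) hc
  simpa only [neg_neg] using this

/-- If the operators `b⁻_l` and `b⁺_m` commute for all `l`, `m`, then so do `c⁻_l` and `c⁺_m`. -/
theorem cMinus_comp_cPlus
    (h : ∀ l m : ℂ, bMinusCLM L γ l (N + 1) ∘L bPlusCLM L γ m N =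
      bPlusCLM L γ m (N + 1) ∘L bMinusCLM L γ l N) (l m : ℂ) :
    cMinusCLM L γ l N ∘L cPlusCLM L γ m (N + 1) = cPlusCLM L γ m N ∘L cMinusCLM L γ l (N + 1) := by
  have hb := fun K ν => isTranspose_bPlus_cMinus L K γ ν
  have hb' := fun K ν => isTranspose_bMinus_cPlus L γ ν K
  have := ((hb N (-l)).comp (hb' (N + 1) (-m))).unique ((hb' N (-m)).comp (hb (N + 1) (-l)))
    (h (-m) (-l))
  simpa only [neg_neg] using this

end

/-! ### Deformed permutations of plane waves -/

section

variable {γ : ℝ} {N : ℕ}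

theorem continuous_lineIntegral {X : Type*} [TopologicalSpace X] [FirstCountableTopology X]
    (j k : Fin N) {f : X → (Fin N → ℝ) → ℂ}
    (hf : Continuous fun p : X × (Fin N → ℝ) => f p.1 p.2) :
    Continuous fun p : X × (Fin N → ℝ) => lineIntegral j k (f p.1) p.2 := by
  unfold lineIntegral
  refine continuous_intervalIntegral continuous_const (by fun_prop) ?_
  exact hf.comp (by fun_prop : Continuous fun q : (X × (Fin N → ℝ)) × ℝ =>
    (q.1.1, q.1.2 - q.2 • (Pi.single j 1 - Pi.single k 1 : Fin N → ℝ)))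

theorem continuous_deformedSwap_param {X : Type*} [TopologicalSpace X] [FirstCountableTopology X]
    (γ : ℝ) (j : {j : ℕ // j + 1 < N}) {f : X → (Fin N → ℝ) → ℂ}
    (hf : Continuous fun p : X × (Fin N → ℝ) => f p.1 p.2) :
    Continuous fun p : X × (Fin N → ℝ) => deformedSwap γ j (f p.1) p.2 := by
  unfold deformedSwap
  refine (hf.comp (?_ : Continuous fun p : X × (Fin N → ℝ) => (p.1, p.2 ∘ simpleSwap j))).add
    ((continuous_lineIntegral _ _ hf).const_mul _)
  exact continuous_fst.prodMk (continuous_pi fun m =>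
    (continuous_apply (simpleSwap j m)).comp continuous_snd)

theorem continuous_foldr_param {X : Type*} [TopologicalSpace X] [FirstCountableTopology X]
    (γ : ℝ) (w : List {j : ℕ // j + 1 < N}) {f : X → (Fin N → ℝ) → ℂ}
    (hf : Continuous fun p : X × (Fin N → ℝ) => f p.1 p.2) :
    Continuous fun p : X × (Fin N → ℝ) => w.foldr (deformedSwap γ) (f p.1) p.2 := by
  induction w with
  | nil => exact hf
  | cons j w ih => 
    exact continuous_deformedSwap_param γ j
      (f := fun q => w.foldr (deformedSwap γ) (f q)) ih

theorem continuous_foldr (γ : ℝ) (w : List {j : ℕ // j + 1 < N}) {f : (Fin N → ℝ) → ℂ}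
    (hf : Continuous f) : Continuous (w.foldr (deformedSwap γ) f) :=
  (continuous_foldr_param (X := Unit) γ w (f := fun _ => f) (hf.comp continuous_snd)).comp
    (by fun_prop : Continuous fun x : Fin N → ℝ => ((), x))

theorem deformedSwap_linear_combination (γ : ℝ) (j : {j : ℕ // j + 1 < N})
    {f g : (Fin N → ℝ) → ℂ} (hf : Continuous f) (hg : Continuous g) (a b : ℂ) :
    deformedSwap γ j (fun x => a * f x + b * g x) =
      fun x => a * deformedSwap γ j f x + b * deformedSwap γ j g x := by
  funext x
  simp only [deformedSwap, lineIntegral]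
  rw [intervalIntegral.integral_add, intervalIntegral.integral_const_mul,
    intervalIntegral.integral_const_mul]
  · ring
  · exact Continuous.intervalIntegrable (by fun_prop) _ _
  · exact Continuous.intervalIntegrable (by fun_prop) _ _

theorem foldr_linear_combination (γ : ℝ) (w : List {j : ℕ // j + 1 < N})
    {f g : (Fin N → ℝ) → ℂ} (hf : Continuous f) (hg : Continuous g) (a b : ℂ) :
    w.foldr (deformedSwap γ) (fun x => a * f x + b * g x) =
      fun x => a * w.foldr (deformedSwap γ) f x + b * w.foldr (deformedSwap γ) g x := by
  induction w with
  | nil => rfl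
  | cons j w ih =>
    simp only [List.foldr_cons]
    rw [ih, deformedSwap_linear_combination γ j (continuous_foldr γ w hf) (continuous_foldr γ w hg)]

theorem continuous_planeWave_param :
    Continuous fun p : (Fin N → ℂ) × (Fin N → ℝ) => planeWave p.1 p.2 := by
  unfold planeWave; fun_prop

theorem continuous_planeWave (k : Fin N → ℂ) : Continuous (planeWave k) := by
  unfold planeWave; fun_prop

theorem planeWave_comp_perm (k : Fin N → ℂ) (x : Fin N → ℝ) (σ : Equiv.Perm (Fin N))
    (hσ : σ * σ = 1) : planeWave k (x ∘ σ) = planeWave (k ∘ σ) x := by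
  unfold planeWave
  congr 2
  rw [← Equiv.sum_comp σ]
  refine Finset.sum_congr rfl fun j _ => ?_
  simp only [Function.comp_apply]
  rw [← Equiv.Perm.mul_apply, hσ, Equiv.Perm.one_apply]

theorem simpleSwap_mul_self (j : {j : ℕ // j + 1 < N}) : simpleSwap j * simpleSwap j = 1 :=
  Equiv.swap_mul_self _ _

/-- The exchange coefficient of two consecutive entries of a wave vector. -/
def swapCoeff (γ : ℝ) (j : {j : ℕ // j + 1 < N}) (k : Fin N → ℂ) : ℂ :=
  exchangeCoeff γ (k ⟨j.1, Nat.lt_of_succ_lt j.2⟩) (k ⟨j.1 + 1, j.2⟩)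

theorem planeWave_sub_smul (k : Fin N → ℂ) (x : Fin N → ℝ) (a b : Fin N) (y : ℝ) :
    planeWave k (x - y • (Pi.single a 1 - Pi.single b 1)) =
      planeWave k x * Complex.exp (-(Complex.I * (k a - k b)) * y) := by
  unfold planeWave
  rw [← Complex.exp_add]
  congr 1
  have : ∀ j, k j * ((x - y • (Pi.single a 1 - Pi.single b 1 : Fin N → ℝ)) j : ℝ) =
      k j * x j - y * (k j * (Pi.single a 1 : Fin N → ℂ) j - k j * (Pi.single b 1 : Fin N → ℂ) j) := by
    intro j
    simp only [Pi.sub_apply, Pi.smul_apply, smul_eq_mul, Pi.single_apply]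
    split_ifs <;> push_cast <;> ring
  simp only [this, Finset.sum_sub_distrib, ← Finset.mul_sum]
  simp [Pi.single_apply]
  ring

/-- Along the line of integration a plane wave is a single exponential, and the endpoint of the
segment is the swapped point. The result stays in the span of two plane waves, with the coefficient
of the exchange relation. -/
theorem deformedSwap_planeWave (γ : ℝ) (j : {j : ℕ // j + 1 < N}) {k : Fin N → ℂ}
    (hk : k ⟨j.1, Nat.lt_of_succ_lt j.2⟩ ≠ k ⟨j.1 + 1, j.2⟩) :
    deformedSwap γ j (planeWave k) = fun x =>
      (1 - swapCoeff γ j k) * planeWave (k ∘ simpleSwap j) x + swapCoeff γ j k * planeWave k x := by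
  funext x
  set a : Fin N := ⟨j.1, Nat.lt_of_succ_lt j.2⟩ with ha
  set b : Fin N := ⟨j.1 + 1, j.2⟩ with hb
  have hab : a ≠ b := by rw [ha, hb]; simp
  have hc : -(Complex.I * (k a - k b)) ≠ 0 :=
    neg_ne_zero.2 (mul_ne_zero Complex.I_ne_zero (sub_ne_zero.2 hk))
  have hx : x - (x a - x b) • (Pi.single a 1 - Pi.single b 1 : Fin N → ℝ) = x ∘ simpleSwap j := by
    ext m
    simp only [simpleSwap, ← ha, ← hb, Function.comp_apply, Equiv.swap_apply_def, Pi.sub_apply,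
      Pi.smul_apply, Pi.single_apply, smul_eq_mul]
    by_cases h1 : m = a
    · subst h1; simp [hab]
    · by_cases h2 : m = b
      · subst h2; simp [h1]
      · simp [h1, h2]
  have hI : lineIntegral a b (planeWave k) x * (-(Complex.I * (k a - k b))) =
      planeWave (k ∘ simpleSwap j) x - planeWave k x := by
    rw [← planeWave_comp_perm k x _ (simpleSwap_mul_self j), ← hx, planeWave_sub_smul, lineIntegral]
    simp only [planeWave_sub_smul]
    rw [intervalIntegral.integral_const_mul, integral_exp_mul_complex hc]
    simp only [Complex.ofReal_zero, mul_zero, Complex.exp_zero]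
    field_simp
  have hκ : swapCoeff γ j k * (Complex.I * (k a - k b)) = γ := exchangeCoeff_mul hk
  rw [deformedSwap, planeWave_comp_perm _ _ _ (simpleSwap_mul_self j), ← hκ]
  linear_combination (-swapCoeff γ j k) * hI

end

/-! ### Families of functions with the exchange property -/

/-- The family `Φ_k` consists of the plane waves on the fundamental chamber, and its behaviour under
simple transpositions is that of the pre-wavefunctions. -/
structure IsWaveFamily (γ : ℝ) {N : ℕ} (Φ : (Fin N → ℂ) → (Fin N → ℝ) → ℂ) : Prop where
  continuous : Continuous fun p : (Fin N → ℂ) × (Fin N → ℝ) => Φ p.1 p.2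
  eq_planeWave : ∀ k x, StrictAnti x → Φ k x = planeWave k x
  exchange : ∀ (j : {j : ℕ // j + 1 < N}) (k : Fin N → ℂ) (x : Fin N → ℝ),
    k ⟨j.1, Nat.lt_of_succ_lt j.2⟩ ≠ k ⟨j.1 + 1, j.2⟩ →
    Φ k (x ∘ simpleSwap j) =
      (1 - swapCoeff γ j k) * Φ (k ∘ simpleSwap j) x + swapCoeff γ j k * Φ k x

/-- Exchange formulas need distinct momenta; this density removes the restriction by continuity in
`k`. -/
theorem dense_injective (N : ℕ) : Dense {k : Fin N → ℂ | Function.Injective k} := by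
  have h : {k : Fin N → ℂ | Function.Injective k} =
      ⋂ p : {p : Fin N × Fin N // p.1 ≠ p.2}, {k | k p.1.1 ≠ k p.1.2} := by
    ext k
    simp only [Set.mem_ofPred_eq, Set.mem_iInter, Subtype.forall, Prod.forall]
    exact ⟨fun hk a b hab => hk.ne hab, fun hk a b hab => by_contra fun hne => hk a b hne hab⟩
  rw [h]
  refine dense_iInter_of_isOpen (fun p => isOpen_ne_fun (by fun_prop) (by fun_prop)) fun p => ?_
  obtain ⟨⟨a, b⟩, hab⟩ := p
  let q : (Fin N → ℂ) →ₗ[ℂ] ℂ :=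
    (LinearMap.proj a : (Fin N → ℂ) →ₗ[ℂ] ℂ) - (LinearMap.proj b : (Fin N → ℂ) →ₗ[ℂ] ℂ)
  have hq : {k : Fin N → ℂ | k a ≠ k b} = ((LinearMap.ker q : Set (Fin N → ℂ)))ᶜ := by
    ext k; simp [q, sub_eq_zero]
  simp only
  rw [hq, ← interior_eq_empty_iff_dense_compl]
  by_contra hne
  have htop := Submodule.eq_top_of_nonempty_interior' (LinearMap.ker q)
    (Set.nonempty_iff_ne_empty.2 hne)
  have : q (Pi.single a 1) = 0 := LinearMap.mem_ker.1 (htop ▸ Submodule.mem_top)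
  simp [q, Ne.symm hab] at this

section

variable {γ : ℝ} {N : ℕ} {Φ : (Fin N → ℂ) → (Fin N → ℝ) → ℂ}

/-- Peel off the last letter of the word. On the right it acts directly on the plane wave, on the
left it moves the argument, and both yield the same combination of momenta `k` and `k ∘ simpleSwap
j`. -/
theorem IsWaveFamily.eq_foldr (h : IsWaveFamily γ Φ) (w : List {j : ℕ // j + 1 < N})
    {y : Fin N → ℝ} (hy : StrictAnti y) (k : Fin N → ℂ) :
    Φ k (y ∘ (w.map simpleSwap).prod) = w.foldr (deformedSwap γ) (planeWave k) y := by
  have key : ∀ k : Fin N → ℂ, Function.Injective k →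
      Φ k (y ∘ (w.map simpleSwap).prod) = w.foldr (deformedSwap γ) (planeWave k) y := by
    induction w using List.reverseRecOn with
    | nil => exact fun k _ => h.eq_planeWave k y hy
    | append_singleton w j ih =>
      intro k hk
      have hne : k ⟨j.1, Nat.lt_of_succ_lt j.2⟩ ≠ k ⟨j.1 + 1, j.2⟩ := hk.ne (by simp)
      rw [List.foldr_append, List.foldr_cons, List.foldr_nil, deformedSwap_planeWave γ j hne,
        foldr_linear_combination γ w (continuous_planeWave _) (continuous_planeWave _)]
      beta_reduce
      rw [← ih k hk, ← ih _ (hk.comp (simpleSwap j).injective), List.map_append, List.prod_append,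
        List.map_singleton, List.prod_singleton, Equiv.Perm.coe_mul, ← Function.comp_assoc,
        h.exchange j k _ hne]
  have h1 : Continuous fun k : Fin N → ℂ => Φ k (y ∘ (w.map simpleSwap).prod) :=
    h.continuous.comp (by fun_prop : Continuous fun k : Fin N → ℂ =>
      (k, y ∘ (w.map simpleSwap).prod))
  have h2 : Continuous fun k : Fin N → ℂ => w.foldr (deformedSwap γ) (planeWave k) y :=
    (continuous_foldr_param γ w continuous_planeWave_param).comp
      (by fun_prop : Continuous fun k : Fin N → ℂ => (k, y))
  exact congrFun (Continuous.ext_on (dense_injective N) h1 h2 key) k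

theorem strictAnti_comp_perm_unique {x : Fin N → ℝ} {σ τ : Equiv.Perm (Fin N)}
    (hσ : StrictAnti (x ∘ σ)) (hτ : StrictAnti (x ∘ τ)) : σ = τ := by
  have hm : StrictMono (σ⁻¹ * τ) := by
    intro a b hab
    by_contra hcon
    have h1 := hσ.antitone (not_lt.1 hcon)
    have h2 : ∀ c, (x ∘ σ) ((σ⁻¹ * τ) c) = (x ∘ τ) c := fun c =>
      congrArg x (σ.apply_symm_apply (τ c))
    rw [h2, h2] at h1
    exact absurd (hτ hab) (not_lt.2 h1)
  have h1 : σ⁻¹ * τ = 1 := by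
    have := Subsingleton.elim (hm.orderIsoOfSurjective _ (σ⁻¹ * τ).surjective)
      (OrderIso.refl (Fin N))
    ext a
    exact congrArg Fin.val (DFunLike.congr_fun this a)
  rw [inv_mul_eq_one] at h1
  exact h1

theorem exists_perm_strictAnti {x : Fin N → ℝ} (hx : Function.Injective x) :
    ∃ σ : Equiv.Perm (Fin N), StrictAnti (x ∘ σ) := by
  refine ⟨Tuple.sort fun j => -x j, ?_⟩
  have h := Tuple.monotone_sort fun j => -x j
  refine Antitone.strictAnti_of_injective (fun a b hab => neg_le_neg_iff.1 (h hab))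
    (hx.comp (Equiv.injective _))

theorem propagation_eq (γ : ℝ) (f : (Fin N → ℝ) → ℂ) {x : Fin N → ℝ} {w : Equiv.Perm (Fin N)}
    (hw : StrictAnti (x ∘ (w⁻¹ : Equiv.Perm (Fin N)))) :
    propagation γ f x = deformedPerm γ w f (x ∘ (w⁻¹ : Equiv.Perm (Fin N))) := by
  classical
  rw [propagation, Finset.sum_eq_single w]
  · rw [if_pos hw]
  · intro v _ hv
    rw [if_neg]
    exact fun h => hv (inv_injective (strictAnti_comp_perm_unique h hw))
  · exact fun h => absurd (Finset.mem_univ w) h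

/-- Away from coinciding coordinates a wave family has no freedom left. This is what identifies the
waves built with `b⁺` and those built with `b⁻`. -/
theorem IsWaveFamily.eq_propagation (h : IsWaveFamily γ Φ) (k : Fin N → ℂ) {x : Fin N → ℝ}
    (hx : Function.Injective x) : Φ k x = propagation γ (planeWave k) x := by
  obtain ⟨σ, hσ⟩ := exists_perm_strictAnti hx
  obtain ⟨w, rfl⟩ : ∃ w, σ = w⁻¹ := ⟨σ⁻¹, (inv_inv σ).symm⟩
  rw [propagation_eq γ _ hσ, deformedPerm, ← h.eq_foldr (word w) hσ, word,
    (exists_simpleSwap_word w).choose_spec, Function.comp_assoc, ← Equiv.Perm.coe_mul,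
    inv_mul_cancel, Equiv.Perm.coe_one, Function.comp_id]

theorem IsWaveFamily.toSector_eq (h : IsWaveFamily γ Φ) (L : ℝ) (k : Fin N → ℂ) :
    toSector L (Φ k) = preWave L γ k := by
  refine (toSector_congr (memLp_of_continuous L ?_) ?_).symm
  · exact h.continuous.comp (by fun_prop : Continuous fun x : Fin N → ℝ => (k, x))
  · filter_upwards [ae_injective L N] with x hx using (h.eq_propagation k hx).symm

end

/-! ### Pre-wavefunctions by particle creation -/

/-- `b⁺_{k_1} ⋯ b⁺_{k_N}` applied to the vacuum. -/
def wavePlus (γ : ℝ) : ∀ {N : ℕ}, (Fin N → ℂ) → (Fin N → ℝ) → ℂ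
  | 0, _, _ => 1
  | _ + 1, k, x => create γ (k 0) (wavePlus γ (Fin.tail k)) (x 0) (Fin.tail x)

/-- `b⁻_{k_N} ⋯ b⁻_{k_1}` applied to the vacuum. -/
def waveMinus (γ : ℝ) {N : ℕ} (k : Fin N → ℂ) (x : Fin N → ℝ) : ℂ :=
  wavePlus γ (fun j => -k j.rev) (refl x)

theorem continuous_wavePlus_param (γ : ℝ) (N : ℕ) :
    Continuous fun p : (Fin N → ℂ) × (Fin N → ℝ) => wavePlus γ p.1 p.2 := by
  induction N with
  | zero => exact continuous_const
  | succ N ih =>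
    have h := continuous_create_param (X := Fin (N + 1) → ℂ) γ (ν := fun k => k 0)
      (f := fun k => wavePlus γ (Fin.tail k)) (by fun_prop)
      (ih.comp (by unfold Fin.tail; fun_prop :
        Continuous fun p : (Fin (N + 1) → ℂ) × (Fin N → ℝ) => ((Fin.tail p.1 : Fin N → ℂ), p.2)))
    exact h.comp (by unfold Fin.tail; fun_prop :
      Continuous fun p : (Fin (N + 1) → ℂ) × (Fin (N + 1) → ℝ) =>
        (p.1, p.2 0, (Fin.tail p.2 : Fin N → ℝ)))

theorem continuous_wavePlus (γ : ℝ) {N : ℕ} (k : Fin N → ℂ) : Continuous (wavePlus γ k) :=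
  (continuous_wavePlus_param γ N).comp (by fun_prop : Continuous fun x : Fin N → ℝ => (k, x))

theorem wavePlus_of_strictAnti (γ : ℝ) {N : ℕ} (k : Fin N → ℂ) {x : Fin N → ℝ}
    (hx : StrictAnti x) : wavePlus γ k x = planeWave k x := by
  induction N with
  | zero => simp [wavePlus, planeWave]
  | succ N ih =>
    have hle : ∀ j, Fin.tail x j ≤ x 0 := fun j => hx.antitone (Fin.zero_le j.succ)
    have htail : StrictAnti (Fin.tail x) := hx.comp_strictMono Fin.strictMono_succ
    rw [wavePlus, create_of_forall_le hle,
      ih _ htail, planeWave, planeWave, Fin.sum_univ_succ,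
      mul_add, Complex.exp_add, phase, mul_assoc]
    rfl

theorem simpleSwap_succ_apply {N : ℕ} {α : Type*} (j : ℕ) (hj : j + 1 + 1 < N + 1)
    (x : Fin (N + 1) → α) :
    (x ∘ simpleSwap ⟨j + 1, hj⟩) 0 = x 0 ∧
      Fin.tail (x ∘ simpleSwap ⟨j + 1, hj⟩) = Fin.tail x ∘ simpleSwap ⟨j, by omega⟩ := by
  constructor
  · rw [Function.comp_apply, simpleSwap, Equiv.swap_apply_of_ne_of_ne] <;>
      simp [Fin.ext_iff]
  · ext m
    simp only [Fin.tail, Function.comp_apply, simpleSwap]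
    congr 1
    have := (Fin.succ_injective N).swap_apply (⟨j, by omega⟩ : Fin N) ⟨j + 1, by omega⟩ m
    simpa using this

/-- For the first two particles this is `exchange`. For a later pair the rule passes through the
outermost creation, which is linear and commutes with permutations of the other particles. -/
theorem wavePlus_exchange (γ : ℝ) {N : ℕ} (j : {j : ℕ // j + 1 < N}) (k : Fin N → ℂ)
    (x : Fin N → ℝ) (hk : k ⟨j.1, Nat.lt_of_succ_lt j.2⟩ ≠ k ⟨j.1 + 1, j.2⟩) :
    wavePlus γ k (x ∘ simpleSwap j) =
      (1 - swapCoeff γ j k) * wavePlus γ (k ∘ simpleSwap j) x + swapCoeff γ j k * wavePlus γ k x := by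
  induction N with
  | zero => exact absurd j.2 (by omega)
  | succ N ih =>
    obtain ⟨j, hj⟩ := j
    cases j with
    | zero =>
      obtain ⟨N, rfl⟩ : ∃ M, N = M + 1 := ⟨N - 1, by omega⟩
      have h2 : ∀ (k : Fin (N + 2) → ℂ) (x : Fin (N + 2) → ℝ), wavePlus γ k x =
          create₂ γ (k 0) (k 1) (wavePlus γ (Fin.tail (Fin.tail k))) (x 0) (x 1)
            (Fin.tail (Fin.tail x)) := fun k x => by
        rw [wavePlus, create₂]
        congr 1
        exact (Fin.cons_self_tail (Fin.tail x)).symm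
      have e0 : ∀ {α : Type} (x : Fin (N + 2) → α), (x ∘ simpleSwap ⟨0, hj⟩) 0 = x 1 :=
        fun x => congrArg x (Equiv.swap_apply_left _ _)
      have e1 : ∀ {α : Type} (x : Fin (N + 2) → α), (x ∘ simpleSwap ⟨0, hj⟩) 1 = x 0 :=
        fun x => congrArg x (Equiv.swap_apply_right _ _)
      have e2 : ∀ {α : Type} (x : Fin (N + 2) → α),
          Fin.tail (Fin.tail (x ∘ simpleSwap ⟨0, hj⟩)) = Fin.tail (Fin.tail x) := fun x => by
        ext m
        refine congrArg x (Equiv.swap_apply_of_ne_of_ne ?_ ?_) <;> simp [Fin.ext_iff]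
      have hE := exchange γ (l := k 0) (m := k 1) hk
        (continuous_wavePlus γ (Fin.tail (Fin.tail k))) (x 0) (x 1) (Fin.tail (Fin.tail x))
      unfold Exchange at hE
      rw [h2, h2, h2, e0, e1, e2, e0, e1, e2, ← hE, add_comm]
      rfl
    | succ j =>
      obtain ⟨h0, ht⟩ := simpleSwap_succ_apply j hj x
      obtain ⟨h0', ht'⟩ := simpleSwap_succ_apply j hj k
      rw [wavePlus, h0, ht, wavePlus, h0', ht', wavePlus, ← create_comp_perm]
      have := fun y => ih ⟨j, by omega⟩ (Fin.tail k) y hk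
      simp only [this]
      exact create_linear_combination γ _ (continuous_wavePlus γ _) (continuous_wavePlus γ _) _ _ _ _

theorem isWaveFamily_wavePlus (γ : ℝ) (N : ℕ) : IsWaveFamily γ (wavePlus γ (N := N)) :=
  ⟨continuous_wavePlus_param γ N, fun k _ => wavePlus_of_strictAnti γ k, wavePlus_exchange γ⟩

theorem isWaveFamily_waveMinus (γ : ℝ) (N : ℕ) : IsWaveFamily γ (waveMinus γ (N := N)) := by
  refine ⟨?_, fun k x hx => ?_, fun j k x hk => ?_⟩
  · exact (continuous_wavePlus_param γ N).comp (by fun_prop :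
      Continuous fun p : (Fin N → ℂ) × (Fin N → ℝ) => ((fun j => -p.1 j.rev : Fin N → ℂ), refl p.2))
  · rw [waveMinus, wavePlus_of_strictAnti γ _ (strictAnti_refl_iff.2 hx), planeWave, planeWave,
      ← Equiv.sum_comp Fin.revPerm]
    simp [refl]
  · obtain ⟨j, hj⟩ := j
    -- Reversal carries the pair `j, j + 1` to `N - 2 - j, N - 1 - j` with its order interchanged.
    -- In the coefficient this sign cancels the one from negating the momenta.
    have hrev : ∀ m : Fin N, (simpleSwap ⟨j, hj⟩ m.rev) =
        (simpleSwap ⟨N - 2 - j, by omega⟩ m).rev := fun m => by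
      have := Fin.rev_injective.swap_apply (⟨N - 2 - j, by omega⟩ : Fin N)
        ⟨N - 2 - j + 1, by omega⟩ m
      simp only [simpleSwap]
      rw [← this, Equiv.swap_comm]
      congr 2 <;> ext <;> simp only [Fin.val_rev] <;> omega
    have i1 : ∀ h, Fin.rev (⟨N - 2 - j, h⟩ : Fin N) = ⟨j + 1, hj⟩ := fun h => by
      ext; simp only [Fin.val_rev]; omega
    have i2 : ∀ h, Fin.rev (⟨N - 2 - j + 1, h⟩ : Fin N) = ⟨j, by omega⟩ := fun h => by
      ext; simp only [Fin.val_rev]; omega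
    have hx : refl (x ∘ simpleSwap ⟨j, hj⟩) = refl x ∘ simpleSwap ⟨N - 2 - j, by omega⟩ := by
      ext m; simp only [refl, Function.comp_apply, hrev]
    have hc : swapCoeff γ ⟨N - 2 - j, by omega⟩ (fun j => -k j.rev) = swapCoeff γ ⟨j, hj⟩ k := by
      simp only [swapCoeff, i1, i2]
      rw [exchangeCoeff_neg, exchangeCoeff_swap, neg_neg]
    simp only [waveMinus]
    rw [hx, wavePlus_exchange γ ⟨N - 2 - j, by omega⟩ _ _ (by
      simp only [i1, i2]; exact fun h => hk (neg_injective h).symm), hc]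
    congr 3
    ext m
    simp only [Function.comp_apply, hrev]

section

variable (L γ : ℝ) {N : ℕ} (ν : ℂ) (k : Fin N → ℂ)

theorem bPlusCLM_preWave :
    bPlusCLM L γ ν N (preWave L γ k) = preWave L γ (Fin.cons ν k : Fin (N + 1) → ℂ) := by
  rw [← (isWaveFamily_wavePlus γ N).toSector_eq, ← (isWaveFamily_wavePlus γ (N + 1)).toSector_eq,
    bPlusCLM_of_continuous ν (continuous_wavePlus γ k)]
  simp only [wavePlus, Fin.cons_zero, Fin.tail_cons]

/-- Reflection turns prepending `-ν` to the reversed, negated momenta into appending `ν` to `k`. -/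
theorem bMinusCLM_preWave :
    bMinusCLM L γ ν N (preWave L γ k) = preWave L γ (Fin.snoc k ν : Fin (N + 1) → ℂ) := by
  have hc := continuous_wavePlus γ fun j => -k j.rev
  have hm : MemLp (waveMinus γ k) 2 (boxMeasure L N) :=
    memLp_of_continuous L (hc.comp continuous_refl)
  rw [← (isWaveFamily_waveMinus γ N).toSector_eq, ← (isWaveFamily_waveMinus γ (N + 1)).toSector_eq,
    bMinusCLM_toSector ν hm]
  congr 1; funext x
  rw [bMinusFun_eq]
  simp only [waveMinus, refl_refl]
  rw [← Fin.cons_self_tail (refl x), bPlusFun_cons γ _ hc, wavePlus]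
  congr 1
  · simp
  · congr 1; ext j
    simp [Fin.tail, Fin.rev_succ]

/-- Both products send `ψ_k` to the wave with momenta `(m, k, l)`: prepending and appending commute.
Boundedness extends this from the dense span. -/
theorem bMinus_comp_bPlus_of_dense
    (h : zSector L γ N = ⊤) (l m : ℂ) :
    bMinusCLM L γ l (N + 1) ∘L bPlusCLM L γ m N =
      bPlusCLM L γ m (N + 1) ∘L bMinusCLM L γ l N := by
  have hd : Dense (Submodule.span ℂ (Set.range fun k : Fin N → ℂ => preWave L γ k) :
      Set (Sector L N)) := Submodule.dense_iff_topologicalClosure_eq_top.2 h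
  refine ContinuousLinearMap.ext_on hd ?_
  rintro _ ⟨k, rfl⟩
  simp only [ContinuousLinearMap.comp_apply, bPlusCLM_preWave, bMinusCLM_preWave]
  congr 1
  exact (Fin.cons_snoc_eq_snoc_cons _ _ _).symm

end

/-! ### Plane waves are uniformly dense on the cube -/

instance (L : ℝ) (N : ℕ) : CompactSpace (cube L N) := isCompact_iff_compactSpace.1 (isCompact_cube L N)

theorem planeWave_zero {N : ℕ} (x : Fin N → ℝ) : planeWave 0 x = 1 := by simp [planeWave]

theorem planeWave_add {N : ℕ} (k k' : Fin N → ℂ) (x : Fin N → ℝ) :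
    planeWave (k + k') x = planeWave k x * planeWave k' x := by
  simp only [planeWave, ← Complex.exp_add, Pi.add_apply, add_mul, Finset.sum_add_distrib, mul_add]

theorem star_planeWave {N : ℕ} (k : Fin N → ℂ) (x : Fin N → ℝ) :
    star (planeWave k x) = planeWave (fun j => -star (k j)) x := by
  simp only [planeWave, Complex.star_def, ← Complex.exp_conj, map_mul, Complex.conj_I, map_sum,
    Complex.conj_ofReal, neg_mul, Finset.sum_neg_distrib, mul_neg]

/-- The restriction of a plane wave to the cube. -/
def planeWaveMap (L : ℝ) {N : ℕ} (k : Fin N → ℂ) : C(cube L N, ℂ) :=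
  ⟨fun x => planeWave k x, (continuous_planeWave k).comp continuous_subtype_val⟩

/-- The star subalgebra generated by the plane waves. -/
def planeWaveAlgebra (L : ℝ) (N : ℕ) : StarSubalgebra ℂ C(cube L N, ℂ) where
  toSubalgebra := Algebra.adjoin ℂ (Set.range (planeWaveMap L (N := N)))
  star_mem' := by
    change Algebra.adjoin ℂ (Set.range (planeWaveMap L (N := N))) ≤
      star (Algebra.adjoin ℂ (Set.range (planeWaveMap L (N := N))))
    refine Algebra.adjoin_le ?_
    rintro - ⟨k, rfl⟩
    exact Algebra.subset_adjoin ⟨fun j => -star (k j), ContinuousMap.ext fun x =>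
      (star_planeWave k x).symm⟩

theorem planeWaveAlgebra_eq_span (L : ℝ) (N : ℕ) :
    Subalgebra.toSubmodule (planeWaveAlgebra L N).toSubalgebra =
      Submodule.span ℂ (Set.range (planeWaveMap L (N := N))) := by
  apply Algebra.adjoin_eq_span_of_subset
  refine Set.Subset.trans ?_ Submodule.subset_span
  intro f hf
  refine Submonoid.closure_induction (fun _ => id) ⟨0, ?_⟩ ?_ hf
  · ext x; exact planeWave_zero _
  · rintro - - - - ⟨k, rfl⟩ ⟨k', rfl⟩
    exact ⟨k + k', ContinuousMap.ext fun x => planeWave_add k k' x⟩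

theorem planeWaveAlgebra_separatesPoints (L : ℝ) (N : ℕ) :
    (planeWaveAlgebra L N).SeparatesPoints := by
  intro x y hxy
  obtain ⟨j, hj⟩ : ∃ j, x.1 j ≠ y.1 j := by
    by_contra h
    push Not at h
    exact hxy (Subtype.ext (funext h))
  -- Momentum `-i` in slot `j` gives the real exponential of `x_j`, which is injective in that
  -- coordinate; a real momentum would only separate up to periods.
  refine ⟨_, ⟨planeWaveMap L (Pi.single j (-Complex.I)), Algebra.subset_adjoin ⟨_, rfl⟩, rfl⟩, ?_⟩
  have h : ∀ z : cube L N, planeWaveMap L (Pi.single j (-Complex.I)) z = (Real.exp (z.1 j) : ℂ) := by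
    intro z
    change Complex.exp _ = _
    simp only [Pi.single_apply, ite_mul, zero_mul, Finset.sum_ite_eq', Finset.mem_univ, if_true]
    rw [← mul_assoc, mul_neg, Complex.I_mul_I, neg_neg, one_mul, Complex.ofReal_exp]
  simp only [h]
  exact fun he => hj (Real.exp_injective (Complex.ofReal_injective he))

theorem exists_planeWave_approx (L : ℝ) {N : ℕ} {g : (Fin N → ℝ) → ℂ} (hg : Continuous g) {δ : ℝ}
    (hδ : 0 < δ) : ∃ (s : Finset (Fin N → ℂ)) (c : (Fin N → ℂ) → ℂ),
      ∀ x ∈ cube L N, ‖g x - ∑ k ∈ s, c k * planeWave k x‖ ≤ δ := by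
  have htop := ContinuousMap.starSubalgebra_topologicalClosure_eq_top_of_separatesPoints _
    (planeWaveAlgebra_separatesPoints L N)
  let G : C(cube L N, ℂ) := ⟨fun x => g x, hg.comp continuous_subtype_val⟩
  have hG : G ∈ closure ((planeWaveAlgebra L N : Set C(cube L N, ℂ))) := by
    rw [← StarSubalgebra.topologicalClosure_coe, htop]; trivial
  obtain ⟨f, hf, hd⟩ := Metric.mem_closure_iff.1 hG δ hδ
  have hf' : f ∈ Submodule.span ℂ (Set.range (planeWaveMap L (N := N))) := by
    rw [← planeWaveAlgebra_eq_span]; exact hf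
  obtain ⟨c, rfl⟩ := Finsupp.mem_span_range_iff_exists_finsupp.1 hf'
  refine ⟨c.support, c, fun x hx => ?_⟩
  have h1 := (ContinuousMap.dist_apply_le_dist (f := G) (g := c.sum fun k a => a • planeWaveMap L k)
    ⟨x, hx⟩).trans hd.le
  rw [dist_eq_norm] at h1
  simpa [Finsupp.sum, ContinuousMap.sum_apply, G, planeWaveMap] using h1

/-! ### Weighted estimates for deformed permutations -/

theorem integral_exp_neg_le {κ u : ℝ} (hκ : 0 < κ) (hu : 0 < u) :
    ∫ y in (0 : ℝ)..u, Real.exp (-(κ * u * y)) ≤ 1 / (κ * u) := by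
  have hd : ∀ y ∈ Set.uIcc 0 u, HasDerivAt (fun y => -(1 / (κ * u)) * Real.exp (-(κ * u * y)))
      (Real.exp (-(κ * u * y))) y := fun y _ => by
    have h1 : HasDerivAt (fun y : ℝ => -(κ * u * y)) (-(κ * u)) y := by
      simpa using ((hasDerivAt_id' y).const_mul (κ * u)).fun_neg
    refine (h1.exp.const_mul (-(1 / (κ * u)))).congr_deriv ?_
    field_simp
  rw [intervalIntegral.integral_eq_sub_of_hasDerivAt hd
    (Continuous.intervalIntegrable (by fun_prop) _ _)]
  have : 0 ≤ 1 / (κ * u) * Real.exp (-(κ * u * u)) := by positivity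
  simp only [mul_zero, neg_zero, Real.exp_zero]
  linarith

/-- The integral is at most `u`, and also at most `2 / (κ u)`, since the larger of `y` and `u - y`
is at least `u / 2`. The two bounds meet at `u = √(2 / κ)`. -/
theorem integral_gaussian_le {κ u : ℝ} (hκ : 0 < κ) (hu : 0 ≤ u) :
    ∫ y in (0 : ℝ)..u, Real.exp (-(2 * κ * (y * (u - y)))) ≤ √(2 / κ) := by
  rcases hu.eq_or_lt with rfl | hu
  · rw [intervalIntegral.integral_same]; positivity
  have hint : ∀ φ : ℝ → ℝ, Continuous φ → IntervalIntegrable φ volume 0 u :=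
    fun φ h => h.intervalIntegrable _ _
  by_cases h : u ≤ √(2 / κ)
  · refine le_trans ?_ h
    have h1 : ∫ y in (0 : ℝ)..u, Real.exp (-(2 * κ * (y * (u - y)))) ≤ ∫ _ in (0 : ℝ)..u, 1 := by
      refine intervalIntegral.integral_mono_on hu.le (hint _ (by fun_prop)) (hint _ (by fun_prop))
        fun y hy => Real.exp_le_one_iff.2 ?_
      have := mul_nonneg hy.1 (sub_nonneg.2 hy.2)
      have : 0 ≤ 2 * κ * (y * (u - y)) := by positivity
      linarith
    simpa using h1
  · rw [not_le] at h
    have h1 : ∫ y in (0 : ℝ)..u, Real.exp (-(2 * κ * (y * (u - y)))) ≤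
        ∫ y in (0 : ℝ)..u, (Real.exp (-(κ * u * y)) + Real.exp (-(κ * u * (u - y)))) := by
      refine intervalIntegral.integral_mono_on hu.le (hint _ (by fun_prop)) (hint _ (by fun_prop))
        fun y hy => ?_
      rcases le_total y (u - y) with hle | hle
      · refine le_trans (Real.exp_le_exp.2 (neg_le_neg ?_))
          (le_add_of_nonneg_right (Real.exp_pos _).le)
        have : 0 ≤ κ * y * ((u - y) - y) := mul_nonneg (mul_nonneg hκ.le hy.1) (by linarith)
        nlinarith
      · refine le_trans (Real.exp_le_exp.2 (neg_le_neg ?_))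
          (le_add_of_nonneg_left (Real.exp_pos _).le)
        have : 0 ≤ κ * (u - y) * (y - (u - y)) :=
          mul_nonneg (mul_nonneg hκ.le (sub_nonneg.2 hy.2)) (by linarith)
        nlinarith
    have h2 : ∫ y in (0 : ℝ)..u, Real.exp (-(κ * u * (u - y))) =
        ∫ y in (0 : ℝ)..u, Real.exp (-(κ * u * y)) := by
      have := intervalIntegral.integral_comp_sub_left (a := 0) (b := u)
        (fun y => Real.exp (-(κ * u * y))) u
      simpa using this
    rw [intervalIntegral.integral_add (hint _ (by fun_prop)) (hint _ (by fun_prop)), h2] at h1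
    have h3 := integral_exp_neg_le hκ hu
    refine h1.trans ((add_le_add h3 h3).trans ?_)
    have hs : √(2 / κ) * √(2 / κ) = 2 / κ := Real.mul_self_sqrt (by positivity)
    have hs0 : 0 < √(2 / κ) := Real.sqrt_pos.2 (by positivity)
    have h4 : 1 / (κ * u) + 1 / (κ * u) = (2 / κ) / u := by field_simp; norm_num
    rw [h4, div_le_iff₀ hu]
    exact hs.symm.trans_le (mul_le_mul_of_nonneg_left h.le hs0.le)

/-- The Gaussian weight. -/
def weight (κ : ℝ) {N : ℕ} (x : Fin N → ℝ) : ℝ := Real.exp (κ * ∑ j, x j ^ 2)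

theorem weight_pos (κ : ℝ) {N : ℕ} (x : Fin N → ℝ) : 0 < weight κ x := Real.exp_pos _

theorem one_le_weight {κ : ℝ} (hκ : 0 < κ) {N : ℕ} (x : Fin N → ℝ) : 1 ≤ weight κ x :=
  Real.one_le_exp (mul_nonneg hκ.le (Finset.sum_nonneg fun _ _ => sq_nonneg _))

theorem weight_comp_perm (κ : ℝ) {N : ℕ} (x : Fin N → ℝ) (σ : Equiv.Perm (Fin N)) :
    weight κ (x ∘ σ) = weight κ x := by
  rw [weight, weight, ← Equiv.sum_comp σ fun j => x j ^ 2]; rfl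

theorem comp_perm_mem_cube {L : ℝ} {N : ℕ} {x : Fin N → ℝ} (hx : x ∈ cube L N)
    (σ : Equiv.Perm (Fin N)) : x ∘ σ ∈ cube L N :=
  mem_cube.2 fun j => mem_cube.1 hx (σ j)

/-- Moving two coordinates towards each other lowers the sum of squares. This gain makes a Gaussian
weight suited to the line integrals. -/
theorem sum_sq_sub_smul {N : ℕ} (x : Fin N → ℝ) {j k : Fin N} (hjk : j ≠ k) (y : ℝ) :
    ∑ m, (x - y • (Pi.single j 1 - Pi.single k 1 : Fin N → ℝ)) m ^ 2 =
      ∑ m, x m ^ 2 - 2 * (y * ((x j - x k) - y)) := by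
  have h : ∀ m, (x - y • (Pi.single j 1 - Pi.single k 1 : Fin N → ℝ)) m ^ 2 = x m ^ 2 +
      ((if m = j then -(2 * y * x j) + y ^ 2 else 0) +
        if m = k then 2 * y * x k + y ^ 2 else 0) := fun m => by
    simp only [Pi.sub_apply, Pi.smul_apply, Pi.single_apply, smul_eq_mul]
    by_cases h1 : m = j
    · subst h1; simp [hjk]; ring
    · by_cases h2 : m = k
      · subst h2; simp [h1]; ring
      · simp [h1, h2]
  simp only [h, Finset.sum_add_distrib, Finset.sum_ite_eq', Finset.mem_univ, if_true]
  ring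

theorem sub_smul_mem_cube {L : ℝ} {N : ℕ} {x : Fin N → ℝ} (hx : x ∈ cube L N) {j k : Fin N}
    {y : ℝ} (hy : y ∈ Set.uIcc 0 (x j - x k)) :
    x - y • (Pi.single j 1 - Pi.single k 1 : Fin N → ℝ) ∈ cube L N := by
  rw [mem_cube] at *
  intro m
  have hm := hx m
  have hj := hx j
  have hk := hx k
  simp only [Pi.sub_apply, Pi.smul_apply, Pi.single_apply, smul_eq_mul]
  rcases Set.mem_uIcc.1 hy with ⟨h1, h2⟩ | ⟨h1, h2⟩ <;>
  · split_ifs with h3 h4 h4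
    · constructor <;> linarith
    · subst h3; constructor <;> linarith
    · subst h4; constructor <;> linarith
    · constructor <;> linarith

/-- Between the endpoints of the segment the weight drops by a factor `exp (-2κ y (u - y))`, whose
integral is controlled by `integral_gaussian_le`. The weighted norm is therefore small for large
`κ`, whatever the size of the cube. -/
theorem norm_lineIntegral_le {L κ : ℝ} (hκ : 0 < κ) {N : ℕ} {g : (Fin N → ℝ) → ℂ} {M : ℝ}
    (hg : ∀ x ∈ cube L N, ‖g x‖ ≤ M * weight κ x) {j k : Fin N} (hjk : j ≠ k) {x : Fin N → ℝ}
    (hx : x ∈ cube L N) :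
    ‖lineIntegral j k g x‖ ≤ √(2 / κ) * (M * weight κ x) := by
  have hM : 0 ≤ M * weight κ x := (norm_nonneg _).trans (hg x hx)
  have h1 : ‖lineIntegral j k g x‖ ≤ |∫ y in (0 : ℝ)..(x j - x k),
      M * weight κ x * Real.exp (-(2 * κ * (y * ((x j - x k) - y))))| := by
    refine intervalIntegral.norm_integral_le_abs_of_norm_le ?_
      (Continuous.intervalIntegrable (by fun_prop) _ _)
    refine (ae_restrict_mem measurableSet_uIoc).mono fun y hy => ?_
    refine (hg _ (sub_smul_mem_cube hx (Set.uIoc_subset_uIcc hy))).trans_eq ?_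
    rw [weight, weight, sum_sq_sub_smul x hjk, mul_assoc, ← Real.exp_add]
    congr 2; ring
  refine h1.trans ?_
  rw [intervalIntegral.integral_const_mul, abs_mul, abs_of_nonneg hM, mul_comm]
  refine mul_le_mul_of_nonneg_right ?_ hM
  have hpos : ∀ u, 0 ≤ u → |∫ y in (0 : ℝ)..u, Real.exp (-(2 * κ * (y * (u - y))))| ≤ √(2 / κ) :=
    fun u hu => by
      rw [abs_of_nonneg (intervalIntegral.integral_nonneg hu fun _ _ => (Real.exp_pos _).le)]
      exact integral_gaussian_le hκ hu
  rcases le_total 0 (x j - x k) with hu | hu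
  · exact hpos _ hu
  · have h2 := intervalIntegral.integral_comp_neg (a := 0) (b := -(x j - x k))
      fun y => Real.exp (-(2 * κ * (y * ((x j - x k) - y))))
    have h3 := hpos (-(x j - x k)) (neg_nonneg.2 hu)
    have h4 : ∀ y, -y * ((x j - x k) - -y) = y * (-(x j - x k) - y) := fun y => by ring
    simp only [neg_zero, neg_neg, h4] at h2
    rwa [intervalIntegral.integral_symm, ← h2, abs_neg]

/-- Each letter is a plain swap, an isometry for the permutation-invariant weight, plus a
perturbation of weighted norm at most `|γ| * √(2 / κ)`. -/
theorem norm_foldr_sub_le {L κ : ℝ} (hκ : 0 < κ) (γ : ℝ) {N : ℕ} {f : (Fin N → ℝ) → ℂ} {M : ℝ}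
    (hf : ∀ x ∈ cube L N, ‖f x‖ ≤ M * weight κ x) (w : List {j : ℕ // j + 1 < N})
    {x : Fin N → ℝ} (hx : x ∈ cube L N) :
    ‖w.foldr (deformedSwap γ) f x - f (x ∘ (w.map simpleSwap).prod)‖ ≤
      ((1 + |γ| * √(2 / κ)) ^ w.length - 1) * (M * weight κ x) := by
  set c := |γ| * √(2 / κ) with hc
  have hc0 : 0 ≤ c := by positivity
  induction w generalizing x with
  | nil => simp
  | cons j w ih =>
    set g := w.foldr (deformedSwap γ) f with hgdef
    have hg : ∀ x ∈ cube L N, ‖g x‖ ≤ ((1 + c) ^ w.length * M) * weight κ x := fun x hx => by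
      have h1 := ih hx
      have h2 := hf _ (comp_perm_mem_cube hx (w.map simpleSwap).prod)
      rw [weight_comp_perm] at h2
      have h3 := norm_le_norm_sub_add (g x) (f (x ∘ (w.map simpleSwap).prod))
      linarith
    have h1 := ih (comp_perm_mem_cube hx (simpleSwap j))
    rw [weight_comp_perm] at h1
    have h2 := norm_lineIntegral_le hκ hg (j := ⟨j.1, Nat.lt_of_succ_lt j.2⟩)
      (k := ⟨j.1 + 1, j.2⟩) (by simp) hx
    have h3 : ‖(γ : ℂ) * lineIntegral ⟨j.1, Nat.lt_of_succ_lt j.2⟩ ⟨j.1 + 1, j.2⟩ g x‖ ≤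
        c * (((1 + c) ^ w.length * M) * weight κ x) := by
      rw [norm_mul, Complex.norm_real, Real.norm_eq_abs, hc, mul_assoc]
      exact mul_le_mul_of_nonneg_left h2 (abs_nonneg _)
    rw [List.foldr_cons, deformedSwap, List.map_cons, List.prod_cons, Equiv.Perm.coe_mul,
      ← Function.comp_assoc, add_sub_right_comm]
    refine (norm_add_le _ _).trans ((add_le_add h1 h3).trans_eq ?_)
    rw [List.length_cons, pow_succ]
    ring

/-! ### Totality of the pre-wavefunctions -/

section

variable {γ : ℝ} {N : ℕ} {Φ : (Fin N → ℂ) → (Fin N → ℝ) → ℂ}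

theorem IsWaveFamily.continuous_apply (h : IsWaveFamily γ Φ) (k : Fin N → ℂ) :
    Continuous (Φ k) :=
  h.continuous.comp (by fun_prop : Continuous fun x : Fin N → ℝ => (k, x))

theorem IsWaveFamily.eq_foldr_of_antitone (h : IsWaveFamily γ Φ) (w : List {j : ℕ // j + 1 < N})
    {y : Fin N → ℝ} (hy : Antitone y) (k : Fin N → ℂ) :
    Φ k (y ∘ (w.map simpleSwap).prod) = w.foldr (deformedSwap γ) (planeWave k) y := by
  -- For `ε > 0` this breaks all ties, so the formula for strictly decreasing points passes to the
  -- limit `ε → 0`. The estimates below then hold at every point of the cube.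
  let z : ℝ → Fin N → ℝ := fun ε j => y j - ε * (j : ℕ)
  have hz : Continuous z := by fun_prop
  have hz0 : z 0 = y := by ext j; simp [z]
  have h1 : Continuous fun ε => Φ k (z ε ∘ (w.map simpleSwap).prod) :=
    (h.continuous_apply k).comp (continuous_pi fun j =>
      (_root_.continuous_apply ((w.map simpleSwap).prod j)).comp hz)
  have h2 : Continuous fun ε => w.foldr (deformedSwap γ) (planeWave k) (z ε) :=
    (continuous_foldr γ w (continuous_planeWave k)).comp hz
  have h3 : ∀ ε ∈ Set.Ioi (0 : ℝ), Φ k (z ε ∘ (w.map simpleSwap).prod) =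
      w.foldr (deformedSwap γ) (planeWave k) (z ε) := fun ε hε => by
    refine h.eq_foldr w (fun a b hab => ?_) k
    have h4 := hy hab.le
    have h5 : ((a : ℕ) : ℝ) < (b : ℕ) := by exact_mod_cast hab
    have h6 := mul_lt_mul_of_pos_left h5 (Set.mem_Ioi.1 hε)
    simp only [z]
    linarith
  have h4 := Set.EqOn.closure h3 h1 h2
  rw [closure_Ioi] at h4
  have h5 := h4 (Set.self_mem_Ici (a := (0 : ℝ)))
  simpa only [hz0] using h5

theorem foldr_sum (γ : ℝ) (w : List {j : ℕ // j + 1 < N}) (s : Finset (Fin N → ℂ))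
    (c : (Fin N → ℂ) → ℂ) :
    w.foldr (deformedSwap γ) (fun x => ∑ k ∈ s, c k * planeWave k x) =
      fun x => ∑ k ∈ s, c k * w.foldr (deformedSwap γ) (planeWave k) x := by
  classical
  induction s using Finset.induction_on with
  | empty =>
    have := foldr_linear_combination γ w (continuous_planeWave (0 : Fin N → ℂ))
      (continuous_planeWave (0 : Fin N → ℂ)) 0 0
    simpa using this
  | insert k s hk ih =>
    have hs : Continuous fun x : Fin N → ℝ => ∑ k ∈ s, c k * planeWave k x :=
      continuous_finsetSum _ fun k _ => (continuous_planeWave k).const_mul _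
    have := foldr_linear_combination γ w (continuous_planeWave k) hs (c k) 1
    simp only [one_mul, ih] at this
    simpa only [Finset.sum_insert hk] using this

/-- Sort `x` by `σ`. The wave at `x` is a deformed permutation evaluated at the sorted point, while
the corresponding undeformed permutation leads back to the plane waves at `x` itself. -/
theorem IsWaveFamily.norm_sum_sub_le (h : IsWaveFamily γ Φ) {L κ : ℝ} (hκ : 0 < κ) {m : ℕ}
    (hm : ∀ σ : Equiv.Perm (Fin N), (word σ).length ≤ m) {s : Finset (Fin N → ℂ)}
    {c : (Fin N → ℂ) → ℂ} {M : ℝ}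
    (hf : ∀ x ∈ cube L N, ‖∑ k ∈ s, c k * planeWave k x‖ ≤ M * weight κ x)
    {x : Fin N → ℝ} (hx : x ∈ cube L N) :
    ‖∑ k ∈ s, c k * Φ k x - ∑ k ∈ s, c k * planeWave k x‖ ≤
      ((1 + |γ| * √(2 / κ)) ^ m - 1) * (M * weight κ x) := by
  have hM : 0 ≤ M * weight κ x := (norm_nonneg _).trans (hf x hx)
  obtain ⟨σ, hσ⟩ : ∃ σ : Equiv.Perm (Fin N), Antitone (x ∘ σ) :=
    ⟨Tuple.sort fun j => -x j, fun a b hab =>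
      neg_le_neg_iff.1 (Tuple.monotone_sort (fun j => -x j) hab)⟩
  have hw := (exists_simpleSwap_word σ⁻¹).choose_spec
  have hxw : x = (x ∘ σ) ∘ (((word σ⁻¹).map simpleSwap).prod : Equiv.Perm (Fin N)) := by
    rw [word, hw, Function.comp_assoc, ← Equiv.Perm.coe_mul, mul_inv_cancel, Equiv.Perm.coe_one,
      Function.comp_id]
  have h1 := norm_foldr_sub_le hκ γ hf (word σ⁻¹) (comp_perm_mem_cube hx σ)
  rw [foldr_sum, weight_comp_perm, ← hxw] at h1
  simp only [← h.eq_foldr_of_antitone (word σ⁻¹) hσ, ← hxw] at h1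
  refine h1.trans (mul_le_mul_of_nonneg_right (sub_le_sub_right ?_ _) hM)
  exact pow_le_pow_right₀ (le_add_of_nonneg_right (by positivity)) (hm _)

theorem exists_weight (γ : ℝ) (m : ℕ) :
    ∃ κ : ℝ, 0 < κ ∧ (1 + |γ| * √(2 / κ)) ^ m - 1 ≤ 1 / 4 := by
  have h1 : Filter.Tendsto (fun κ : ℝ => (1 + |γ| * √(2 / κ)) ^ m - 1) Filter.atTop
      (nhds ((1 + |γ| * √0) ^ m - 1)) :=
    (((((Real.continuous_sqrt.tendsto 0).comp
      (tendsto_const_nhds.div_atTop Filter.tendsto_id)).const_mul _).const_add _).pow _).sub_const _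
  simp only [Real.sqrt_zero, mul_zero, add_zero, one_pow, sub_self] at h1
  obtain ⟨κ, h2, h3⟩ := ((h1.eventually (ge_mem_nhds (by norm_num : (0 : ℝ) < 1 / 4))).and
    (Filter.eventually_gt_atTop 0)).exists
  exact ⟨κ, h3, h2⟩

/-- Approximate by plane waves within `M / 8`, then replace each plane wave by the wave with the
same momenta. The total error `1/8 + (1/4)(9/8) = 13/32`, in units of `M`, is below one half. -/
theorem IsWaveFamily.exists_approx_half (h : IsWaveFamily γ Φ) (L : ℝ) {κ : ℝ} (hκ : 0 < κ) {m : ℕ}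
    (hm : ∀ σ : Equiv.Perm (Fin N), (word σ).length ≤ m)
    (hκm : (1 + |γ| * √(2 / κ)) ^ m - 1 ≤ 1 / 4) {g : (Fin N → ℝ) → ℂ} (hg : Continuous g) {M : ℝ}
    (hM : 0 < M) (hgM : ∀ x ∈ cube L N, ‖g x‖ ≤ M * weight κ x) :
    ∃ f ∈ Submodule.span ℂ (Set.range Φ), ∀ x ∈ cube L N, ‖g x - f x‖ ≤ M / 2 * weight κ x := by
  obtain ⟨s, c, hsc⟩ := exists_planeWave_approx L hg (by positivity : 0 < M / 8)
  refine ⟨∑ k ∈ s, c k • Φ k, Submodule.sum_mem _ fun k _ => Submodule.smul_mem _ _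
    (Submodule.subset_span ⟨k, rfl⟩), fun x hx => ?_⟩
  have h1 : ∀ x ∈ cube L N, ‖g x - ∑ k ∈ s, c k * planeWave k x‖ ≤ M / 8 * weight κ x :=
    fun x hx => (hsc x hx).trans (le_mul_of_one_le_right (by positivity) (one_le_weight hκ x))
  have h2 : ∀ x ∈ cube L N, ‖∑ k ∈ s, c k * planeWave k x‖ ≤ (M + M / 8) * weight κ x :=
    fun x hx => by
      have := norm_sub_le (g x) (g x - ∑ k ∈ s, c k * planeWave k x)
      rw [sub_sub_cancel] at this
      have := hgM x hx
      have := h1 x hx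
      linarith
  have h3 := h.norm_sum_sub_le hκ hm h2 hx
  have hW : 0 ≤ M * weight κ x := mul_nonneg hM.le (weight_pos κ x).le
  have h4 := h3.trans (mul_le_mul_of_nonneg_right hκm (by linarith))
  have h5 := h1 x hx
  have h6 := norm_sub_le (g x - ∑ k ∈ s, c k * planeWave k x)
    (∑ k ∈ s, c k * Φ k x - ∑ k ∈ s, c k * planeWave k x)
  rw [sub_sub_sub_cancel_right] at h6
  simp only [Finset.sum_apply, Pi.smul_apply, smul_eq_mul]
  linarith

theorem IsWaveFamily.continuous_of_mem_span (h : IsWaveFamily γ Φ) {f : (Fin N → ℝ) → ℂ}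
    (hf : f ∈ Submodule.span ℂ (Set.range Φ)) : Continuous f := by
  induction hf using Submodule.span_induction with
  | mem f hf => obtain ⟨k, rfl⟩ := hf; exact h.continuous_apply k
  | zero => exact continuous_zero
  | add f g _ _ hf hg => exact hf.add hg
  | smul c f _ hf => exact hf.const_smul c

theorem IsWaveFamily.exists_approx (h : IsWaveFamily γ Φ) (L : ℝ) {κ : ℝ} (hκ : 0 < κ) {m : ℕ}
    (hm : ∀ σ : Equiv.Perm (Fin N), (word σ).length ≤ m)
    (hκm : (1 + |γ| * √(2 / κ)) ^ m - 1 ≤ 1 / 4) (n : ℕ) {g : (Fin N → ℝ) → ℂ} (hg : Continuous g)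
    {M : ℝ} (hM : 0 < M) (hgM : ∀ x ∈ cube L N, ‖g x‖ ≤ M * weight κ x) :
    ∃ f ∈ Submodule.span ℂ (Set.range Φ),
      ∀ x ∈ cube L N, ‖g x - f x‖ ≤ M * (1 / 2) ^ n * weight κ x := by
  induction n generalizing g M with
  | zero => exact ⟨0, zero_mem _, by simpa using hgM⟩
  | succ n ih =>
    obtain ⟨f, hf, hfg⟩ := h.exists_approx_half L hκ hm hκm hg hM hgM
    -- Iterate on the residual, as in a Neumann series: it is again continuous, with half the bound.
    obtain ⟨f', hf', hfg'⟩ := ih (hg.sub (h.continuous_of_mem_span hf)) (half_pos hM) hfg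
    refine ⟨f + f', add_mem hf hf', fun x hx => ?_⟩
    have := hfg' x hx
    rw [Pi.add_apply, ← sub_sub, pow_succ]
    exact this.trans_eq (by ring)

theorem IsWaveFamily.exists_uniform_approx (h : IsWaveFamily γ Φ) (L : ℝ) {g : (Fin N → ℝ) → ℂ}
    (hg : Continuous g) {ε : ℝ} (hε : 0 < ε) :
    ∃ f ∈ Submodule.span ℂ (Set.range Φ), ∀ x ∈ cube L N, ‖g x - f x‖ ≤ ε := by
  obtain ⟨κ, hκ, hκm⟩ := exists_weight γ
    (Finset.univ.sup fun σ : Equiv.Perm (Fin N) => (word σ).length)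
  have hm : ∀ σ : Equiv.Perm (Fin N), (word σ).length ≤
      Finset.univ.sup fun σ : Equiv.Perm (Fin N) => (word σ).length :=
    fun σ => Finset.le_sup (f := fun σ : Equiv.Perm (Fin N) => (word σ).length) (Finset.mem_univ σ)
  obtain ⟨C, hC⟩ := (isCompact_cube L N).exists_bound_of_continuousOn hg.continuousOn
  obtain ⟨B, hB⟩ := (isCompact_cube L N).exists_bound_of_continuousOn
    (by unfold weight; fun_prop : Continuous (weight κ (N := N))).continuousOn
  have hM : 0 < max C 1 := lt_max_of_lt_right one_pos
  have hgM : ∀ x ∈ cube L N, ‖g x‖ ≤ max C 1 * weight κ x := fun x hx =>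
    ((hC x hx).trans (le_max_left _ _)).trans (le_mul_of_one_le_right hM.le (one_le_weight hκ x))
  have ht : Filter.Tendsto (fun n : ℕ => max C 1 * (1 / 2 : ℝ) ^ n * max B 1) Filter.atTop
      (nhds (max C 1 * 0 * max B 1)) :=
    ((tendsto_pow_atTop_nhds_zero_of_lt_one (by norm_num) (by norm_num)).const_mul _).mul_const _
  rw [mul_zero, zero_mul] at ht
  obtain ⟨n, hn⟩ := (ht.eventually (ge_mem_nhds hε)).exists
  obtain ⟨f, hf, hfg⟩ := h.exists_approx L hκ hm hκm n hg hM hgM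
  refine ⟨f, hf, fun x hx => (hfg x hx).trans (le_trans ?_ hn)⟩
  refine mul_le_mul_of_nonneg_left ?_ (by positivity)
  exact ((le_abs_self _).trans (hB x hx)).trans (le_max_left _ _)

theorem IsWaveFamily.toSector_mem_span (h : IsWaveFamily γ Φ) (L : ℝ) {f : (Fin N → ℝ) → ℂ}
    (hf : f ∈ Submodule.span ℂ (Set.range Φ)) :
    toSector L f ∈ Submodule.span ℂ (Set.range fun k : Fin N → ℂ => preWave L γ k) := by
  induction hf using Submodule.span_induction with
  | mem f hf =>
    obtain ⟨k, rfl⟩ := hf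
    rw [h.toSector_eq L k]
    exact Submodule.subset_span ⟨k, rfl⟩
  | zero =>
    rw [toSector_eq_of_ae (Lp.coeFn_zero ℂ 2 (boxMeasure L N))]
    exact zero_mem _
  | add f g hf hg ihf ihg =>
    have := toSector_linear_combination (memLp_of_continuous L (h.continuous_of_mem_span hf))
      (memLp_of_continuous L (h.continuous_of_mem_span hg)) 1 1
    simp only [one_mul, one_smul] at this
    exact this ▸ add_mem ihf ihg
  | smul c f hf ih =>
    have := toSector_linear_combination (memLp_of_continuous L (h.continuous_of_mem_span hf))
      (memLp_of_continuous L (h.continuous_of_mem_span hf)) c 0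
    simp only [zero_mul, add_zero, zero_smul] at this
    exact this ▸ Submodule.smul_mem _ c ih

end

/-- Continuous functions are dense in `L²`, and on the cube they are uniform limits of combinations
of wave functions, which are a.e. combinations of pre-wavefunctions. -/
theorem zSector_eq_top (L γ : ℝ) (N : ℕ) : zSector L γ N = ⊤ := by
  have h := isWaveFamily_wavePlus γ N
  have hd := BoundedContinuousFunction.toLp_denseRange (E := ℂ) (p := 2) (boxMeasure L N) ℂ
    (by norm_num)
  refine SetLike.coe_injective (Set.eq_univ_of_univ_subset ?_)
  rw [← hd.closure_range]
  refine closure_minimal ?_ (Submodule.isClosed_topologicalClosure _)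
  rintro _ ⟨g, rfl⟩
  rw [← toSector_eq_of_ae (BoundedContinuousFunction.coeFn_toLp (p := 2) (𝕜 := ℂ)
    (boxMeasure L N) g)]
  change toSector L g ∈ closure _
  refine Metric.mem_closure_iff.2 fun ε hε => ?_
  -- The factor by which a uniform bound on the cube controls the `L²` norm; the `+ 1` below keeps
  -- the quotient defined and makes the final inequality strict.
  set B : ℝ := (measureUnivNNReal (boxMeasure L N) : ℝ) ^ ((2 : ENNReal).toReal)⁻¹ with hB
  have hB0 : 0 ≤ B := by positivity
  obtain ⟨f, hf, hfg⟩ := h.exists_uniform_approx L g.continuous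
    (by positivity : 0 < ε / (B + 1))
  refine ⟨toSector L f, h.toSector_mem_span L hf, ?_⟩
  rw [dist_eq_norm]
  have h1 : ‖toSector L g - toSector L f‖ ≤ B * (ε / (B + 1)) := by
    refine Lp.norm_le_of_ae_bound (by positivity) ?_
    filter_upwards [Lp.coeFn_sub (toSector L g) (toSector L f),
      coeFn_toSector (memLp_of_continuous L g.continuous),
      coeFn_toSector (memLp_of_continuous L (h.continuous_of_mem_span hf)), ae_mem_cube L N]
      with x h1 h2 h3 h4
    rw [h1, Pi.sub_apply, h2, h3]
    exact hfg x h4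
  refine h1.trans_lt ?_
  rw [mul_div_assoc', div_lt_iff₀ (by positivity)]
  nlinarith

/-! ### Endomorphisms of the space of finite vectors -/

theorem mem_zFin {L γ : ℝ} {f : SectorSeq L} : f ∈ zFin L γ ↔ ∃ M : ℕ, ∀ N, M < N → f N = 0 := by
  rw [zFin, Submodule.mem_inf, Submodule.mem_pi]
  simp only [zSector_eq_top, Submodule.mem_top, implies_true, and_true]
  rfl

section

variable {L : ℝ} (γ : ℝ)

/-- The endomorphism of `zFin` given by operators on the sectors. -/
def diagEnd (T : ∀ N, Sector L N →L[ℂ] Sector L N) : Module.End ℂ (zFin L γ) where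
  toFun f := ⟨fun N => T N (f.1 N), by
    obtain ⟨M, hM⟩ := mem_zFin.1 f.2
    exact mem_zFin.2 ⟨M, fun N hN => by rw [hM N hN, map_zero]⟩⟩
  map_add' f g := Subtype.ext (funext fun N => map_add (T N) _ _)
  map_smul' c f := Subtype.ext (funext fun N => map_smul (T N) _ _)

/-- The endomorphism of `zFin` given by operators that raise the number of particles. -/
def upEnd (T : ∀ N, Sector L N →L[ℂ] Sector L (N + 1)) : Module.End ℂ (zFin L γ) where
  toFun f := ⟨fun
      | 0 => 0
      | N + 1 => T N (f.1 N), by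
    obtain ⟨M, hM⟩ := mem_zFin.1 f.2
    refine mem_zFin.2 ⟨M + 1, fun N hN => ?_⟩
    cases N with
    | zero => rfl
    | succ N => exact (congrArg (T N) (hM N (by omega))).trans (map_zero _)⟩
  map_add' f g := Subtype.ext (funext fun
    | 0 => (add_zero _).symm
    | N + 1 => map_add (T N) _ _)
  map_smul' c f := Subtype.ext (funext fun
    | 0 => (smul_zero (A := Sector L 0) c).symm
    | N + 1 => map_smul (T N) _ _)

/-- The endomorphism of `zFin` given by operators that lower the number of particles. -/
def downEnd (T : ∀ N, Sector L (N + 1) →L[ℂ] Sector L N) : Module.End ℂ (zFin L γ) where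
  toFun f := ⟨fun N => T N (f.1 (N + 1)), by
    obtain ⟨M, hM⟩ := mem_zFin.1 f.2
    exact mem_zFin.2 ⟨M, fun N hN => by rw [hM (N + 1) (by omega), map_zero]⟩⟩
  map_add' f g := Subtype.ext (funext fun N => map_add (T N) _ _)
  map_smul' c f := Subtype.ext (funext fun N => map_smul (T N) _ _)

variable {γ}

theorem diagEnd_apply (T : ∀ N, Sector L N →L[ℂ] Sector L N) (f : zFin L γ) (N : ℕ) :
    (diagEnd γ T f).1 N = T N (f.1 N) := rfl

theorem upEnd_apply_zero (T : ∀ N, Sector L N →L[ℂ] Sector L (N + 1)) (f : zFin L γ) :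
    (upEnd γ T f).1 0 = 0 := rfl

theorem upEnd_apply_succ (T : ∀ N, Sector L N →L[ℂ] Sector L (N + 1)) (f : zFin L γ) (N : ℕ) :
    (upEnd γ T f).1 (N + 1) = T N (f.1 N) := rfl

theorem downEnd_apply (T : ∀ N, Sector L (N + 1) →L[ℂ] Sector L N) (f : zFin L γ) (N : ℕ) :
    (downEnd γ T f).1 N = T N (f.1 (N + 1)) := rfl

theorem end_ext {S T : Module.End ℂ (zFin L γ)} (h : ∀ f N, (S f).1 N = (T f).1 N) : S = T :=
  LinearMap.ext fun f => Subtype.ext (funext fun N => h f N)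

theorem coe_sub_apply (f g : zFin L γ) (N : ℕ) : (f - g).1 N = f.1 N - g.1 N := rfl

theorem coe_smul_apply (c : ℂ) (f : zFin L γ) (N : ℕ) : (c • f).1 N = c • f.1 N := rfl

/-! ### Commutators on finite vectors from relations between sectors -/

section

variable {A A' : ∀ N, Sector L N →L[ℂ] Sector L N} {c : ℂ}

theorem lie_diagEnd_eq_zero (h : ∀ N, A N ∘L A' N = A' N ∘L A N) :
    ⁅diagEnd γ A, diagEnd γ A'⁆ = 0 := end_ext fun f N => by
  rw [Ring.lie_def]
  simp only [LinearMap.sub_apply, Module.End.mul_apply, coe_sub_apply, diagEnd_apply]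
  exact sub_eq_zero.2 (DFunLike.congr_fun (h N) (f.1 N))

variable {B B' : ∀ N, Sector L N →L[ℂ] Sector L (N + 1)}

theorem lie_upEnd_eq_zero (h : ∀ N, B (N + 1) ∘L B' N = B' (N + 1) ∘L B N) :
    ⁅upEnd γ B, upEnd γ B'⁆ = 0 := end_ext fun f N => by
  rw [Ring.lie_def]
  simp only [LinearMap.sub_apply, Module.End.mul_apply, coe_sub_apply]
  -- Raising twice leaves nothing in the sectors with fewer than two particles; only from two on
  -- does the relation `h` enter.
  rcases N with _ | _ | N
  · exact sub_self (0 : Sector L 0)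
  · exact (congrArg₂ (· - ·) (map_zero (B 0)) (map_zero (B' 0))).trans (sub_self _)
  · exact sub_eq_zero.2 (DFunLike.congr_fun (h N) (f.1 N))

theorem lie_diagEnd_upEnd
    (h : ∀ N, A (N + 1) ∘L B N - B N ∘L A N = c • (B' N ∘L A' N - B N ∘L A N)) :
    ⁅diagEnd γ A, upEnd γ B⁆ =
      c • (upEnd γ B' * diagEnd γ A' - upEnd γ B * diagEnd γ A) := end_ext fun f N => by
  rw [Ring.lie_def]
  simp only [LinearMap.sub_apply, LinearMap.smul_apply, Module.End.mul_apply, coe_sub_apply,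
    coe_smul_apply, diagEnd_apply]
  cases N with
  | zero => simp only [upEnd_apply_zero, map_zero, sub_self, smul_zero]
  | succ N => exact DFunLike.congr_fun (h N) (f.1 N)

theorem lie_upEnd_diagEnd
    (h : ∀ N, B N ∘L A N - A (N + 1) ∘L B N = c • (A' (N + 1) ∘L B' N - A (N + 1) ∘L B N)) :
    ⁅upEnd γ B, diagEnd γ A⁆ =
      c • (diagEnd γ A' * upEnd γ B' - diagEnd γ A * upEnd γ B) := end_ext fun f N => by
  rw [Ring.lie_def]
  simp only [LinearMap.sub_apply, LinearMap.smul_apply, Module.End.mul_apply, coe_sub_apply,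
    coe_smul_apply, diagEnd_apply]
  cases N with
  | zero => simp only [upEnd_apply_zero, map_zero, sub_self, smul_zero]
  | succ N => exact DFunLike.congr_fun (h N) (f.1 N)

variable {C C' : ∀ N, Sector L (N + 1) →L[ℂ] Sector L N}

theorem lie_downEnd_eq_zero (h : ∀ N, C N ∘L C' (N + 1) = C' N ∘L C (N + 1)) :
    ⁅downEnd γ C, downEnd γ C'⁆ = 0 := end_ext fun f N => by
  rw [Ring.lie_def]
  simp only [LinearMap.sub_apply, Module.End.mul_apply, coe_sub_apply, downEnd_apply]
  exact sub_eq_zero.2 (DFunLike.congr_fun (h N) (f.1 (N + 2)))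

theorem lie_diagEnd_downEnd
    (h : ∀ N, A N ∘L C N - C N ∘L A (N + 1) = c • (C' N ∘L A' (N + 1) - C N ∘L A (N + 1))) :
    ⁅diagEnd γ A, downEnd γ C⁆ =
      c • (downEnd γ C' * diagEnd γ A' - downEnd γ C * diagEnd γ A) := end_ext fun f N => by
  rw [Ring.lie_def]
  exact DFunLike.congr_fun (h N) (f.1 (N + 1))

theorem lie_downEnd_diagEnd
    (h : ∀ N, C N ∘L A (N + 1) - A N ∘L C N = c • (A' N ∘L C' N - A N ∘L C N)) :
    ⁅downEnd γ C, diagEnd γ A⁆ =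
      c • (diagEnd γ A' * downEnd γ C' - diagEnd γ A * downEnd γ C) := end_ext fun f N => by
  rw [Ring.lie_def]
  exact DFunLike.congr_fun (h N) (f.1 (N + 1))

end

end

theorem exchangeCoeff_eq (γ : ℝ) (l m : ℂ) :
    exchangeCoeff γ l m = -(Complex.I * γ / (l - m)) := by
  rw [exchangeCoeff, ← div_div, Complex.div_I]
  ring

end QNLS

end

theorem mainTheorem4 (L : ℝ) (hL : 0 < L) (γ : ℝ) :
    ∃ a bp bm cp cm d : ℂ → Module.End ℂ (zFin L γ),
      -- the six operators restrict to linear endomorphisms of `zFin L γ` ...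
      (∀ (ν : ℂ) (f : zFin L γ),
        (a ν f : SectorSeq L) = aOp L γ ν f ∧
        (bp ν f : SectorSeq L) = bPlusOp L γ ν f ∧
        (bm ν f : SectorSeq L) = bMinusOp L γ ν f ∧
        (cp ν f : SectorSeq L) = cPlusOp L γ ν f ∧
        (cm ν f : SectorSeq L) = cMinusOp L γ ν f ∧
        (d ν f : SectorSeq L) = dOp L γ ν f) ∧
      -- ... which satisfy the commutation relations
      (∀ l m : ℂ, ⁅a l, a m⁆ = 0 ∧ ⁅bm l, bp m⁆ = 0 ∧ ⁅cm l, cp m⁆ = 0 ∧ ⁅d l, d m⁆ = 0) ∧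
      (∀ l m : ℂ, l ≠ m →
        ⁅a l, bp m⁆ = (-(Complex.I * γ / (l - m))) • (bp l * a m - bp m * a l) ∧
        ⁅bp l, a m⁆ = (-(Complex.I * γ / (l - m))) • (a l * bp m - a m * bp l) ∧
        ⁅d l, bm m⁆ = (Complex.I * γ / (l - m)) • (bm l * d m - bm m * d l) ∧
        ⁅bm l, d m⁆ = (Complex.I * γ / (l - m)) • (d l * bm m - d m * bm l) ∧
        ⁅a l, cp m⁆ = (Complex.I * γ / (l - m)) • (cp l * a m - cp m * a l) ∧
        ⁅cp l, a m⁆ = (Complex.I * γ / (l - m)) • (a l * cp m - a m * cp l) ∧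
        ⁅d l, cm m⁆ = (-(Complex.I * γ / (l - m))) • (cm l * d m - cm m * d l) ∧
        ⁅cm l, d m⁆ = (-(Complex.I * γ / (l - m))) • (d l * cm m - d m * cm l)) := by
  refine ⟨fun ν => diagEnd γ (aCLM L γ ν), fun ν => upEnd γ (bPlusCLM L γ ν),
    fun ν => upEnd γ (bMinusCLM L γ ν), fun ν => downEnd γ (cPlusCLM L γ ν),
    fun ν => downEnd γ (cMinusCLM L γ ν), fun ν => diagEnd γ (dCLM L γ ν), fun ν f => ?_,
    fun l m => ?_, fun l m h => ?_⟩
  -- Each component is the class of its own representative, so the bounded operators, computed on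
  -- classes of square-integrable functions, give the values of the integral formulas.
  · have hf : ∀ N, toSector L ((f : SectorSeq L) N) = (f : SectorSeq L) N :=
      fun N => toSector_coeFn _
    have hm : ∀ N, MemLp ((f : SectorSeq L) N) 2 (boxMeasure L N) := fun N => Lp.memLp _
    refine ⟨funext fun N => ?_, funext fun N => ?_, funext fun N => ?_, funext fun N => ?_,
      funext fun N => ?_, funext fun N => ?_⟩
    · rw [diagEnd_apply, aOp, ← aCLM_toSector ν (hm N), hf]
    · cases N with
      | zero => rfl
      | succ N => rw [upEnd_apply_succ, bPlusOp, ← bPlusCLM_toSector ν (hm N), hf]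
    · cases N with
      | zero => rfl
      | succ N => rw [upEnd_apply_succ, bMinusOp, ← bMinusCLM_toSector ν (hm N), hf]
    · rw [downEnd_apply, cPlusOp, ← cPlusCLM_toSector ν (hm (N + 1)), hf]
    · rw [downEnd_apply, cMinusOp, ← cMinusCLM_toSector ν (hm (N + 1)), hf]
    · rw [diagEnd_apply, dOp, ← dCLM_toSector ν (hm N), hf]
  -- Among these four relations, totality enters the proof only for `b⁻` with `b⁺` and, by
  -- transposition, for `c⁻` with `c⁺`.
  · have hb := fun N => bMinus_comp_bPlus_of_dense L γ (zSector_eq_top L γ N)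
    exact ⟨lie_diagEnd_eq_zero fun N => aCLM_comm L γ N l m, lie_upEnd_eq_zero fun N => hb N l m,
      lie_downEnd_eq_zero fun N => cMinus_comp_cPlus L γ N (hb N) l m,
      lie_diagEnd_eq_zero fun N => dCLM_comm L γ N l m⟩
  · have hκ : Complex.I * γ / (l - m) = -exchangeCoeff γ l m := by rw [exchangeCoeff_eq, neg_neg]
    rw [hκ, neg_neg]
    exact ⟨lie_diagEnd_upEnd fun N => commutator_a_bPlus L γ N h,
      lie_upEnd_diagEnd fun N => commutator_bPlus_a L γ N h,
      lie_diagEnd_upEnd fun N => commutator_d_bMinus L γ N h,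
      lie_upEnd_diagEnd fun N => commutator_bMinus_d L γ N h,
      lie_diagEnd_downEnd fun N => commutator_a_cPlus L γ N h,
      lie_downEnd_diagEnd fun N => commutator_cPlus_a L γ N h,
      lie_diagEnd_downEnd fun N => commutator_d_cMinus L γ N h,
      lie_downEnd_diagEnd fun N => commutator_cMinus_d L γ N h⟩
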